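/- **Data model.** A *scheme* is a hereditarily finite set $X$ built from flat attributes, in which no flat attribute and no scheme occurs more than once (for schemes this just says that $\emptyset$ occurs at most once); its elements are flat attributes $x$ and nested attributes $Y$ (schemes). Write $\mathrm{flatsub}(X)$ and $\mathrm{sub}(X)$ for the sets of all flat attributes and of all schemes occurring in $X$ at any depth. A *tuple* over $X$ maps each flat attribute of $X$ to a scalar from a fixed non-empty domain and each nested attribute $Y\in X$ to a non-empty relation over $Y$; a *relation* over $X$ is a finite bag of tuples over $X$, and its cardinality is its number of tuples. A *dictionary* $D\colon \vec y\to Z$ is a finite map from $\vec y$-tuples ($\vec y$ a finite set of flat attributes) to non-empty relations over $Z$; its cardinality is its number of keys. **Nested Semijoin Algebra (NSA).** Expressions are the well-typed terms built from input relation symbols $R$ with flat schemes by: selection $\sigma_{\theta(\vec y)}$ with a constant-time predicate on flat attributes $\vec y\subseteq X$; (bag) projection $\pi_Y$, $Y\subseteq X$; renaming $\rho_\varphi$ by a permutation $\varphi$ of the flat attributes, applied hereditarily; bag union of relations over the same scheme; bag difference of relations over the same flat scheme; group-by $\gamma_{\vec y}$ for $\vec y\subseteq X$, sending $R\colon X$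 to the dictionary over $\vec y\to Z$, $Z=X\setminus\vec y$, whose keys are the $\vec y$-tuples occurring in $R$ and which maps $k\mapsto\pi_Z(\sigma_{\vec y=k}R)$; nested semijoin of $R\colon X$ with $D\colon\vec y\to Z$, where $\vec y\subseteq X$, $\mathrm{flatsub}(Z)\cap \mathrm{flatsub}(X)=\emptyset$ and $X\cup\{Z\}$ is a scheme in which no nested attribute is repeated, which keeps the $t\in R$ with $t|_{\vec y}\in\mathrm{dom}(D)$ and extends each by $Z\mapsto D(t|_{\vec y})$; unnest $\mu_Y(R)=\{\!\{ s|_{X\setminus\{Y\}}\circ t : s\in R,\ t\in s(Y)\}\!\}$ for a nested attribute $Y\in X$; and flatten $\mu^*$, which unnests all nested attributes recursively and returns a relation over $\mathrm{flatsub}(X)$. An operator is *non-shrinking* if on all its legal inputs the output cardinality is at least the cardinality of its largest input; otherwise it is *shrinking*. An expression is *2-phase* if, in its syntax tree, no shrinking operator is an ancestor of an unnest or a flatten. **Shredded processing.** A relation $R\colon X$ is represented by a column-wise stored physical relation, a store and a selection vector. The physical relation has one column per flat attribute of $X$ and, for each nested $Y\in X$, a column of linked-list heads and a column of weights (the number of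 tuples obtained by flattening the inner relation). The store has, for every $Y\in\mathrm{sub}(X)$, one such physical relation with an additional successor-pointer column, so that inner relations are linked lists of rows. The selection vector lists the valid rows; for flat $X$ all rows are valid and the store is empty. A dictionary is represented by a hash map from keys to (list head, weight) together with a store. Shredded processing evaluates an expression bottom-up on these representations: selection and nested semijoin (hash probe) compute new selection vectors, the semijoin also adding a head and a weight column; group-by is a hash build that threads the rows of each group into a linked list and sums their weights; unnest traverses the lists of the valid rows and gathers the columns at the visited positions; flatten recursively computes position and repetition vectors from the lists and weights, and gathers each flat column once; projection drops columns; renaming renames columns; union concatenates columns and shifts pointers; difference counts tuples in a hash map. Rows that are not valid are removed whenever a result has a flat scheme. Time is the number of unit-cost RAM steps, where hash-map insertion and lookup take $O(1)$ steps per tuple. **Theorem.** Let $e$ be a 2-phase NSA expression over flat input relations whose output scheme is flat. There is a constant $c$, depending only on $e$ and the schemes of its input relations, such that for every database $db$, given by physical representations of its flat relations, shredded processing of $e$ yields the shredded representation of the flat relation $e(db)$ after at most $c\cdot(\mathrm{IN}+\mathrm{OUT}+1)$ steps, where $\mathrm{IN}$ is the sum of the cardinalities of the input relations of $e$ in $db$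 and $\mathrm{OUT}$ is the cardinality of $e(db)$. That is, $e$ is evaluated in time $O(\mathrm{IN}+\mathrm{OUT})$ in data complexity. -/

import Mathlib

noncomputable section

namespace NSA

open scoped Classical

/-! ## Schemes: hereditarily finite sets over the flat attributes -/

/-- Finite trees whose nodes carry a finite set of flat attributes and a list of subtrees. -/
inductive PreScheme (A : Type) : Type where
  | mk (flat : Finset A) (nested : List (PreScheme A)) : PreScheme A

namespace PreScheme

variable {A : Type}

/-- The flat attributes at the root. -/
def flat : PreScheme A → Finset A
  | mk F _ => F

/-- The list of subtrees of the root. -/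
def nested : PreScheme A → List (PreScheme A)
  | mk _ L => L

/-- An arbitrary linear order, only used to pick one listing of each finite set of subtrees. -/
instance : LinearOrder (PreScheme A) := linearOrderOfSTO WellOrderingRel

/-- Hereditarily, the list of subtrees is the strictly increasing listing of a finite set. -/
inductive Canonical : PreScheme A → Prop where
  | mk (F : Finset A) (L : List (PreScheme A)) :
      L.SortedLT → (∀ p ∈ L, Canonical p) → Canonical (PreScheme.mk F L)

theorem Canonical.sorted {p : PreScheme A} (h : p.Canonical) : p.nested.SortedLT := by
  cases h; assumption

theorem Canonical.of_mem {p q : PreScheme A} (h : p.Canonical) (hq : q ∈ p.nested) :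
    q.Canonical := by
  cases h with
  | mk F L _ h2 => exact h2 q hq

end PreScheme

/-- A set `X` built hereditarily from flat attributes: its elements are the flat attributes
`X.flat` and the nested attributes `X.nested`, which are again such sets.
`Scheme.equiv` says that `X` is given by an arbitrary pair of these two finite sets. -/
@[ext] structure Scheme (A : Type) : Type where
  ofTree ::
  tree : PreScheme A
  canonical : tree.Canonical

namespace Scheme

variable {A : Type}

/-- The flat attributes that are elements of `X`. -/
def flat (X : Scheme A) : Finset A := X.tree.flat

/-- The nested attributes (schemes) that are elements of `X`. -/
def nested (X : Scheme A) : Finset (Scheme A) :=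
  (X.tree.nested.attach.map fun p => (⟨p.1, X.canonical.of_mem p.2⟩ : Scheme A)).toFinset

/-- The scheme with the given flat and nested elements. -/
def mk (F : Finset A) (N : Finset (Scheme A)) : Scheme A :=
  ⟨.mk F ((N.image tree).sort (· ≤ ·)), .mk _ _ (Finset.sortedLT_sort _) (by
    intro p hp
    simp only [Finset.mem_sort, Finset.mem_image] at hp
    obtain ⟨q, _, rfl⟩ := hp
    exact q.canonical)⟩

theorem mem_nested {X Y : Scheme A} : Y ∈ X.nested ↔ Y.tree ∈ X.tree.nested := by
  simp only [nested, List.mem_toFinset, List.mem_map, List.mem_attach, true_and]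
  constructor
  · rintro ⟨p, rfl⟩
    exact p.2
  · intro h
    exact ⟨⟨Y.tree, h⟩, rfl⟩

theorem flat_mk (F : Finset A) (N : Finset (Scheme A)) : (mk F N).flat = F := rfl

theorem nested_mk (F : Finset A) (N : Finset (Scheme A)) : (mk F N).nested = N := by
  ext Y
  rw [mem_nested]
  show Y.tree ∈ (N.image tree).sort (· ≤ ·) ↔ Y ∈ N
  simp only [Finset.mem_sort, Finset.mem_image]
  constructor
  · rintro ⟨q, hq, h⟩
    rwa [← Scheme.ext h]
  · intro h
    exact ⟨Y, h, rfl⟩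

theorem mk_flat_nested (X : Scheme A) : mk X.flat X.nested = X := by
  obtain ⟨⟨F, L⟩, hX⟩ := X
  apply Scheme.ext
  show PreScheme.mk F _ = PreScheme.mk F L
  congr 1
  refine (Finset.sortedLT_sort _).eq_of_mem_iff hX.sorted ?_
  intro p
  simp only [Finset.mem_sort, Finset.mem_image, mem_nested]
  constructor
  · rintro ⟨q, hq, rfl⟩
    exact hq
  · intro hp
    exact ⟨⟨p, hX.of_mem hp⟩, hp, rfl⟩

/-- A scheme is the same thing as a finite set of flat attributes together with a finite set of
schemes. -/
def equiv : Scheme A ≃ Finset A × Finset (Scheme A) where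
  toFun X := (X.flat, X.nested)
  invFun p := mk p.1 p.2
  left_inv := mk_flat_nested
  right_inv p := Prod.ext (flat_mk p.1 p.2) (nested_mk p.1 p.2)

/-- The size of the underlying tree; it decreases when passing to a nested attribute. -/
def size (X : Scheme A) : ℕ := sizeOf X.tree

theorem size_lt {X Y : Scheme A} (h : Y ∈ X.nested) : Y.size < X.size := by
  rw [mem_nested] at h
  obtain ⟨⟨F, L⟩, hX⟩ := X
  have h1 : sizeOf Y.tree < sizeOf L := List.sizeOf_lt_of_mem h
  show sizeOf Y.tree < sizeOf (PreScheme.mk F L)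
  simp only [PreScheme.mk.sizeOf_spec]
  omega

/-- `X` has no nested attributes. -/
def IsFlat (X : Scheme A) : Prop := X.nested = ∅

/-- A finite set of flat attributes, as a scheme. -/
def ofFlat (F : Finset A) : Scheme A := mk F ∅

/-- All flat attributes that occur in `X`, at any depth. -/
def flatsub (X : Scheme A) : Finset A :=
  X.flat ∪ X.nested.attach.biUnion fun Y => flatsub Y.1
termination_by X.size
decreasing_by exact size_lt Y.2

/-- All schemes that occur in `X`, at any depth (`X` itself excluded). -/
def sub (X : Scheme A) : Finset (Scheme A) :=
  X.nested ∪ X.nested.attach.biUnion fun Y => sub Y.1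
termination_by X.size
decreasing_by exact size_lt Y.2

/-- The result of applying a permutation of the flat attributes hereditarily to `X`. -/
def rename (φ : Equiv.Perm A) (X : Scheme A) : Scheme A :=
  mk (X.flat.image φ) (X.nested.attach.image fun Y => rename φ Y.1)
termination_by X.size
decreasing_by exact size_lt Y.2

/-- Inclusion of schemes, as sets. -/
def Included (Y X : Scheme A) : Prop := Y.flat ⊆ X.flat ∧ Y.nested ⊆ X.nested

/-- `X \ y`, for a set `y` of flat attributes. -/
def remove (X : Scheme A) (y : Finset A) : Scheme A := mk (X.flat \ y) X.nested

/-- `X ∪ {Z}`. -/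
def extend (X Z : Scheme A) : Scheme A := mk X.flat (insert Z X.nested)

/-- `(X \ {Y}) ∪ Y`. -/
def unnest (X Y : Scheme A) : Scheme A :=
  mk (X.flat ∪ Y.flat) (X.nested.erase Y ∪ Y.nested)

theorem nested_ofFlat (F : Finset A) : (ofFlat F).nested = ∅ := nested_mk _ _

theorem flat_rename (φ : Equiv.Perm A) (X : Scheme A) :
    (X.rename φ).flat = X.flat.image φ := by
  rw [rename, flat_mk]

theorem nested_rename (φ : Equiv.Perm A) (X : Scheme A) :
    (X.rename φ).nested = X.nested.image (rename φ) := by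
  rw [rename, nested_mk]
  ext Y
  simp

theorem mem_flat_rename {φ : Equiv.Perm A} {X : Scheme A} {a : A} :
    a ∈ (X.rename φ).flat ↔ φ.symm a ∈ X.flat := by
  rw [flat_rename, Finset.mem_image]
  constructor
  · rintro ⟨b, hb, rfl⟩
    rwa [Equiv.symm_apply_apply]
  · intro h
    exact ⟨_, h, Equiv.apply_symm_apply φ a⟩

theorem mem_nested_rename {φ : Equiv.Perm A} {X W : Scheme A} :
    W ∈ (X.rename φ).nested ↔ ∃ Y ∈ X.nested, Y.rename φ = W := by
  rw [nested_rename, Finset.mem_image]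

theorem mem_nested_extend {X Z W : Scheme A} :
    W ∈ (X.extend Z).nested ↔ W = Z ∨ W ∈ X.nested := by
  rw [extend, nested_mk, Finset.mem_insert]

theorem mem_nested_unnest {X Y W : Scheme A} :
    W ∈ (X.unnest Y).nested ↔ W ∈ X.nested.erase Y ∨ W ∈ Y.nested := by
  rw [unnest, nested_mk, Finset.mem_union]

theorem mem_flatsub {X : Scheme A} {a : A} :
    a ∈ X.flatsub ↔ a ∈ X.flat ∨ ∃ Y ∈ X.nested, a ∈ Y.flatsub := by
  rw [flatsub]
  simp

theorem remove_included (X : Scheme A) (y : Finset A) : (X.remove y).Included X :=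
  ⟨Finset.sdiff_subset, by rw [remove, nested_mk]⟩

end Scheme

/-! ## Nested relations and dictionaries -/

variable {A : Type}

/-- A tuple over `X`: a scalar for every flat attribute of `X`, and for every nested attribute `Y`
of `X` a non-empty finite bag of tuples over `Y`. -/
def Tup (V : Type) (X : Scheme A) : Type :=
  (X.flat → V) × ((Y : X.nested) → {r : Multiset (Tup V Y.1) // r ≠ 0})
termination_by X.size
decreasing_by exact Scheme.size_lt Y.2

namespace Tup

variable {V : Type} {X : Scheme A}

/-- Tuples unfolded one level. -/
def equiv (V : Type) (X : Scheme A) :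
    Tup V X ≃ (X.flat → V) × ((Y : X.nested) → {r : Multiset (Tup V Y.1) // r ≠ 0}) :=
  Equiv.cast (by rw [Tup])

/-- The tuple with the given scalars and inner relations. -/
def mk (f : X.flat → V) (g : (Y : X.nested) → {r : Multiset (Tup V Y.1) // r ≠ 0}) : Tup V X :=
  (equiv V X).symm (f, g)

/-- The scalar at a flat attribute. -/
def val (t : Tup V X) (a : X.flat) : V := (equiv V X t).1 a

/-- The inner relation at a nested attribute. -/
def rel (t : Tup V X) (Y : X.nested) : {r : Multiset (Tup V Y.1) // r ≠ 0} := (equiv V X t).2 Y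

/-- Transport of a non-empty relation along an equality of schemes. -/
def castRel {Y Z : Scheme A} (h : Y = Z) (r : {r : Multiset (Tup V Y) // r ≠ 0}) :
    {r : Multiset (Tup V Z) // r ≠ 0} := h ▸ r

/-- A tuple over a flat scheme. -/
def mkFlat (hX : X.IsFlat) (f : X.flat → V) : Tup V X :=
  mk f fun Y => absurd (hX ▸ Y.2) (Finset.notMem_empty Y.1)

/-- Restriction of a tuple to a set of flat attributes. -/
def key (y : Finset A) (hy : y ⊆ X.flat) (t : Tup V X) : y → V := fun a => t.val ⟨a.1, hy a.2⟩

/-- Restriction of a tuple to a subset of its scheme. -/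
def restrict {Y : Scheme A} (h : Y.Included X) (t : Tup V X) : Tup V Y :=
  mk (fun a => t.val ⟨a.1, h.1 a.2⟩) (fun Z => t.rel ⟨Z.1, h.2 Z.2⟩)

/-- `t ∘ {Z ↦ r}`. -/
def extend (Z : Scheme A) (t : Tup V X) (r : {r : Multiset (Tup V Z) // r ≠ 0}) :
    Tup V (X.extend Z) :=
  mk (fun a => t.val a) fun W =>
    if h : W.1 = Z then castRel h.symm r
    else t.rel ⟨W.1, (Scheme.mem_nested_extend.1 W.2).resolve_left h⟩

/-- `s` restricted to `X \ {Y}`, concatenated with `t`. -/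
def concat (Y : Scheme A) (s : Tup V X) (t : Tup V Y) : Tup V (X.unnest Y) :=
  mk
    (fun a => if h : a.1 ∈ X.flat then s.val ⟨a.1, h⟩
      else t.val ⟨a.1, (Finset.mem_union.1 a.2).resolve_left h⟩)
    (fun W => if h : W.1 ∈ X.nested.erase Y then s.rel ⟨W.1, Finset.mem_of_mem_erase h⟩
      else t.rel ⟨W.1, (Scheme.mem_nested_unnest.1 W.2).resolve_left h⟩)

theorem exists_of_mem_rename {φ : Equiv.Perm A} (W : (X.rename φ).nested) :
    ∃ Y : X.nested, Y.1.rename φ = W.1 := by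
  obtain ⟨Y, hY, h⟩ := Scheme.mem_nested_rename.1 W.2
  exact ⟨⟨Y, hY⟩, h⟩

/-- Renaming of the flat attributes of a tuple, hereditarily. The inner relation at `W` is the
renaming of the one at the nested attribute `Y` with `φ(Y) = W`. -/
def rename (φ : Equiv.Perm A) (X : Scheme A) (t : Tup V X) : Tup V (X.rename φ) :=
  mk
    (fun a => t.val ⟨φ.symm a.1, Scheme.mem_flat_rename.1 a.2⟩)
    (fun W =>
      let Y := Classical.choose (exists_of_mem_rename W)
      let r : {r : Multiset (Tup V (Y.1.rename φ)) // r ≠ 0} :=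
        ⟨(t.rel Y).1.map (rename φ Y.1), by
          intro h
          exact (t.rel Y).2 (Multiset.map_eq_zero.1 h)⟩
      castRel (Classical.choose_spec (exists_of_mem_rename W)) r)
termination_by X.size
decreasing_by exact Scheme.size_lt (Classical.choose (exists_of_mem_rename W)).2

theorem exists_of_mem_flatsub (a : X.flatsub) (h : a.1 ∉ X.flat) :
    ∃ Y : X.nested, a.1 ∈ Y.1.flatsub := by
  obtain ⟨Y, hY, ha⟩ := (Scheme.mem_flatsub.1 a.2).resolve_left h
  exact ⟨⟨Y, hY⟩, ha⟩

/-- Complete flattening of a tuple: `μ*(s) = {s[x]} × μ*(s(Y₁)) × ⋯ × μ*(s(Yₖ))`, where `x` are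
the flat and `Y₁, …, Yₖ` the nested attributes of `X`. -/
def flatten (X : Scheme A) (s : Tup V X) : Multiset (X.flatsub → V) :=
  (Multiset.pi X.nested.attach.val fun Y => (s.rel Y).1.bind (flatten Y.1)).map
    fun g a =>
      if h : a.1 ∈ X.flat then s.val ⟨a.1, h⟩
      else g (Classical.choose (exists_of_mem_flatsub a h)) (Finset.mem_attach X.nested _)
        ⟨a.1, Classical.choose_spec (exists_of_mem_flatsub a h)⟩
termination_by X.size
decreasing_by exact Scheme.size_lt Y.2

end Tup

/-- A relation over `X`: a finite bag of tuples. -/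
abbrev Rel (V : Type) (X : Scheme A) : Type := Multiset (Tup V X)

/-- A dictionary over `y → Z`: a finite mapping from `y`-tuples to non-empty relations over `Z`.
The keys are the elements of the support; the value `0` means that there is no entry. -/
abbrev Dict (V : Type) (y : Finset A) (Z : Scheme A) : Type := (y → V) →₀ Rel V Z

/-- The types of expressions: relations over a scheme, and dictionaries. -/
inductive Ty (A : Type) : Type where
  | rel (X : Scheme A) : Ty A
  | dict (y : Finset A) (Z : Scheme A) : Ty A

/-- The relations, respectively dictionaries, of a type. -/
abbrev Val (V : Type) : Ty A → Type
  | .rel X => Rel V X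
  | .dict y Z => Dict V y Z

/-- The cardinality: number of tuples of a relation (outermost bag), number of keys of a
dictionary. -/
def Val.card {V : Type} : {τ : Ty A} → Val V τ → ℕ
  | .rel _, R => Multiset.card R
  | .dict _ _, D => D.support.card

/-! ## The nested semijoin algebra -/

/-- The unary operators, with their typing rules. -/
inductive Op1 (A V : Type) : Ty A → Ty A → Type where
  /-- `σ_θ(y)`, for a predicate `θ` on `y`-tuples. -/
  | select (X : Scheme A) (y : Finset A) (hy : y ⊆ X.flat) (θ : (y → V) → Bool) :
      Op1 A V (.rel X) (.rel X)
  /-- `π_Y`. -/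
  | project (X Y : Scheme A) (h : Y.Included X) : Op1 A V (.rel X) (.rel Y)
  /-- `ρ_φ`. -/
  | rename (X : Scheme A) (φ : Equiv.Perm A) : Op1 A V (.rel X) (.rel (X.rename φ))
  /-- group-by on `y`, with `Z = X \ y`. -/
  | groupBy (X : Scheme A) (y : Finset A) (hy : y ⊆ X.flat) :
      Op1 A V (.rel X) (.dict y (X.remove y))
  /-- `μ_Y`. -/
  | unnest (X Y : Scheme A) (h : Y ∈ X.nested) : Op1 A V (.rel X) (.rel (X.unnest Y))
  /-- `μ*`. -/
  | flatten (X : Scheme A) : Op1 A V (.rel X) (.rel (.ofFlat X.flatsub))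

/-- The binary operators, with their typing rules. For the nested semijoin, `X` is compatible with
`y → Z`; the condition `hsub` says that no nested attribute occurs twice in `X ∪ {Z}` (since no
flat attribute occurs twice, this means that the empty scheme does not occur twice). -/
inductive Op2 (A V : Type) : Ty A → Ty A → Ty A → Type where
  /-- bag union. -/
  | union (X : Scheme A) : Op2 A V (.rel X) (.rel X) (.rel X)
  /-- bag difference, of flat relations. -/
  | diff (X : Scheme A) (hX : X.IsFlat) : Op2 A V (.rel X) (.rel X) (.rel X)
  /-- nested semijoin. -/
  | semijoin (X : Scheme A) (y : Finset A) (Z : Scheme A) (hy : y ⊆ X.flat)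
      (hflat : Disjoint Z.flatsub X.flatsub) (hsub : Disjoint (insert Z Z.sub) X.sub) :
      Op2 A V (.rel X) (.dict y Z) (.rel (X.extend Z))

/-- Group-by: the keys are the `y`-tuples occurring in `R`, and the key `k` is mapped to
`π_Z(σ_{y = k}(R))`. -/
def groupByRel {V : Type} (X : Scheme A) (y : Finset A) (hy : y ⊆ X.flat) (R : Rel V X) :
    Dict V y (X.remove y) :=
  Finsupp.onFinset (R.map (Tup.key y hy)).toFinset
    (fun k => (R.filter fun t => t.key y hy = k).map (Tup.restrict (X.remove_included y)))
    (by
      intro k hk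
      rw [Multiset.mem_toFinset, Multiset.mem_map]
      by_contra hcon
      push Not at hcon
      apply hk
      rw [Multiset.map_eq_zero, Multiset.filter_eq_nil]
      exact fun t ht => hcon t ht)

/-- Nested semijoin: every tuple of `R` whose key occurs in `D` is extended by the relation stored
there. -/
def semijoinRel {V : Type} (X : Scheme A) (y : Finset A) (Z : Scheme A) (hy : y ⊆ X.flat)
    (R : Rel V X) (D : Dict V y Z) : Rel V (X.extend Z) :=
  R.filterMap fun t =>
    if h : D (t.key y hy) ≠ 0 then some (t.extend Z ⟨D (t.key y hy), h⟩) else none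

/-- Semantics of the unary operators. -/
def Op1.sem {V : Type} : {τ τ' : Ty A} → Op1 A V τ τ' → Val V τ → Val V τ'
  | _, _, .select X y hy θ => fun (R : Rel V X) => R.filter fun t => θ (t.key y hy) = true
  | _, _, .project X _ h => fun (R : Rel V X) => R.map (Tup.restrict h)
  | _, _, .rename X φ => fun (R : Rel V X) => R.map (Tup.rename φ X)
  | _, _, .groupBy X y hy => groupByRel X y hy
  | _, _, .unnest X Y h => fun (R : Rel V X) =>
      R.bind fun s => (s.rel ⟨Y, h⟩).1.map (Tup.concat Y s)
  | _, _, .flatten X => fun (R : Rel V X) =>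
      R.bind fun s => (Tup.flatten X s).map (Tup.mkFlat (Scheme.nested_ofFlat _))

/-- Semantics of the binary operators. -/
def Op2.sem {V : Type} : {τ₁ τ₂ τ' : Ty A} → Op2 A V τ₁ τ₂ τ' → Val V τ₁ → Val V τ₂ → Val V τ'
  | _, _, _, .union X => fun (R S : Rel V X) => R + S
  | _, _, _, .diff X _ => fun (R S : Rel V X) => R - S
  | _, _, _, .semijoin X y Z hy _ _ => semijoinRel X y Z hy

/-- The output cardinality is never smaller than the input cardinality. -/
def Op1.NonShrinking {V : Type} {τ τ' : Ty A} (f : Op1 A V τ τ') : Prop :=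
  ∀ v : Val V τ, v.card ≤ (f.sem v).card

/-- The output cardinality is never smaller than that of the larger input. -/
def Op2.NonShrinking {V : Type} {τ₁ τ₂ τ' : Ty A} (f : Op2 A V τ₁ τ₂ τ') : Prop :=
  ∀ (v : Val V τ₁) (w : Val V τ₂), max v.card w.card ≤ (f.sem v w).card

/-- The operator is an unnest or a flatten. -/
def Op1.IsUnnest {V : Type} : {τ τ' : Ty A} → Op1 A V τ τ' → Prop
  | _, _, .unnest _ _ _ => True
  | _, _, .flatten _ => True
  | _, _, _ => False

/-- Well-typed expressions over input relation symbols `R : Sym` with flat schemes `sch R`. -/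
inductive Expr {A : Type} (V : Type) {Sym : Type} (sch : Sym → Finset A) : Ty A → Type where
  | base (R : Sym) : Expr V sch (.rel (.ofFlat (sch R)))
  | app1 {τ τ' : Ty A} (f : Op1 A V τ τ') (e : Expr V sch τ) : Expr V sch τ'
  | app2 {τ₁ τ₂ τ' : Ty A} (f : Op2 A V τ₁ τ₂ τ') (e₁ : Expr V sch τ₁) (e₂ : Expr V sch τ₂) :
      Expr V sch τ'

/-- A database assigns to every symbol a flat relation. -/
abbrev Database {A : Type} (V : Type) {Sym : Type} (sch : Sym → Finset A) : Type :=
  (R : Sym) → Rel V (Scheme.ofFlat (sch R))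

namespace Expr

variable {V Sym : Type} {sch : Sym → Finset A}

/-- The value `e(db)` of an expression. -/
def eval (db : Database V sch) : {τ : Ty A} → Expr V sch τ → Val V τ
  | _, base R => db R
  | _, app1 f e => f.sem (e.eval db)
  | _, app2 f e₁ e₂ => f.sem (e₁.eval db) (e₂.eval db)

/-- The input relation symbols of an expression. -/
def symbols : {τ : Ty A} → Expr V sch τ → Finset Sym
  | _, base R => {R}
  | _, app1 _ e => e.symbols
  | _, app2 _ e₁ e₂ => e₁.symbols ∪ e₂.symbols

/-- The total cardinality of the input relations of an expression. -/
def inCard {τ : Ty A} (e : Expr V sch τ) (db : Database V sch) : ℕ :=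
  ∑ R ∈ e.symbols, Multiset.card (db R)

/-- An unnest or flatten operator occurs in the expression. -/
def HasUnnest : {τ : Ty A} → Expr V sch τ → Prop
  | _, base _ => False
  | _, app1 f e => f.IsUnnest ∨ e.HasUnnest
  | _, app2 _ e₁ e₂ => e₁.HasUnnest ∨ e₂.HasUnnest

/-- Every unnest and flatten operator has only non-shrinking operators as ancestors. -/
def TwoPhase : {τ : Ty A} → Expr V sch τ → Prop
  | _, base _ => True
  | _, app1 f e => e.TwoPhase ∧ (e.HasUnnest → f.NonShrinking)
  | _, app2 f e₁ e₂ =>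
      e₁.TwoPhase ∧ e₂.TwoPhase ∧ (e₁.HasUnnest ∨ e₂.HasUnnest → f.NonShrinking)

end Expr

/-! ## RAM programs with unit costs

A program returning an `α` is modelled by its result and the number of steps it takes. Access to
vectors and hash maps, arithmetic on numbers and every loop iteration cost one step. -/

/-- A result together with the number of steps needed to compute it. -/
structure Cost (α : Type) : Type where
  val : α
  time : ℕ

namespace Cost

instance : Monad Cost where
  pure a := ⟨a, 0⟩
  bind x f := ⟨(f x.val).val, x.time + (f x.val).time⟩

/-- A result that takes `n` steps. -/
def steps {α : Type} (n : ℕ) (a : α) : Cost α := ⟨a, n⟩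

/-- `for i in l do s := body s i`. -/
def loop {ι σ : Type} : List ι → σ → (σ → ι → Cost σ) → Cost σ
  | [], s, _ => steps 1 s
  | i :: l, s, body => do
      let s ← steps 1 s
      let s ← body s i
      loop l s body

end Cost

open Cost

section Primitives

variable {α : Type}

/-- `v[i]` -/
def rd [Inhabited α] (v : Array α) (i : ℕ) : Cost α := steps 1 (v.getD i default)

/-- `v[i] := a` -/
def wr (v : Array α) (i : ℕ) (a : α) : Cost (Array α) := steps 1 (v.setIfInBounds i a)

/-- `v.append(a)` -/
def push (v : Array α) (a : α) : Cost (Array α) := steps 1 (v.push a)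

/-- `[a] * n` -/
def fill (n : ℕ) (a : α) : Cost (Array α) := steps (n + 1) (Array.replicate n a)

/-- A fresh vector containing the entries of `u` followed by those of `v`. -/
def append (u v : Array α) : Cost (Array α) := steps (u.size + v.size + 1) (u ++ v)

def add (m n : ℕ) : Cost ℕ := steps 1 (m + n)

def mul (m n : ℕ) : Cost ℕ := steps 1 (m * n)

def div (m n : ℕ) : Cost ℕ := steps 1 (m / n)

/-- The vector of the entries of `v` at the positions listed in `p`. -/
def take [Inhabited α] (v : Array α) (p : Array ℕ) : Cost (Array α) :=
  loop p.toList #[] fun c i => do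
    let a ← rd v i
    push c a

/-- The vector of all positions below `n`. -/
def allSel (n : ℕ) : Cost (Array ℕ) := loop (List.range n) #[] fun c i => push c i

/-- A hash map with keys `K` and values `W`. -/
def HashMap (K W : Type) : Type := K → Option W

/-- The empty hash map. -/
def HashMap.new (K W : Type) : Cost (HashMap K W) := steps 1 fun _ => none

def HashMap.lookup {K W : Type} (h : HashMap K W) (k : K) : Cost (Option W) := steps 1 (h k)

def HashMap.insert {K W : Type} (h : HashMap K W) (k : K) (w : W) : Cost (HashMap K W) :=
  steps 1 (Function.update h k (some w))

end Primitives

/-! ## Shredded representations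

Positions start at `0`; a pointer is an `Option ℕ`, with `none` in the role of the null pointer. -/

/-- A physical relation with `len` rows: named columns for flat attributes, for every nested
attribute `Y` a column `hd Y` of list heads and a column `wt Y` of weights, and a column `nxt` of
successor pointers. Columns that are not part of the scheme at hand are irrelevant. -/
structure Phys (A V : Type) : Type where
  len : ℕ
  col : A → Array V
  hd : Scheme A → Array (Option ℕ)
  wt : Scheme A → Array ℕ
  nxt : Array (Option ℕ)

/-- A store: for every nested attribute `Y` a physical relation holding the linked lists of tuples
over `Y`. -/
abbrev Store (A V : Type) : Type := Scheme A → Phys A V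

/-- The shredded representation of a nested relation: physical relation, store, and selection
vector of the positions of the valid rows. -/
structure Shred (A V : Type) : Type where
  phys : Phys A V
  store : Store A V
  sel : Array ℕ

/-- The shredded representation of a dictionary: a hash map that maps the keys to the head of a
linked list in the store, and its weight. -/
structure ShredDict (A V : Type) (y : Finset A) : Type where
  map : HashMap (y → V) (ℕ × ℕ)
  store : Store A V

/-- The shredded values of a type. -/
abbrev PVal (V : Type) : Ty A → Type
  | .rel _ => Shred A V
  | .dict y _ => ShredDict A V y

section Physical

variable {V : Type}

/-- A physical relation with `n` rows and no columns. -/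
def Phys.new (A V : Type) (n : ℕ) : Phys A V := ⟨n, fun _ => #[], fun _ => #[], fun _ => #[], #[]⟩

/-- The store without entries. -/
def Store.empty (A V : Type) : Store A V := fun _ => Phys.new A V 0

/-- The physical relation that has only the columns for the elements of `X` (by reference). -/
def Phys.columns (P : Phys A V) (X : Scheme A) : Cost (Phys A V) :=
  steps (X.flat.card + 2 * X.nested.card + 1)
    { len := P.len
      col := fun a => if a ∈ X.flat then P.col a else #[]
      hd := fun Y => if Y ∈ X.nested then P.hd Y else #[]
      wt := fun Y => if Y ∈ X.nested then P.wt Y else #[]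
      nxt := #[] }

variable [Inhabited V]

/-- The `y`-tuple in row `i`. -/
def Phys.readKey (P : Phys A V) (y : Finset A) (i : ℕ) : Cost (y → V) :=
  steps (y.card + 1) fun a => (P.col a.1).getD i default

/-- Add to `O` the columns of `P` for the flat attributes `F` and the nested attributes `N`,
rearranged according to the position vector `p`. -/
def Phys.takeInto (O P : Phys A V) (F : Finset A) (N : Finset (Scheme A)) (p : Array ℕ) :
    Cost (Phys A V) := do
  let O ← loop F.toList O fun O a => do
    let c ← take (P.col a) p
    pure { O with col := Function.update O.col a c }
  loop N.toList O fun O Y => do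
    let h ← take (P.hd Y) p
    let w ← take (P.wt Y) p
    pure { O with hd := Function.update O.hd Y h, wt := Function.update O.wt Y w }

/-- Remove the rows that are not selected, if there are any. -/
def compact (X : Scheme A) (P : Phys A V) (sel : Array ℕ) : Cost (Phys A V × Array ℕ) := do
  if (← steps 1 (sel.size < P.len)) then
    let O ← (Phys.new A V sel.size).takeInto P X.flat X.nested sel
    let s ← allSel sel.size
    pure (O, s)
  else
    pure (P, sel)

/-- The vector whose `i`-th entry is the product of the weights in row `i`. -/
def multiplyWeights (P : Phys A V) (X : Scheme A) : Cost (Array ℕ) := do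
  let w ← fill P.len 1
  loop X.nested.toList w fun w Y =>
    loop (List.range P.len) w fun w i => do
      let m ← rd w i
      let n ← rd (P.wt Y) i
      let k ← mul m n
      wr w i k

/-- Follow the `nxt` pointers from a given one to the end of the list. The first argument bounds
the number of nodes (it only serves to make the function total: a list in a physical relation has
at most as many nodes as there are rows). -/
def chase (nxt : Array (Option ℕ)) : ℕ → Option ℕ → Cost (List ℕ)
  | _, none => steps 1 []
  | 0, some _ => steps 1 []
  | n + 1, some j => do
      let k ← rd nxt j
      let l ← chase nxt n k
      steps 1 (j :: l)

/-- The positions in the store of the elements of the inner relation `Y` of row `i`. -/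
def itr (P : Phys A V) (S : Store A V) (Y : Scheme A) (i : ℕ) : Cost (List ℕ) := do
  let c ← rd (P.hd Y) i
  chase (S Y).nxt (S Y).len c

/-! ## Physical operators -/

/-- Selection. -/
def physSelect (X : Scheme A) (y : Finset A) (θ : (y → V) → Bool) (R : Shred A V) :
    Cost (Shred A V) := do
  let s ← loop R.sel.toList #[] fun s i => do
    let k ← R.phys.readKey y i
    let b ← steps 1 (θ k)
    if b then push s i else pure s
  if X.IsFlat then
    let (O, s) ← compact X R.phys s
    pure ⟨O, R.store, s⟩
  else
    pure ⟨R.phys, R.store, s⟩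

/-- Projection of a relation over `X` to `Y ⊆ X`. -/
def physProject (X Y : Scheme A) (R : Shred A V) : Cost (Shred A V) := do
  let P ← R.phys.columns Y
  let S ← steps (X.sub.card + 1) fun Z => if Z ∈ Y.sub then R.store Z else Phys.new A V 0
  if Y.IsFlat then
    let (O, s) ← compact Y P R.sel
    pure ⟨O, S, s⟩
  else
    pure ⟨P, S, R.sel⟩

/-- Renaming of the columns of a physical relation. -/
def Phys.rename (φ : Equiv.Perm A) (P : Phys A V) : Phys A V :=
  { len := P.len
    col := fun a => P.col (φ.symm a)
    hd := fun Y => P.hd (Y.rename φ.symm)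
    wt := fun Y => P.wt (Y.rename φ.symm)
    nxt := P.nxt }

/-- Renaming; it touches column names only. -/
def physRename (X : Scheme A) (φ : Equiv.Perm A) (R : Shred A V) : Cost (Shred A V) :=
  steps (X.flatsub.card + 3 * X.sub.card + 1)
    ⟨R.phys.rename φ, fun Y => (R.store (Y.rename φ.symm)).rename φ, R.sel⟩

/-- Group-by: hash build. -/
def physGroupBy (X : Scheme A) (y : Finset A) (R : Shred A V) : Cost (ShredDict A V y) := do
  let w ← multiplyWeights R.phys X
  let nxt ← fill R.phys.len none
  let h ← HashMap.new (y → V) (ℕ × ℕ)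
  let (h, nxt) ← loop R.sel.toList (h, nxt) fun (h, nxt) i => do
    let k ← R.phys.readKey y i
    let wi ← rd w i
    match ← h.lookup k with
    | some (j, v) =>
        let nxt ← wr nxt i (some j)
        let v ← add v wi
        let h ← h.insert k (i, v)
        pure (h, nxt)
    | none =>
        let h ← h.insert k (i, wi)
        pure (h, nxt)
  let P ← R.phys.columns (X.remove y)
  let S ← steps 1 (Function.update R.store (X.remove y) { P with nxt := nxt })
  pure ⟨h, S⟩

/-- Unnest. -/
def physUnnest (X Y : Scheme A) (R : Shred A V) : Cost (Shred A V) := do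
  let (p, q) ← loop R.sel.toList ((#[], #[]) : Array ℕ × Array ℕ) fun (p, q) i => do
    let js ← itr R.phys R.store Y i
    loop js (p, q) fun (p, q) j => do
      let p ← push p i
      let q ← push q j
      pure (p, q)
  let O ← (Phys.new A V p.size).takeInto R.phys X.flat (X.nested.erase Y) p
  let O ← O.takeInto (R.store Y) Y.flat Y.nested q
  let S ← steps 1 (Function.update R.store Y (Phys.new A V 0))
  let s ← allSel p.size
  pure ⟨O, S, s⟩

/-- Produce the columns of the flat attributes of `X` in a flattened relation: row `i` of `P`,
listed in `pos`, is repeated `rep * w[i]` times. -/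
def generate (X : Scheme A) (P : Phys A V) (pos rep w : Array ℕ) (O : Phys A V) :
    Cost (Phys A V) := do
  let p ← loop (List.range pos.size) (#[] : Array ℕ) fun p row => do
    let i ← rd pos row
    let r ← rd rep row
    let wi ← rd w i
    let n ← mul r wi
    loop (List.range n) p fun p _ => push p i
  { O with len := p.size }.takeInto P X.flat ∅ p

/-- Completely flatten the rows of `P` listed in `pos`, repeating every resulting tuple as many
times (consecutively) as the matching entry of `rep` says. The nested attributes are treated one
after the other; `w[i]` is the total weight of the attributes yet to come, and `out` the total
weight of those already treated. -/
def rflatten (S : Store A V) (X : Scheme A) (P : Phys A V) (pos rep : Array ℕ) (O : Phys A V) :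
    Cost (Phys A V) := do
  let w ← multiplyWeights P X
  let O ← generate X P pos rep w O
  let out ← fill pos.size 1
  let (O, _, _) ← loop X.nested.attach.toList (O, w, out) fun (O, w, out) Y => do
    let w ← loop (List.range P.len) w fun w i => do
      let m ← rd w i
      let n ← rd (P.wt Y.1) i
      let k ← div m n
      wr w i k
    let (npos, nrep, out) ← loop (List.range pos.size)
        ((#[], #[], out) : Array ℕ × Array ℕ × Array ℕ) fun (npos, nrep, out) row => do
      let i ← rd pos row
      let r ← rd rep row
      let wi ← rd w i
      let m ← mul r wi
      let n ← rd out row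
      let (npos, nrep) ← loop (List.range n) (npos, nrep) fun (npos, nrep) _ => do
        let js ← itr P S Y.1 i
        loop js (npos, nrep) fun (npos, nrep) j => do
          let npos ← push npos j
          let nrep ← push nrep m
          pure (npos, nrep)
      let v ← rd (P.wt Y.1) i
      let n ← mul n v
      let out ← wr out row n
      pure (npos, nrep, out)
    let O ← rflatten S Y.1 (S Y.1) npos nrep O
    pure (O, w, out)
  pure O
termination_by X.size
decreasing_by exact Scheme.size_lt Y.2

/-- Flatten. -/
def physFlatten (X : Scheme A) (R : Shred A V) : Cost (Shred A V) := do
  let rep ← fill R.sel.size 1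
  let O ← rflatten R.store X R.phys R.sel rep (Phys.new A V 0)
  let s ← allSel O.len
  pure ⟨O, Store.empty A V, s⟩

/-- Shift all non-null pointers of a vector. -/
def offset (n : ℕ) (v : Array (Option ℕ)) : Cost (Array (Option ℕ)) :=
  loop v.toList #[] fun c p => do
    let p ← steps 1 (p.map (· + n))
    push c p

/-- Shift the list heads in a physical relation over `Y`, so that they refer to stores that have
been placed behind those of `S`. -/
def fixHeads (S : Store A V) (Y : Scheme A) (T : Phys A V) : Cost (Phys A V) :=
  loop Y.nested.toList T fun T Z => do
    let h ← offset (S Z).len (T.hd Z)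
    pure { T with hd := Function.update T.hd Z h }

/-- Concatenation of two physical relations, without their `nxt` columns. -/
def Phys.concat (X : Scheme A) (P Q : Phys A V) : Cost (Phys A V) := do
  let n ← add P.len Q.len
  let O ← loop X.flat.toList (Phys.new A V n) fun O a => do
    let c ← append (P.col a) (Q.col a)
    pure { O with col := Function.update O.col a c }
  loop X.nested.toList O fun O Y => do
    let h ← append (P.hd Y) (Q.hd Y)
    let w ← append (P.wt Y) (Q.wt Y)
    pure { O with hd := Function.update O.hd Y h, wt := Function.update O.wt Y w }

/-- Bag union. -/
def physUnion (X : Scheme A) (R T : Shred A V) : Cost (Shred A V) := do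
  let (P, _) ← compact X R.phys R.sel
  let (Q, _) ← compact X T.phys T.sel
  let S ← loop X.sub.toList (Store.empty A V) fun S Y => do
    let U ← fixHeads R.store Y (T.store Y)
    let O ← Phys.concat Y (R.store Y) U
    let m ← offset (R.store Y).len U.nxt
    let m ← append (R.store Y).nxt m
    pure (Function.update S Y { O with nxt := m })
  let Q ← fixHeads R.store X Q
  let O ← Phys.concat X P Q
  let s ← allSel O.len
  pure ⟨O, S, s⟩

/-- Bag difference of flat relations, by counting the tuples of `T` in a hash map. -/
def physDiff (X : Scheme A) (R T : Shred A V) : Cost (Shred A V) := do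
  let h ← HashMap.new (X.flat → V) ℕ
  let h ← loop T.sel.toList h fun h i => do
    let k ← T.phys.readKey X.flat i
    let n := (← h.lookup k).getD 0
    let n ← add n 1
    h.insert k n
  let (p, _) ← loop R.sel.toList ((#[] : Array ℕ), h) fun (p, h) i => do
    let k ← R.phys.readKey X.flat i
    match ← h.lookup k with
    | some (n + 1) =>
        let h ← h.insert k n
        pure (p, h)
    | _ =>
        let p ← push p i
        pure (p, h)
  let O ← (Phys.new A V p.size).takeInto R.phys X.flat ∅ p
  let s ← allSel p.size
  pure ⟨O, R.store, s⟩

/-- Nested semijoin: hash probe. -/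
def physSemijoin (X : Scheme A) (y : Finset A) (Z : Scheme A) (R : Shred A V)
    (D : ShredDict A V y) : Cost (Shred A V) := do
  let hd ← fill R.phys.len (none : Option ℕ)
  let wt ← fill R.phys.len 0
  let (s, hd, wt) ← loop R.sel.toList ((#[] : Array ℕ), hd, wt) fun (s, hd, wt) i => do
    let k ← R.phys.readKey y i
    match ← D.map.lookup k with
    | some (j, w) =>
        let s ← push s i
        let hd ← wr hd i (some j)
        let wt ← wr wt i w
        pure (s, hd, wt)
    | none => pure (s, hd, wt)
  let S ← steps (X.sub.card + Z.sub.card + 1) fun Y => if Y ∈ X.sub then R.store Y else D.store Y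
  pure ⟨{ R.phys with hd := Function.update R.phys.hd Z hd
                      wt := Function.update R.phys.wt Z wt }, S, s⟩

/-- Implementation of the unary operators on shredded representations. -/
def Op1.phys : {τ τ' : Ty A} → Op1 A V τ τ' → PVal V τ → Cost (PVal V τ')
  | _, _, .select X y _ θ => physSelect X y θ
  | _, _, .project X Y _ => physProject X Y
  | _, _, .rename X φ => physRename X φ
  | _, _, .groupBy X y _ => physGroupBy X y
  | _, _, .unnest X Y _ => physUnnest X Y
  | _, _, .flatten X => physFlatten X

/-- Implementation of the binary operators on shredded representations. -/
def Op2.phys : {τ₁ τ₂ τ' : Ty A} → Op2 A V τ₁ τ₂ τ' → PVal V τ₁ → PVal V τ₂ → Cost (PVal V τ')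
  | _, _, _, .union X => physUnion X
  | _, _, _, .diff X _ => physDiff X
  | _, _, _, .semijoin X y Z _ _ _ => physSemijoin X y Z

/-- Shredded processing of an expression on physical input relations. -/
def Expr.run {Sym : Type} {sch : Sym → Finset A} (pdb : Sym → Phys A V) :
    {τ : Ty A} → Expr V sch τ → Cost (PVal V τ)
  | _, .base R => do
      let P ← (pdb R).columns (.ofFlat (sch R))
      let s ← allSel P.len
      pure (⟨P, Store.empty A V, s⟩ : Shred A V)
  | _, .app1 f e => do
      let v ← e.run pdb
      f.phys v
  | _, .app2 f e₁ e₂ => do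
      let v ← e₁.run pdb
      let w ← e₂.run pdb
      f.phys v w

/-- A physical relation represents a flat relation `R` over `X`: its columns have length `len`, and
`R` is the bag of its rows. -/
def Phys.Represents {X : Scheme A} (P : Phys A V) (hX : X.IsFlat) (R : Rel V X) : Prop :=
  (∀ a ∈ X.flat, (P.col a).size = P.len) ∧
    R = (Multiset.range P.len).map fun i =>
      Tup.mkFlat hX fun a => (P.col a.1).getD i default

/-- The shredded representations of a flat relation: all rows are selected. -/
def Shred.Represents {X : Scheme A} (T : Shred A V) (hX : X.IsFlat) (R : Rel V X) : Prop :=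
  T.phys.Represents hX R ∧ T.sel = Array.range T.phys.len

end Physical

end NSA

end

noncomputable section

namespace NSA

open scoped Classical

section

namespace Cost

variable {α β ι σ : Type}

@[simp] theorem val_pure (a : α) : (pure a : Cost α).val = a := rfl

@[simp] theorem time_pure (a : α) : (pure a : Cost α).time = 0 := rfl

@[simp] theorem val_bind (x : Cost α) (f : α → Cost β) : (x >>= f).val = (f x.val).val := rfl

@[simp] theorem time_bind (x : Cost α) (f : α → Cost β) :
    (x >>= f).time = x.time + (f x.val).time := rfl

@[simp] theorem val_steps (n : ℕ) (a : α) : (steps n a).val = a := rfl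

@[simp] theorem time_steps (n : ℕ) (a : α) : (steps n a).time = n := rfl

@[simp] theorem val_loop (l : List ι) (s : σ) (body : σ → ι → Cost σ) :
    (loop l s body).val = l.foldl (fun s i => (body s i).val) s := by
  induction l generalizing s with
  | nil => rfl
  | cons i l ih => simp [loop, ih]

/-- Invariant rule for loops: values and running time. -/
theorem loop_rule {l : List ι} {s : σ} {body : σ → ι → Cost σ} (I : List ι → σ → Prop)
    (b : ι → ℕ) (h0 : I [] s)
    (h : ∀ pre i post s, l = pre ++ i :: post → I pre s →
      I (pre ++ [i]) (body s i).val ∧ (body s i).time ≤ b i) :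
    I l (loop l s body).val ∧ (loop l s body).time ≤ (l.map fun i => b i + 1).sum + 1 := by
  suffices H : ∀ (post pre : List ι) (s : σ), l = pre ++ post → I pre s →
      I l (loop post s body).val ∧
        (loop post s body).time ≤ (post.map fun i => b i + 1).sum + 1 from H l [] s rfl h0
  intro post
  induction post with
  | nil =>
    intro pre s hl hI
    rw [List.append_nil] at hl
    subst hl
    exact ⟨hI, le_refl _⟩
  | cons i post ih =>
    intro pre s hl hI
    obtain ⟨h1, h2⟩ := h pre i post s hl hI
    obtain ⟨h3, h4⟩ := ih (pre ++ [i]) (body s i).val (by simp [hl]) h1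
    refine ⟨h3, ?_⟩
    simp only [loop, time_bind, time_steps, val_steps, List.map_cons, List.sum_cons]
    omega

theorem time_loop_le_sum {l : List ι} {s : σ} {body : σ → ι → Cost σ} (b : ι → ℕ)
    (h : ∀ i ∈ l, ∀ s, (body s i).time ≤ b i) :
    (loop l s body).time ≤ (l.map fun i => b i + 1).sum + 1 :=
  (loop_rule (fun _ _ => True) b trivial fun pre i post s hl _ =>
    ⟨trivial, h i (by simp [hl]) s⟩).2

theorem time_loop_le {l : List ι} {s : σ} {body : σ → ι → Cost σ} (b : ℕ)
    (h : ∀ i ∈ l, ∀ s, (body s i).time ≤ b) :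
    (loop l s body).time ≤ l.length * (b + 1) + 1 := by
  have := time_loop_le_sum (s := s) (fun _ => b) h
  simpa using this

end Cost

open Cost

section Primitives

variable {α : Type}

theorem sum_map_const_add {ι : Type} (l : List ι) (b : ι → ℕ) (c d : ℕ) :
    (l.map fun i => c * b i + d).sum = c * (l.map b).sum + d * l.length := by
  induction l with
  | nil => simp
  | cons i l ih => simp [ih]; ring

theorem foldl_push (l : List ι) (f : ι → α) (c : Array α) :
    l.foldl (fun c i => c.push (f i)) c = c ++ (l.map f).toArray := by
  induction l generalizing c with
  | nil => simp
  | cons i l ih => simp [ih]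

/-- The entries of `v` at the positions `p`. -/
def gather [Inhabited α] (v : Array α) (p : Array ℕ) : Array α := p.map fun i => v.getD i default

@[simp] theorem size_gather [Inhabited α] (v : Array α) (p : Array ℕ) :
    (gather v p).size = p.size := by simp [gather]

theorem gather_toArray [Inhabited α] (v : Array α) (p : List ℕ) :
    gather v p.toArray = (p.map fun i => v.getD i default).toArray := by simp [gather]

theorem getD_gather [Inhabited α] (v : Array α) (p : Array ℕ) (m : ℕ) (hm : m < p.size) :
    (gather v p).getD m default = v.getD (p.getD m default) default := by
  simp [gather, Array.getD_eq_getD_getElem?, hm]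

@[simp] theorem val_rd [Inhabited α] (v : Array α) (i : ℕ) : (rd v i).val = v.getD i default := rfl
@[simp] theorem time_rd [Inhabited α] (v : Array α) (i : ℕ) : (rd v i).time = 1 := rfl
@[simp] theorem val_wr (v : Array α) (i : ℕ) (a : α) : (wr v i a).val = v.setIfInBounds i a := rfl
@[simp] theorem time_wr (v : Array α) (i : ℕ) (a : α) : (wr v i a).time = 1 := rfl
@[simp] theorem val_push (v : Array α) (a : α) : (push v a).val = v.push a := rfl
@[simp] theorem time_push (v : Array α) (a : α) : (push v a).time = 1 := rfl
@[simp] theorem val_fill (n : ℕ) (a : α) : (fill n a).val = Array.replicate n a := rfl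
@[simp] theorem time_fill (n : ℕ) (a : α) : (fill n a).time = n + 1 := rfl
@[simp] theorem val_append (u v : Array α) : (append u v).val = u ++ v := rfl
@[simp] theorem time_append (u v : Array α) : (append u v).time = u.size + v.size + 1 := rfl
@[simp] theorem val_add (m n : ℕ) : (add m n).val = m + n := rfl
@[simp] theorem time_add (m n : ℕ) : (add m n).time = 1 := rfl
@[simp] theorem val_mul (m n : ℕ) : (mul m n).val = m * n := rfl
@[simp] theorem time_mul (m n : ℕ) : (mul m n).time = 1 := rfl
@[simp] theorem time_div (m n : ℕ) : (div m n).time = 1 := rfl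

@[simp] theorem val_take [Inhabited α] (v : Array α) (p : Array ℕ) :
    (take v p).val = gather v p := by
  simp [take, gather]

@[simp] theorem time_take [Inhabited α] (v : Array α) (p : Array ℕ) :
    (take v p).time ≤ 3 * p.size + 1 := by
  refine (time_loop_le 2 (by simp)).trans ?_
  simp
  omega

@[simp] theorem val_allSel (n : ℕ) : (allSel n).val = Array.range n := by
  simp [allSel]

@[simp] theorem time_allSel (n : ℕ) : (allSel n).time ≤ 2 * n + 1 := by
  refine (time_loop_le 1 (by simp)).trans ?_
  simp
  omega

@[simp] theorem HashMap.val_new (K W : Type) : (HashMap.new K W).val = fun _ => none := rfl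
@[simp] theorem HashMap.time_new (K W : Type) : (HashMap.new K W).time = 1 := rfl
@[simp] theorem HashMap.val_lookup {K W : Type} (h : HashMap K W) (k : K) :
    (h.lookup k).val = h k := rfl
@[simp] theorem HashMap.time_lookup {K W : Type} (h : HashMap K W) (k : K) :
    (h.lookup k).time = 1 := rfl
@[simp] theorem HashMap.val_insert {K W : Type} (h : HashMap K W) (k : K) (w : W) :
    (h.insert k w).val = Function.update h k (some w) := rfl
@[simp] theorem HashMap.time_insert {K W : Type} (h : HashMap K W) (k : K) (w : W) :
    (h.insert k w).time = 1 := rfl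

/-- Shifting all pointers by `n`. -/
def shift (n : ℕ) (v : Array (Option ℕ)) : Array (Option ℕ) := v.map (Option.map (· + n))

@[simp] theorem size_shift (n : ℕ) (v : Array (Option ℕ)) : (shift n v).size = v.size := by
  simp [shift]

theorem getD_shift (n : ℕ) (v : Array (Option ℕ)) (i : ℕ) :
    (shift n v).getD i none = (v.getD i none).map (· + n) := by
  by_cases h : i < v.size <;> simp [shift, Array.getD_eq_getD_getElem?, h]

@[simp] theorem val_offset (n : ℕ) (v : Array (Option ℕ)) : (offset n v).val = shift n v := by
  simp only [offset, shift, val_loop, val_bind, val_steps, val_push]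
  rw [foldl_push v.toList (Option.map (· + n)) #[]]
  simp [← List.map_toArray]

@[simp] theorem time_offset (n : ℕ) (v : Array (Option ℕ)) :
    (offset n v).time ≤ 3 * v.size + 1 := by
  refine (time_loop_le 2 (by simp)).trans ?_
  simp
  omega

theorem getD_append_left (u v : Array α) (i : ℕ) (d : α) (h : i < u.size) :
    (u ++ v).getD i d = u.getD i d := by
  simp [Array.getD_eq_getD_getElem?, Array.getElem?_append, h]

theorem getD_append_right (u v : Array α) (i : ℕ) (d : α) :
    (u ++ v).getD (i + u.size) d = v.getD i d := by
  simp [Array.getD_eq_getD_getElem?, Array.getElem?_append]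

theorem getD_setIfInBounds (v : Array α) (i j : ℕ) (a d : α) :
    (v.setIfInBounds i a).getD j d = if i = j ∧ j < v.size then a else v.getD j d := by
  simp only [Array.getD_eq_getD_getElem?, Array.getElem?_setIfInBounds]
  by_cases h : i = j <;> by_cases h' : j < v.size <;> simp [h, h']

/-- Updating every entry of a vector in place. -/
theorem foldl_setIfInBounds_range (g : ℕ → ℕ → ℕ) (w : Array ℕ) (n : ℕ) (hn : n ≤ w.size) :
    ((List.range n).foldl (fun w i => w.setIfInBounds i (g i (w.getD i default))) w).size =
        w.size ∧
      ∀ k, ((List.range n).foldl (fun w i => w.setIfInBounds i (g i (w.getD i default))) w).getD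
        k default = if k < n then g k (w.getD k default) else w.getD k default := by
  induction n with
  | zero => simp
  | succ n ih =>
    obtain ⟨h1, h2⟩ := ih (by omega)
    rw [List.range_succ, List.foldl_append]
    simp only [List.foldl_cons, List.foldl_nil]
    refine ⟨by simpa using h1, fun k => ?_⟩
    rw [getD_setIfInBounds, h1]
    by_cases hk : n = k
    · subst hk
      rw [if_pos ⟨rfl, by omega⟩, h2, if_neg (by omega), if_pos (by omega)]
    · rw [if_neg (fun h => hk h.1), h2]
      by_cases hk' : k < n
      · rw [if_pos hk', if_pos (by omega)]
      · rw [if_neg hk', if_neg (by omega)]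

end Primitives

section Physical

variable {A V : Type}

/-- Adding columns to a physical relation. -/
theorem Phys.foldl_col (l : List A) (g : A → Array V) (O : Phys A V) :
    l.foldl (fun O a => { O with col := Function.update O.col a (g a) }) O =
      { O with col := fun a => if a ∈ l then g a else O.col a } := by
  induction l generalizing O with
  | nil => simp
  | cons b l ih =>
    simp only [List.foldl_cons, ih, Phys.mk.injEq, true_and, and_true]
    funext a
    by_cases h : a ∈ l
    · simp [h]
    · by_cases hb : a = b
      · subst hb; simp [h]
      · simp [h, hb]

theorem Phys.foldl_hd (l : List (Scheme A)) (g : Scheme A → Array (Option ℕ)) (O : Phys A V)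
    (F : Scheme A → Array (Option ℕ) → Array (Option ℕ)) (hF : ∀ Y, F Y (O.hd Y) = g Y)
    (hl : l.Nodup) :
    l.foldl (fun O Y => { O with hd := Function.update O.hd Y (F Y (O.hd Y)) }) O =
      { O with hd := fun Y => if Y ∈ l then g Y else O.hd Y } := by
  induction l generalizing O g with
  | nil => simp
  | cons b l ih =>
    rw [List.nodup_cons] at hl
    simp only [List.foldl_cons]
    rw [ih (fun Y => F Y (Function.update O.hd b (F b (O.hd b)) Y)) _ (fun _ => rfl) hl.2]
    simp only [Phys.mk.injEq, true_and, and_true]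
    funext a
    by_cases h : a ∈ l
    · have : a ≠ b := fun e => hl.1 (e ▸ h)
      simp [h, this, hF]
    · by_cases hb : a = b
      · subst hb; simp [h, hF]
      · simp [h, hb]

theorem Phys.foldl_hd_wt (l : List (Scheme A)) (g : Scheme A → Array (Option ℕ))
    (g' : Scheme A → Array ℕ) (O : Phys A V) :
    l.foldl (fun O Y => { O with hd := Function.update O.hd Y (g Y)
                                 wt := Function.update O.wt Y (g' Y) }) O =
      { O with hd := fun Y => if Y ∈ l then g Y else O.hd Y
               wt := fun Y => if Y ∈ l then g' Y else O.wt Y } := by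
  induction l generalizing O with
  | nil => simp
  | cons b l ih =>
    simp only [List.foldl_cons, ih, Phys.mk.injEq, true_and, and_true]
    constructor
    all_goals
      funext a
      by_cases h : a ∈ l
      · simp [h]
      · by_cases hb : a = b
        · subst hb; simp [h]
        · simp [h, hb]

theorem val_multiplyWeights (P : Phys A V) (X : Scheme A) :
    (multiplyWeights P X).val.size = P.len ∧
      ∀ i < P.len, (multiplyWeights P X).val.getD i default =
        ∏ Y ∈ X.nested, (P.wt Y).getD i default := by
  have key : ∀ (l : List (Scheme A)) (w : Array ℕ), w.size = P.len →
      (l.foldl (fun w Y => (List.range P.len).foldl (fun w i =>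
        w.setIfInBounds i (w.getD i default * (P.wt Y).getD i default)) w) w).size = P.len ∧
      ∀ i < P.len, (l.foldl (fun w Y => (List.range P.len).foldl (fun w i =>
        w.setIfInBounds i (w.getD i default * (P.wt Y).getD i default)) w) w).getD i default =
        w.getD i default * (l.map fun Y => (P.wt Y).getD i default).prod := by
    intro l
    induction l with
    | nil => intro w hw; simp [hw]
    | cons Y l ih =>
      intro w hw
      obtain ⟨h1, h2⟩ := foldl_setIfInBounds_range
        (fun i m => m * (P.wt Y).getD i default) w P.len hw.ge
      obtain ⟨h3, h4⟩ := ih _ (h1.trans hw)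
      refine ⟨h3, fun i hi => ?_⟩
      rw [List.foldl_cons, h4 i hi, h2, if_pos hi]
      simp [mul_assoc]
  simp only [multiplyWeights, val_bind, val_loop, val_fill, val_rd, val_mul, val_wr]
  obtain ⟨h1, h2⟩ := key X.nested.toList (Array.replicate P.len 1) (by simp)
  refine ⟨h1, fun i hi => ?_⟩
  rw [h2 i hi, Finset.prod_map_toList]
  simp [Array.getD_eq_getD_getElem?, hi]

theorem time_multiplyWeights (P : Phys A V) (X : Scheme A) :
    (multiplyWeights P X).time ≤ (7 * X.nested.card + 2) * (P.len + 1) := by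
  have h1 : ∀ w : Array ℕ, (loop X.nested.toList w fun w Y =>
      loop (List.range P.len) w fun w i => do
        let m ← rd w i
        let n ← rd (P.wt Y) i
        let k ← mul m n
        wr w i k).time ≤ X.nested.toList.length * ((P.len * (4 + 1) + 1) + 1) + 1 := by
    intro w
    refine time_loop_le _ fun Y _ w => ?_
    refine (time_loop_le 4 (by simp)).trans ?_
    simp
  simp only [multiplyWeights, time_bind, time_fill]
  refine (add_le_add le_rfl (h1 _)).trans ?_
  rw [Finset.length_toList]
  nlinarith [Nat.zero_le (X.nested.card * P.len)]

/-- Shifting the list heads of a physical relation. -/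
theorem val_fixHeads (S : Store A V) (Y : Scheme A) (T : Phys A V) :
    (fixHeads S Y T).val =
      { T with hd := fun Z => if Z ∈ Y.nested then shift (S Z).len (T.hd Z) else T.hd Z } := by
  simp only [fixHeads, val_loop, val_bind, val_offset, val_pure]
  rw [Phys.foldl_hd Y.nested.toList (fun Z => shift (S Z).len (T.hd Z)) T
    (fun Z v => shift (S Z).len v) (fun _ => rfl) (Finset.nodup_toList _)]
  simp

theorem time_fixHeads (S : Store A V) (Y : Scheme A) (T : Phys A V) (n : ℕ)
    (hn : ∀ Z ∈ Y.nested, (T.hd Z).size = n) :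
    (fixHeads S Y T).time ≤ (3 * Y.nested.card + 1) * (n + 1) := by
  have h := (loop_rule (l := Y.nested.toList) (s := T) (body := fun T Z => do
      let h ← offset (S Z).len (T.hd Z)
      pure { T with hd := Function.update T.hd Z h })
    (fun _ T => ∀ Z ∈ Y.nested, (T.hd Z).size = n) (fun _ => 3 * n + 1) hn (by
      intro pre Z post T hl hT
      have hZ : Z ∈ Y.nested := by
        rw [← Finset.mem_toList, hl]
        simp
      constructor
      · intro W hW
        simp only [val_bind, val_offset, val_pure]
        by_cases h : W = Z
        · subst h
          simp [hT W hW]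
        · simp [h, hT W hW]
      · simp only [time_bind, time_pure, add_zero]
        have := time_offset (S Z).len (T.hd Z)
        rwa [hT Z hZ] at this)).2
  refine h.trans ?_
  simp
  nlinarith [Nat.zero_le (Y.nested.card * n)]

theorem Phys.val_concat (X : Scheme A) (P Q : Phys A V) :
    (Phys.concat X P Q).val =
      { len := P.len + Q.len
        col := fun a => if a ∈ X.flat then P.col a ++ Q.col a else #[]
        hd := fun Y => if Y ∈ X.nested then P.hd Y ++ Q.hd Y else #[]
        wt := fun Y => if Y ∈ X.nested then P.wt Y ++ Q.wt Y else #[]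
        nxt := #[] } := by
  simp only [Phys.concat, val_bind, val_loop, val_append, val_pure, val_add]
  rw [Phys.foldl_col X.flat.toList (fun a => P.col a ++ Q.col a),
    Phys.foldl_hd_wt X.nested.toList (fun Y => P.hd Y ++ Q.hd Y) (fun Y => P.wt Y ++ Q.wt Y)]
  simp [Phys.new]

theorem Phys.time_concat (X : Scheme A) (P Q : Phys A V) (n : ℕ)
    (hcol : ∀ a ∈ X.flat, (P.col a).size + (Q.col a).size ≤ n)
    (hhd : ∀ Y ∈ X.nested, (P.hd Y).size + (Q.hd Y).size ≤ n)
    (hwt : ∀ Y ∈ X.nested, (P.wt Y).size + (Q.wt Y).size ≤ n) :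
    (Phys.concat X P Q).time ≤ (3 * (X.flat.card + X.nested.card) + 3) * (n + 1) := by
  simp only [Phys.concat, time_bind, time_add]
  have h1 : ∀ O : Phys A V, (loop X.flat.toList O fun O a => do
      let c ← append (P.col a) (Q.col a)
      pure { O with col := Function.update O.col a c }).time ≤
      X.flat.toList.length * (n + 1 + 1) + 1 := by
    intro O
    refine time_loop_le _ fun a ha O => ?_
    have := hcol a (Finset.mem_toList.1 ha)
    simp
    omega
  have h2 : ∀ O : Phys A V, (loop X.nested.toList O fun O Y => do
      let h ← append (P.hd Y) (Q.hd Y)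
      let w ← append (P.wt Y) (Q.wt Y)
      pure { O with hd := Function.update O.hd Y h, wt := Function.update O.wt Y w }).time ≤
      X.nested.toList.length * (2 * n + 2 + 1) + 1 := by
    intro O
    refine time_loop_le _ fun a ha O => ?_
    have := hhd a (Finset.mem_toList.1 ha)
    have := hwt a (Finset.mem_toList.1 ha)
    simp only [time_bind, time_pure, time_append]
    omega
  refine (add_le_add le_rfl (add_le_add (h1 _) (h2 _))).trans ?_
  simp only [Finset.length_toList]
  nlinarith [Nat.zero_le (X.flat.card * n), Nat.zero_le (X.nested.card * n)]

variable [Inhabited V]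

@[simp] theorem Phys.val_readKey (P : Phys A V) (y : Finset A) (i : ℕ) :
    (P.readKey y i).val = fun a : y => (P.col a.1).getD i default := rfl
@[simp] theorem Phys.time_readKey (P : Phys A V) (y : Finset A) (i : ℕ) :
    (P.readKey y i).time = y.card + 1 := rfl

theorem Phys.val_takeInto (O P : Phys A V) (F : Finset A) (N : Finset (Scheme A))
    (p : Array ℕ) :
    (O.takeInto P F N p).val =
      { O with
        col := fun a => if a ∈ F then gather (P.col a) p else O.col a
        hd := fun Y => if Y ∈ N then gather (P.hd Y) p else O.hd Y
        wt := fun Y => if Y ∈ N then gather (P.wt Y) p else O.wt Y } := by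
  simp only [Phys.takeInto, val_bind, val_loop, val_take, val_pure]
  rw [Phys.foldl_col F.toList (fun a => gather (P.col a) p),
    Phys.foldl_hd_wt N.toList (fun Y => gather (P.hd Y) p) (fun Y => gather (P.wt Y) p)]
  simp

theorem Phys.time_takeInto (O P : Phys A V) (F : Finset A) (N : Finset (Scheme A))
    (p : Array ℕ) :
    (O.takeInto P F N p).time ≤ (6 * (F.card + N.card) + 2) * (p.size + 1) := by
  simp only [Phys.takeInto, time_bind]
  have h1 : (loop F.toList O fun O a => do
      let c ← take (P.col a) p
      pure { O with col := Function.update O.col a c }).time ≤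
      F.toList.length * (3 * p.size + 1 + 1) + 1 := by
    refine time_loop_le _ fun a _ O => ?_
    simp
  have h2 : ∀ O : Phys A V, (loop N.toList O fun O Y => do
      let h ← take (P.hd Y) p
      let w ← take (P.wt Y) p
      pure { O with hd := Function.update O.hd Y h, wt := Function.update O.wt Y w }).time ≤
      N.toList.length * (6 * p.size + 2 + 1) + 1 := by
    intro O
    refine time_loop_le _ fun a _ O => ?_
    have := time_take (P.hd a) p
    have := time_take (P.wt a) p
    simp only [time_bind, time_pure]
    omega
  refine (add_le_add h1 (h2 _)).trans ?_
  simp only [Finset.length_toList]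
  nlinarith [Nat.zero_le (F.card * p.size), Nat.zero_le (N.card * p.size)]

theorem val_compact (X : Scheme A) (P : Phys A V) (sel : Array ℕ) :
    (compact X P sel).val =
      if sel.size < P.len then
        (((Phys.new A V sel.size).takeInto P X.flat X.nested sel).val, Array.range sel.size)
      else (P, sel) := by
  by_cases h : sel.size < P.len
  · rw [if_pos h, compact, val_bind, if_pos (show (steps 1 (sel.size < P.len)).val from h)]
    simp
  · rw [if_neg h, compact, val_bind, if_neg (show ¬ (steps 1 (sel.size < P.len)).val from h)]
    simp

theorem time_compact (X : Scheme A) (P : Phys A V) (sel : Array ℕ) :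
    (compact X P sel).time ≤ (6 * (X.flat.card + X.nested.card) + 6) * (P.len + 1) := by
  rw [compact, time_bind, time_steps]
  by_cases h : sel.size < P.len
  · rw [if_pos (show (steps 1 (sel.size < P.len)).val from h)]
    have h1 := (Phys.new A V sel.size).time_takeInto P X.flat X.nested sel
    have h2 := time_allSel sel.size
    have h3 : (6 * (X.flat.card + X.nested.card) + 2) * (sel.size + 1) ≤
        (6 * (X.flat.card + X.nested.card) + 2) * (P.len + 1) :=
      Nat.mul_le_mul_left _ (by omega)
    simp only [time_bind, time_pure]
    calc _ ≤ (6 * (X.flat.card + X.nested.card) + 2) * (P.len + 1) + 4 * (P.len + 1) := by omega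
      _ = _ := by ring
  · rw [if_neg (show ¬ (steps 1 (sel.size < P.len)).val from h)]
    simp only [time_pure]
    nlinarith [Nat.zero_le ((6 * (X.flat.card + X.nested.card) + 6) * P.len)]

end Physical

end

section

namespace Scheme

variable {A : Type}

theorem ind {p : Scheme A → Prop} (h : ∀ X, (∀ Y ∈ X.nested, p Y) → p X) (X : Scheme A) :
    p X := by
  induction hn : X.size using Nat.strong_induction_on generalizing X with
  | _ n ih =>
    subst hn
    exact h X fun Y hY => ih _ (size_lt hY) Y rfl

theorem mem_sub {X Z : Scheme A} : Z ∈ X.sub ↔ Z ∈ X.nested ∨ ∃ Y ∈ X.nested, Z ∈ Y.sub := by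
  rw [sub]
  simp

theorem nested_subset_sub (X : Scheme A) : X.nested ⊆ X.sub := fun _ h => mem_sub.2 (.inl h)

theorem sub_subset_of_mem_nested {X Y : Scheme A} (h : Y ∈ X.nested) : Y.sub ⊆ X.sub :=
  fun _ hZ => mem_sub.2 (.inr ⟨Y, h, hZ⟩)

theorem size_lt_of_mem_sub {X Z : Scheme A} (h : Z ∈ X.sub) : Z.size < X.size := by
  induction X using ind with
  | h X ih =>
    rcases mem_sub.1 h with h | ⟨W, hW, h⟩
    · exact size_lt h
    · exact (ih W hW h).trans (size_lt hW)

theorem notMem_sub_self (X : Scheme A) : X ∉ X.sub := fun h => (size_lt_of_mem_sub h).false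

theorem sub_mono {X Y : Scheme A} (h : Y.nested ⊆ X.nested) : Y.sub ⊆ X.sub := by
  intro Z hZ
  rcases mem_sub.1 hZ with hZ | ⟨W, hW, hZ⟩
  · exact mem_sub.2 (.inl (h hZ))
  · exact mem_sub.2 (.inr ⟨W, h hW, hZ⟩)

theorem flatsub_subset_of_mem_nested {X Y : Scheme A} (h : Y ∈ X.nested) :
    Y.flatsub ⊆ X.flatsub := fun _ ha => mem_flatsub.2 (.inr ⟨Y, h, ha⟩)

theorem flat_subset_flatsub (X : Scheme A) : X.flat ⊆ X.flatsub :=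
  fun _ ha => mem_flatsub.2 (.inl ha)

theorem IsFlat.sub_eq {X : Scheme A} (h : X.IsFlat) : X.sub = ∅ := by
  ext Z
  rw [mem_sub, show X.nested = ∅ from h]
  simp

theorem nested_remove (X : Scheme A) (y : Finset A) : (X.remove y).nested = X.nested :=
  nested_mk _ _

theorem sub_remove (X : Scheme A) (y : Finset A) : (X.remove y).sub = X.sub :=
  (sub_mono (nested_remove X y).le).antisymm (sub_mono (nested_remove X y).ge)

theorem remove_notMem_sub (X : Scheme A) (y : Finset A) : X.remove y ∉ X.sub := by
  rw [← sub_remove X y]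
  exact notMem_sub_self _

theorem mem_sub_extend {X Z W : Scheme A} :
    W ∈ (X.extend Z).sub ↔ W ∈ X.sub ∨ W ∈ insert Z Z.sub := by
  simp only [mem_sub (X := X.extend Z), mem_nested_extend, Finset.mem_insert, exists_eq_or_imp]
  rw [mem_sub (X := X)]
  grind

theorem flat_unnest (X Y : Scheme A) : (X.unnest Y).flat = X.flat ∪ Y.flat := rfl

theorem sub_unnest_subset {X Y : Scheme A} (h : Y ∈ X.nested) : (X.unnest Y).sub ⊆ X.sub := by
  intro W hW
  rcases mem_sub.1 hW with hW | ⟨U, hU, hW⟩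
  · rcases mem_nested_unnest.1 hW with hW | hW
    · exact nested_subset_sub _ (Finset.mem_of_mem_erase hW)
    · exact sub_subset_of_mem_nested h (nested_subset_sub _ hW)
  · rcases mem_nested_unnest.1 hU with hU | hU
    · exact sub_subset_of_mem_nested (Finset.mem_of_mem_erase hU) hW
    · exact sub_subset_of_mem_nested h (sub_subset_of_mem_nested hU hW)

/-- No flat attribute and no scheme occurs twice in `X`. -/
inductive Linear : Scheme A → Prop where
  | intro {X : Scheme A} (nested : ∀ Y ∈ X.nested, Linear Y)
      (flat : ∀ Y ∈ X.nested, Disjoint X.flat Y.flatsub)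
      (flatsub : ∀ Y ∈ X.nested, ∀ W ∈ X.nested, Y ≠ W → Disjoint Y.flatsub W.flatsub)
      (sub : ∀ Y ∈ X.nested, ∀ W ∈ X.nested, Y ≠ W → Disjoint (insert Y Y.sub) (insert W W.sub)) :
      Linear X

namespace Linear

variable {X Y : Scheme A}

theorem of_mem_nested (h : X.Linear) (hY : Y ∈ X.nested) : Y.Linear := by
  cases h with
  | intro h1 _ _ _ => exact h1 Y hY

theorem disjoint_flat (h : X.Linear) (hY : Y ∈ X.nested) : Disjoint X.flat Y.flatsub := by
  cases h with
  | intro _ h _ _ => exact h Y hY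

theorem disjoint_flatsub (h : X.Linear) (hY : Y ∈ X.nested) {W : Scheme A} (hW : W ∈ X.nested)
    (hne : Y ≠ W) : Disjoint Y.flatsub W.flatsub := by
  cases h with
  | intro _ _ h _ => exact h Y hY W hW hne

theorem disjoint_sub (h : X.Linear) (hY : Y ∈ X.nested) {W : Scheme A} (hW : W ∈ X.nested)
    (hne : Y ≠ W) : Disjoint (insert Y Y.sub) (insert W W.sub) := by
  cases h with
  | intro _ _ _ h => exact h Y hY W hW hne

theorem of_isFlat (h : X.IsFlat) : X.Linear := by
  have h' : ∀ Y, Y ∉ X.nested := by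
    intro Y
    rw [show X.nested = ∅ from h]
    exact Finset.notMem_empty Y
  exact .intro (fun Y hY => absurd hY (h' Y)) (fun Y hY => absurd hY (h' Y))
    (fun Y hY => absurd hY (h' Y)) (fun Y hY => absurd hY (h' Y))

theorem of_included (h : X.Linear) (hY : Y.Included X) : Y.Linear :=
  .intro (fun _ hW => h.of_mem_nested (hY.2 hW))
    (fun _ hW => (h.disjoint_flat (hY.2 hW)).mono_left hY.1)
    (fun _ hU _ hW hne => h.disjoint_flatsub (hY.2 hU) (hY.2 hW) hne)
    (fun _ hU _ hW hne => h.disjoint_sub (hY.2 hU) (hY.2 hW) hne)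

theorem insert_sub_subset (hY : Y ∈ X.nested) : insert Y Y.sub ⊆ X.sub :=
  Finset.insert_subset (nested_subset_sub _ hY) (sub_subset_of_mem_nested hY)

theorem extend {Z : Scheme A} (hX : X.Linear) (hZ : Z.Linear)
    (hflat : Disjoint Z.flatsub X.flatsub) (hsub : Disjoint (insert Z Z.sub) X.sub) :
    (X.extend Z).Linear := by
  refine .intro ?_ ?_ ?_ ?_
  · intro Y hY
    rcases mem_nested_extend.1 hY with rfl | hY
    · exact hZ
    · exact hX.of_mem_nested hY
  · intro Y hY
    rcases mem_nested_extend.1 hY with rfl | hY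
    · exact (hflat.mono_right X.flat_subset_flatsub).symm
    · exact hX.disjoint_flat hY
  · intro Y hY W hW hne
    rw [mem_nested_extend] at hY hW
    rcases hY with e | hY <;> rcases hW with e' | hW
    · exact absurd (e.trans e'.symm) hne
    · subst e
      exact hflat.mono_right (flatsub_subset_of_mem_nested hW)
    · subst e'
      exact (hflat.mono_right (flatsub_subset_of_mem_nested hY)).symm
    · exact hX.disjoint_flatsub hY hW hne
  · intro Y hY W hW hne
    rw [mem_nested_extend] at hY hW
    rcases hY with e | hY <;> rcases hW with e' | hW
    · exact absurd (e.trans e'.symm) hne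
    · subst e
      exact hsub.mono_right (insert_sub_subset hW)
    · subst e'
      exact (hsub.mono_right (insert_sub_subset hY)).symm
    · exact hX.disjoint_sub hY hW hne

theorem unnest (hX : X.Linear) (hY : Y ∈ X.nested) : (X.unnest Y).Linear := by
  have hYl := hX.of_mem_nested hY
  refine .intro ?_ ?_ ?_ ?_
  · intro W hW
    rcases mem_nested_unnest.1 hW with hW | hW
    · exact hX.of_mem_nested (Finset.mem_of_mem_erase hW)
    · exact hYl.of_mem_nested hW
  · intro W hW
    rw [flat_unnest, Finset.disjoint_union_left]
    rcases mem_nested_unnest.1 hW with hW | hW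
    · obtain ⟨hne, hW⟩ := Finset.mem_erase.1 hW
      exact ⟨hX.disjoint_flat hW,
        (hX.disjoint_flatsub hY hW hne.symm).mono_left Y.flat_subset_flatsub⟩
    · exact ⟨(hX.disjoint_flat hY).mono_right (flatsub_subset_of_mem_nested hW),
        hYl.disjoint_flat hW⟩
  · intro U hU W hW hne
    rcases mem_nested_unnest.1 hU with hU | hU <;> rcases mem_nested_unnest.1 hW with hW | hW
    · exact hX.disjoint_flatsub (Finset.mem_of_mem_erase hU) (Finset.mem_of_mem_erase hW) hne
    · obtain ⟨hn, hU⟩ := Finset.mem_erase.1 hU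
      exact (hX.disjoint_flatsub hU hY hn).mono_right (flatsub_subset_of_mem_nested hW)
    · obtain ⟨hn, hW⟩ := Finset.mem_erase.1 hW
      exact ((hX.disjoint_flatsub hW hY hn).mono_right (flatsub_subset_of_mem_nested hU)).symm
    · exact hYl.disjoint_flatsub hU hW hne
  · have hs : ∀ {W}, W ∈ Y.nested → insert W W.sub ⊆ insert Y Y.sub := fun hW =>
      (insert_sub_subset hW).trans (Finset.subset_insert _ _)
    intro U hU W hW hne
    rcases mem_nested_unnest.1 hU with hU | hU <;> rcases mem_nested_unnest.1 hW with hW | hW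
    · exact hX.disjoint_sub (Finset.mem_of_mem_erase hU) (Finset.mem_of_mem_erase hW) hne
    · obtain ⟨hn, hU⟩ := Finset.mem_erase.1 hU
      exact (hX.disjoint_sub hU hY hn).mono_right (hs hW)
    · obtain ⟨hn, hW⟩ := Finset.mem_erase.1 hW
      exact ((hX.disjoint_sub hW hY hn).mono_right (hs hU)).symm
    · exact hYl.disjoint_sub hU hW hne

/-- In a linear scheme, an unnested attribute does not occur any more. -/
theorem notMem_sub_unnest (hX : X.Linear) (hY : Y ∈ X.nested) : Y ∉ (X.unnest Y).sub := by
  intro h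
  rcases mem_sub.1 h with h | ⟨U, hU, h⟩
  · rcases mem_nested_unnest.1 h with h | h
    · exact (Finset.mem_erase.1 h).1 rfl
    · exact (size_lt h).false
  · rcases mem_nested_unnest.1 hU with hU | hU
    · obtain ⟨hne, hU⟩ := Finset.mem_erase.1 hU
      exact Finset.disjoint_left.1 (hX.disjoint_sub hU hY hne) (Finset.mem_insert_of_mem h)
        (Finset.mem_insert_self _ _)
    · exact ((size_lt_of_mem_sub h).trans (size_lt hU)).false

end Linear

/-! ### Renaming -/

theorem ext_elems {X Y : Scheme A} (h1 : X.flat = Y.flat) (h2 : X.nested = Y.nested) : X = Y := by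
  rw [← mk_flat_nested X, ← mk_flat_nested Y, h1, h2]

theorem rename_rename (φ ψ : Equiv.Perm A) (X : Scheme A) :
    (X.rename φ).rename ψ = X.rename (φ.trans ψ) := by
  induction X using ind with
  | h X ih =>
    apply ext_elems
    · simp only [flat_rename, Finset.image_image]
      rfl
    · simp only [nested_rename, Finset.image_image]
      exact Finset.image_congr fun Y hY => ih Y hY

theorem rename_refl (X : Scheme A) : X.rename (Equiv.refl A) = X := by
  induction X using ind with
  | h X ih =>
    apply ext_elems
    · simp [flat_rename]
    · rw [nested_rename]
      exact (Finset.image_congr fun Y hY => ih Y hY).trans Finset.image_id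

@[simp] theorem rename_symm_rename (φ : Equiv.Perm A) (X : Scheme A) :
    (X.rename φ).rename φ.symm = X := by
  rw [rename_rename, Equiv.self_trans_symm, rename_refl]

theorem rename_injective (φ : Equiv.Perm A) : Function.Injective (rename φ) :=
  Function.LeftInverse.injective (g := rename φ.symm) (rename_symm_rename φ)

theorem sub_rename (φ : Equiv.Perm A) (X : Scheme A) :
    (X.rename φ).sub = X.sub.image (rename φ) := by
  induction X using ind with
  | h X ih =>
    ext Z
    simp only [mem_sub (X := X.rename φ), mem_nested_rename, Finset.mem_image, mem_sub (X := X)]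
    constructor
    · rintro (⟨Y, hY, rfl⟩ | ⟨_, ⟨Y, hY, rfl⟩, hZ⟩)
      · exact ⟨Y, .inl hY, rfl⟩
      · rw [ih Y hY, Finset.mem_image] at hZ
        obtain ⟨W, hW, rfl⟩ := hZ
        exact ⟨W, .inr ⟨Y, hY, hW⟩, rfl⟩
    · rintro ⟨W, hW | ⟨Y, hY, hW⟩, rfl⟩
      · exact .inl ⟨W, hW, rfl⟩
      · exact .inr ⟨_, ⟨Y, hY, rfl⟩, by rw [ih Y hY]; exact Finset.mem_image_of_mem _ hW⟩

theorem flatsub_rename (φ : Equiv.Perm A) (X : Scheme A) :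
    (X.rename φ).flatsub = X.flatsub.image φ := by
  induction X using ind with
  | h X ih =>
    ext a
    simp only [mem_flatsub (X := X.rename φ), mem_nested_rename, Finset.mem_image,
      mem_flatsub (X := X), flat_rename]
    constructor
    · rintro (⟨b, hb, rfl⟩ | ⟨_, ⟨Y, hY, rfl⟩, ha⟩)
      · exact ⟨b, .inl hb, rfl⟩
      · rw [ih Y hY, Finset.mem_image] at ha
        obtain ⟨b, hb, rfl⟩ := ha
        exact ⟨b, .inr ⟨Y, hY, hb⟩, rfl⟩
    · rintro ⟨b, hb | ⟨Y, hY, hb⟩, rfl⟩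
      · exact .inl ⟨b, hb, rfl⟩
      · exact .inr ⟨_, ⟨Y, hY, rfl⟩, by rw [ih Y hY]; exact Finset.mem_image_of_mem _ hb⟩

theorem Linear.rename {X : Scheme A} (h : X.Linear) (φ : Equiv.Perm A) : (X.rename φ).Linear := by
  induction h with
  | @intro X _ h2 h3 h4 ih =>
    refine .intro ?_ ?_ ?_ ?_
    · intro W hW
      obtain ⟨Y, hY, rfl⟩ := mem_nested_rename.1 hW
      exact ih Y hY
    · intro W hW
      obtain ⟨Y, hY, rfl⟩ := mem_nested_rename.1 hW
      rw [flat_rename, flatsub_rename, Finset.disjoint_image φ.injective]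
      exact h2 Y hY
    · intro W hW W' hW' hne
      obtain ⟨Y, hY, rfl⟩ := mem_nested_rename.1 hW
      obtain ⟨Y', hY', rfl⟩ := mem_nested_rename.1 hW'
      rw [flatsub_rename, flatsub_rename, Finset.disjoint_image φ.injective]
      exact h3 Y hY Y' hY' fun e => hne (e ▸ rfl)
    · intro W hW W' hW' hne
      obtain ⟨Y, hY, rfl⟩ := mem_nested_rename.1 hW
      obtain ⟨Y', hY', rfl⟩ := mem_nested_rename.1 hW'
      rw [sub_rename, sub_rename, ← Finset.image_insert, ← Finset.image_insert,
        Finset.disjoint_image (rename_injective φ)]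
      exact h4 Y hY Y' hY' fun e => hne (e ▸ rfl)

end Scheme

/-- No flat attribute and no scheme occurs twice in the scheme of a type. -/
def Ty.Linear {A : Type} : Ty A → Prop
  | .rel X => X.Linear
  | .dict _ Z => Z.Linear

theorem Expr.linear {A V Sym : Type} {sch : Sym → Finset A} {τ : Ty A} (e : Expr V sch τ) :
    τ.Linear := by
  induction e with
  | base R => exact .of_isFlat (Scheme.nested_ofFlat _)
  | app1 f e ih =>
    cases f with
    | select X y hy θ => exact ih
    | project X Y h => exact Scheme.Linear.of_included ih h
    | rename X φ => exact Scheme.Linear.rename ih φ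
    | groupBy X y hy => exact Scheme.Linear.of_included ih (X.remove_included y)
    | unnest X Y h => exact Scheme.Linear.unnest ih h
    | flatten X => exact .of_isFlat (Scheme.nested_ofFlat _)
  | app2 f e₁ e₂ ih₁ ih₂ =>
    cases f with
    | union X => exact ih₁
    | diff X hX => exact ih₁
    | semijoin X y Z hy hflat hsub => exact Scheme.Linear.extend ih₁ ih₂ hflat hsub

end

section

namespace Tup

variable {A V : Type} {X : Scheme A}

@[simp] theorem val_mk (f : X.flat → V) (g : (Y : X.nested) → {r : Multiset (Tup V Y.1) // r ≠ 0}) :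
    (mk f g).val = f := by
  funext a
  simp [val, mk]

@[simp] theorem rel_mk (f : X.flat → V) (g : (Y : X.nested) → {r : Multiset (Tup V Y.1) // r ≠ 0}) :
    (mk f g).rel = g := by
  funext a
  simp [rel, mk]

theorem ext_fields {s t : Tup V X} (h1 : s.val = t.val) (h2 : s.rel = t.rel) : s = t := by
  apply (equiv V X).injective
  exact Prod.ext h1 h2

theorem nonempty [Inhabited V] (X : Scheme A) : Nonempty (Tup V X) := by
  induction X using Scheme.ind with
  | h X ih =>
    exact ⟨mk (fun _ => default) fun Y =>
      ⟨{Classical.choice (ih Y.1 Y.2)}, Multiset.singleton_ne_zero _⟩⟩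

instance [Inhabited V] : Inhabited (Tup V X) := ⟨Classical.choice (nonempty X)⟩

@[simp] theorem val_mkFlat (hX : X.IsFlat) (f : X.flat → V) : (mkFlat hX f).val = f := val_mk _ _

theorem eq_mkFlat (hX : X.IsFlat) (t : Tup V X) : t = mkFlat hX t.val :=
  ext_fields (by simp) (by
    funext Y
    exact absurd (hX ▸ Y.2) (Finset.notMem_empty Y.1))

@[simp] theorem val_restrict {Y : Scheme A} (h : Y.Included X) (t : Tup V X) (a : Y.flat) :
    (t.restrict h).val a = t.val ⟨a.1, h.1 a.2⟩ := by
  rw [restrict, val_mk]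

@[simp] theorem rel_restrict {Y : Scheme A} (h : Y.Included X) (t : Tup V X) (Z : Y.nested) :
    (t.restrict h).rel Z = t.rel ⟨Z.1, h.2 Z.2⟩ := by
  rw [restrict, rel_mk]

@[simp] theorem val_extend (Z : Scheme A) (t : Tup V X) (r : {r : Multiset (Tup V Z) // r ≠ 0}) :
    (t.extend Z r).val = t.val := by
  rw [extend, val_mk]

theorem rel_extend_self (Z : Scheme A) (t : Tup V X) (r : {r : Multiset (Tup V Z) // r ≠ 0})
    (h : Z ∈ (X.extend Z).nested) : (t.extend Z r).rel ⟨Z, h⟩ = r := by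
  rw [extend, rel_mk]
  simp [castRel]

theorem rel_extend_of_ne (Z : Scheme A) (t : Tup V X) (r : {r : Multiset (Tup V Z) // r ≠ 0})
    {W : Scheme A} (hW : W ∈ (X.extend Z).nested) (hW' : W ∈ X.nested) (hne : W ≠ Z) :
    (t.extend Z r).rel ⟨W, hW⟩ = t.rel ⟨W, hW'⟩ := by
  rw [extend, rel_mk]
  simp [hne]

theorem val_concat_left (Y : Scheme A) (s : Tup V X) (t : Tup V Y) {a : A}
    (h : a ∈ (X.unnest Y).flat) (ha : a ∈ X.flat) : (concat Y s t).val ⟨a, h⟩ = s.val ⟨a, ha⟩ := by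
  rw [concat, val_mk]
  simp [ha]

theorem val_concat_right (Y : Scheme A) (s : Tup V X) (t : Tup V Y) {a : A}
    (h : a ∈ (X.unnest Y).flat) (ha : a ∉ X.flat) (ha' : a ∈ Y.flat) :
    (concat Y s t).val ⟨a, h⟩ = t.val ⟨a, ha'⟩ := by
  rw [concat, val_mk]
  simp [ha]

theorem rel_concat_left (Y : Scheme A) (s : Tup V X) (t : Tup V Y) {W : Scheme A}
    (h : W ∈ (X.unnest Y).nested) (hW : W ∈ X.nested.erase Y) :
    (concat Y s t).rel ⟨W, h⟩ = s.rel ⟨W, Finset.mem_of_mem_erase hW⟩ := by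
  rw [concat, rel_mk]
  exact dif_pos hW

theorem rel_concat_right (Y : Scheme A) (s : Tup V X) (t : Tup V Y) {W : Scheme A}
    (h : W ∈ (X.unnest Y).nested) (hW : W ∉ X.nested.erase Y) (hW' : W ∈ Y.nested) :
    (concat Y s t).rel ⟨W, h⟩ = t.rel ⟨W, hW'⟩ := by
  rw [concat, rel_mk]
  exact dif_neg hW

@[simp] theorem val_rename (φ : Equiv.Perm A) (t : Tup V X) (a : (X.rename φ).flat) :
    (rename φ X t).val a = t.val ⟨φ.symm a.1, Scheme.mem_flat_rename.1 a.2⟩ := by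
  rw [rename, val_mk]

theorem rel_rename (φ : Equiv.Perm A) (t : Tup V X) (Y : X.nested)
    (h : Y.1.rename φ ∈ (X.rename φ).nested) :
    ((rename φ X t).rel ⟨Y.1.rename φ, h⟩).1 = (t.rel Y).1.map (rename φ Y.1) := by
  rw [rename, rel_mk]
  simp only
  generalize_proofs h1 h2 h3 h4
  have key : ∀ (Y' : X.nested) (e : Y'.1.rename φ = Y.1.rename φ)
      (hne : (t.rel Y').1.map (rename φ Y'.1) ≠ 0),
      (castRel e ⟨(t.rel Y').1.map (rename φ Y'.1), hne⟩).1 = (t.rel Y).1.map (rename φ Y.1) := by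
    intro Y' e hne
    obtain rfl : Y' = Y := Subtype.ext (Scheme.rename_injective φ e)
    rfl
  exact key _ _ _

/-- The number of tuples obtained by flattening. -/
def weight (t : Tup V X) : ℕ := Multiset.card (flatten X t)

/-- The total weight of the inner relation at `Y`. -/
def relWeight (t : Tup V X) (Y : Scheme A) : ℕ :=
  if h : Y ∈ X.nested then ((t.rel ⟨Y, h⟩).1.map weight).sum else 0

theorem relWeight_eq (t : Tup V X) (Y : X.nested) :
    t.relWeight Y.1 = ((t.rel Y).1.map weight).sum := dif_pos Y.2

theorem weight_eq (t : Tup V X) : t.weight = ∏ Y ∈ X.nested, t.relWeight Y := by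
  rw [weight, flatten, Multiset.card_map, Multiset.card_pi, ← Finset.prod_attach]
  change ∏ Y ∈ X.nested.attach, _ = _
  refine Finset.prod_congr rfl fun Y _ => ?_
  rw [relWeight_eq, Multiset.card_bind]
  rfl

theorem weight_pos (t : Tup V X) : 0 < t.weight := by
  induction X using Scheme.ind with
  | h X ih =>
    rw [weight_eq]
    refine Finset.prod_pos fun Y hY => ?_
    rw [relWeight_eq t ⟨Y, hY⟩]
    obtain ⟨s, hs⟩ := Multiset.exists_mem_of_ne_zero (t.rel ⟨Y, hY⟩).2
    exact (ih Y hY s).trans_le (Multiset.le_sum_of_mem (Multiset.mem_map_of_mem _ hs))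

theorem weight_restrict {Y : Scheme A} (h : Y.Included X) (h' : Y.nested = X.nested)
    (t : Tup V X) : (t.restrict h).weight = t.weight := by
  rw [weight_eq, weight_eq, h']
  refine Finset.prod_congr rfl fun Z hZ => ?_
  rw [relWeight_eq t ⟨Z, hZ⟩, relWeight_eq (t.restrict h) ⟨Z, h' ▸ hZ⟩, rel_restrict]

theorem weight_rename (φ : Equiv.Perm A) (t : Tup V X) : (rename φ X t).weight = t.weight := by
  induction X using Scheme.ind with
  | h X ih =>
    rw [weight_eq, weight_eq, Scheme.nested_rename,
      Finset.prod_image fun _ _ _ _ h => Scheme.rename_injective φ h]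
    refine Finset.prod_congr rfl fun Y hY => ?_
    rw [relWeight_eq t ⟨Y, hY⟩,
      relWeight_eq (rename φ X t) ⟨Y.rename φ, Scheme.mem_nested_rename.2 ⟨Y, hY, rfl⟩⟩,
      rel_rename φ t ⟨Y, hY⟩, Multiset.map_map]
    congr 1
    exact Multiset.map_congr rfl fun s _ => ih Y hY s

end Tup

end

section

open Cost

/-! ## Linked lists -/

/-- Following the pointers `nxt` from `c` visits the positions `l`, which are decreasing. -/
def IsList (nxt : Array (Option ℕ)) : Option ℕ → List ℕ → Prop
  | c, [] => c = none
  | c, j :: l => c = some j ∧ (∀ k ∈ l, k < j) ∧ IsList nxt (nxt.getD j none) l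

namespace IsList

variable {nxt nxt' : Array (Option ℕ)} {c : Option ℕ} {l : List ℕ}

theorem chase (h : IsList nxt c l) {n : ℕ} (hn : ∀ j ∈ l, j < n) :
    (chase nxt n c).val = l ∧ (NSA.chase nxt n c).time = 2 * l.length + 1 := by
  induction l generalizing c n with
  | nil =>
    obtain rfl : c = none := h
    cases n <;> exact ⟨rfl, rfl⟩
  | cons j l ih =>
    obtain ⟨rfl, h2, h3⟩ := h
    obtain ⟨n, rfl⟩ : ∃ m, n = m + 1 := ⟨n - 1, by have := hn j (by simp); omega⟩
    obtain ⟨h4, h5⟩ := ih h3 (n := n) fun k hk => by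
      have := h2 k hk
      have := hn j (by simp)
      omega
    constructor
    · change j :: (NSA.chase nxt n (nxt.getD j none)).val = _
      rw [h4]
    · change 1 + ((NSA.chase nxt n (nxt.getD j none)).time + 1) = _
      rw [h5, List.length_cons]
      omega

theorem map {σ : ℕ → ℕ} (hσ : StrictMono σ) (h : IsList nxt c l)
    (hn : ∀ j ∈ l, nxt'.getD (σ j) none = (nxt.getD j none).map σ) :
    IsList nxt' (c.map σ) (l.map σ) := by
  induction l generalizing c with
  | nil =>
    obtain rfl : c = none := h
    rfl
  | cons j l ih =>
    obtain ⟨rfl, h2, h3⟩ := h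
    refine ⟨rfl, ?_, ?_⟩
    · simp only [List.mem_map, forall_exists_index, and_imp, forall_apply_eq_imp_iff₂]
      exact fun k hk => hσ (h2 k hk)
    · rw [hn j (by simp)]
      exact ih h3 fun k hk => hn k (by simp [hk])

theorem congr (h : IsList nxt c l) (hn : ∀ j ∈ l, nxt'.getD j none = nxt.getD j none) :
    IsList nxt' c l := by
  have := h.map (nxt' := nxt') (σ := id) strictMono_id (by simpa using hn)
  simpa using this

end IsList

/-! ## Denotation of rows -/

variable {A V : Type} [Inhabited V]

/-- Row `i` of `P`, as a physical relation over `X` with store `S`, represents the tuple `t`. -/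
inductive Den (S : Store A V) : (X : Scheme A) → Phys A V → ℕ → Tup V X → Prop where
  | intro {X : Scheme A} {P : Phys A V} {i : ℕ} {t : Tup V X} (js : X.nested → List ℕ)
      (f : (Y : X.nested) → ℕ → Tup V Y.1) (len : i < P.len)
      (col : ∀ a : X.flat, (P.col a.1).getD i default = t.val a)
      (list : ∀ Y : X.nested, IsList (S Y.1).nxt ((P.hd Y.1).getD i none) (js Y))
      (den : ∀ (Y : X.nested), ∀ j ∈ js Y, Den S Y.1 (S Y.1) j (f Y j))
      (rel : ∀ Y : X.nested, (t.rel Y).1 = ((js Y).map (f Y) : List (Tup V Y.1)))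
      (wt : ∀ Y : X.nested, (P.wt Y.1).getD i 0 = ((t.rel Y).1.map Tup.weight).sum) :
      Den S X P i t

/-- The linked list with head `c` in the store `S` represents the relation `r` of weight `w`. -/
def InnerRep (S : Store A V) (Y : Scheme A) (c : Option ℕ) (w : ℕ) (r : Multiset (Tup V Y)) :
    Prop :=
  ∃ (js : List ℕ) (f : ℕ → Tup V Y), IsList (S Y).nxt c js ∧
    (∀ j ∈ js, Den S Y (S Y) j (f j)) ∧ r = (js.map f : List (Tup V Y)) ∧
    w = (r.map Tup.weight).sum

theorem den_iff {S : Store A V} {X : Scheme A} {P : Phys A V} {i : ℕ} {t : Tup V X} :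
    Den S X P i t ↔ i < P.len ∧ (∀ a : X.flat, (P.col a.1).getD i default = t.val a) ∧
      ∀ Y : X.nested, InnerRep S Y.1 ((P.hd Y.1).getD i none) ((P.wt Y.1).getD i 0)
        (t.rel Y).1 := by
  constructor
  · rintro ⟨js, f, h1, h2, h3, h4, h5, h6⟩
    exact ⟨h1, h2, fun Y => ⟨js Y, f Y, h3 Y, h4 Y, h5 Y, h6 Y⟩⟩
  · rintro ⟨h1, h2, h3⟩
    choose js f h3 h4 h5 h6 using h3
    exact ⟨js, f, h1, h2, h3, h4, h5, h6⟩

theorem Den.lt_len {S : Store A V} {X : Scheme A} {P : Phys A V} {i : ℕ} {t : Tup V X}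
    (h : Den S X P i t) : i < P.len := (den_iff.1 h).1

theorem Den.key_eq {S : Store A V} {X : Scheme A} {P : Phys A V} {i : ℕ} {t : Tup V X}
    (h : Den S X P i t) (y : Finset A) (hy : y ⊆ X.flat) :
    (fun a : y => (P.col a.1).getD i default) = t.key y hy := by
  funext a
  exact (den_iff.1 h).2.1 ⟨a.1, hy a.2⟩

/-- Row `i'` of `P'` agrees with row `i` of `P` on the columns of `X`, except that pointers to `Y`
are mapped by `σ Y`. -/
structure RowSim (σ : Scheme A → ℕ → ℕ) (X : Scheme A) (P : Phys A V) (i : ℕ) (P' : Phys A V)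
    (i' : ℕ) : Prop where
  len : i' < P'.len
  col : ∀ a ∈ X.flat, (P'.col a).getD i' default = (P.col a).getD i default
  hd : ∀ Y ∈ X.nested, (P'.hd Y).getD i' none = ((P.hd Y).getD i none).map (σ Y)
  wt : ∀ Y ∈ X.nested, (P'.wt Y).getD i' 0 = (P.wt Y).getD i 0

/-- The store `S'` contains for every `Z` in `N` the rows of `S`, moved by `σ Z`. -/
structure StoreSim (σ : Scheme A → ℕ → ℕ) (N : Finset (Scheme A)) (S S' : Store A V) : Prop where
  mono : ∀ Z ∈ N, StrictMono (σ Z)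
  row : ∀ Z ∈ N, ∀ j < (S Z).len, RowSim σ Z (S Z) j (S' Z) (σ Z j)
  nxt : ∀ Z ∈ N, ∀ j < (S Z).len,
    (S' Z).nxt.getD (σ Z j) none = ((S Z).nxt.getD j none).map (σ Z)

theorem StoreSim.subset {σ : Scheme A → ℕ → ℕ} {N N' : Finset (Scheme A)} {S S' : Store A V}
    (h : StoreSim σ N S S') (hN : N' ⊆ N) : StoreSim σ N' S S' :=
  ⟨fun Z hZ => h.mono Z (hN hZ), fun Z hZ => h.row Z (hN hZ), fun Z hZ => h.nxt Z (hN hZ)⟩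

theorem Den.sim {σ : Scheme A → ℕ → ℕ} {S S' : Store A V} {X : Scheme A} {P P' : Phys A V}
    {i i' : ℕ} {t : Tup V X} (h : Den S X P i t) (hS : StoreSim σ X.sub S S')
    (hP : RowSim σ X P i P' i') : Den S' X P' i' t := by
  induction h generalizing P' i' with
  | @intro X P i t js f len col list den rel wt ih =>
    have hmono : ∀ Y : X.nested, StrictMono (σ Y.1) := fun Y =>
      hS.mono _ (X.nested_subset_sub Y.2)
    refine .intro (fun Y => (js Y).map (σ Y.1)) (fun Y => f Y ∘ Function.invFun (σ Y.1)) hP.len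
      (fun a => (hP.col a.1 a.2).trans (col a)) (fun Y => ?_) (fun Y => ?_) (fun Y => ?_)
      (fun Y => (hP.wt Y.1 Y.2).trans (wt Y))
    · rw [hP.hd Y.1 Y.2]
      exact (list Y).map (hmono Y) fun j hj =>
        hS.nxt _ (X.nested_subset_sub Y.2) j (den Y j hj).lt_len
    · simp only [List.mem_map, forall_exists_index, and_imp, forall_apply_eq_imp_iff₂,
        Function.comp_apply]
      intro j hj
      rw [Function.leftInverse_invFun (hmono Y).injective j]
      exact ih Y j hj (hS.subset (Scheme.sub_subset_of_mem_nested Y.2))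
        (hS.row _ (X.nested_subset_sub Y.2) j (den Y j hj).lt_len)
    · rw [rel Y, List.map_map, Function.comp_assoc,
        Function.invFun_comp (hmono Y).injective, Function.comp_id]

theorem InnerRep.sim {σ : Scheme A → ℕ → ℕ} {S S' : Store A V} {Y : Scheme A} {c : Option ℕ}
    {w : ℕ} {r : Multiset (Tup V Y)} (h : InnerRep S Y c w r)
    (hS : StoreSim σ (insert Y Y.sub) S S') : InnerRep S' Y (c.map (σ Y)) w r := by
  obtain ⟨js, f, h1, h2, h3, h4⟩ := h
  have hY := Finset.mem_insert_self Y Y.sub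
  refine ⟨js.map (σ Y), f ∘ Function.invFun (σ Y), ?_, ?_, ?_, h4⟩
  · exact h1.map (hS.mono Y hY) fun j hj => hS.nxt Y hY j (h2 j hj).lt_len
  · simp only [List.mem_map, forall_exists_index, and_imp, forall_apply_eq_imp_iff₂,
      Function.comp_apply]
    intro j hj
    rw [Function.leftInverse_invFun (hS.mono Y hY).injective j]
    exact (h2 j hj).sim (hS.subset (Finset.subset_insert _ _)) (hS.row Y hY j (h2 j hj).lt_len)
  · rw [h3, List.map_map, Function.comp_assoc, Function.invFun_comp (hS.mono Y hY).injective,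
      Function.comp_id]

theorem RowSim.of_id {X : Scheme A} {P P' : Phys A V} {i i' : ℕ} (len : i' < P'.len)
    (col : ∀ a ∈ X.flat, (P'.col a).getD i' default = (P.col a).getD i default)
    (hd : ∀ Y ∈ X.nested, (P'.hd Y).getD i' none = (P.hd Y).getD i none)
    (wt : ∀ Y ∈ X.nested, (P'.wt Y).getD i' 0 = (P.wt Y).getD i 0) :
    RowSim (fun _ => id) X P i P' i' :=
  ⟨len, col, fun Y hY => by simp [hd Y hY], wt⟩

theorem StoreSim.of_eq {N : Finset (Scheme A)} {S S' : Store A V} (h : ∀ Z ∈ N, S' Z = S Z) :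
    StoreSim (fun _ => id) N S S' where
  mono _ _ := strictMono_id
  row Z hZ j hj := by
    rw [h Z hZ]
    exact .of_id hj (fun _ _ => rfl) (fun _ _ => rfl) fun _ _ => rfl
  nxt Z hZ j hj := by simp [h Z hZ]

theorem InnerRep.congr_store {S S' : Store A V} {Y : Scheme A} {c : Option ℕ} {w : ℕ}
    {r : Multiset (Tup V Y)} (h : InnerRep S Y c w r) (hS : ∀ Z ∈ insert Y Y.sub, S' Z = S Z) :
    InnerRep S' Y c w r := by
  simpa using h.sim (.of_eq hS)

theorem Den.restrict {S : Store A V} {X Y : Scheme A} {P : Phys A V} {i : ℕ} {t : Tup V X}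
    (h : Den S X P i t) (hY : Y.Included X) : Den S Y P i (t.restrict hY) := by
  rw [den_iff] at h ⊢
  refine ⟨h.1, fun a => ?_, fun Z => ?_⟩
  · rw [Tup.val_restrict]
    exact h.2.1 ⟨a.1, hY.1 a.2⟩
  · rw [Tup.rel_restrict]
    exact h.2.2 ⟨Z.1, hY.2 Z.2⟩

/-- Renaming of a store. -/
def Store.rename (φ : Equiv.Perm A) (S : Store A V) : Store A V :=
  fun Y => (S (Y.rename φ.symm)).rename φ

theorem Den.rename (φ : Equiv.Perm A) {S : Store A V} {X : Scheme A} {P : Phys A V} {i : ℕ}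
    {t : Tup V X} (h : Den S X P i t) :
    Den (S.rename φ) (X.rename φ) (P.rename φ) i (Tup.rename φ X t) := by
  induction h with
  | @intro X P i t js f len col list den rel wt ih =>
    rw [den_iff]
    refine ⟨len, fun a => ?_, ?_⟩
    · rw [Tup.val_rename]
      exact col ⟨φ.symm a.1, _⟩
    · rintro ⟨W, hW⟩
      obtain ⟨Y, hY, rfl⟩ := Scheme.mem_nested_rename.1 hW
      refine ⟨js ⟨Y, hY⟩, Tup.rename φ Y ∘ f ⟨Y, hY⟩, ?_, ?_, ?_, ?_⟩
      · have := list ⟨Y, hY⟩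
        simp only [Store.rename, Phys.rename, Scheme.rename_symm_rename]
        exact this
      · intro j hj
        have := ih ⟨Y, hY⟩ j hj
        simpa only [Store.rename, Scheme.rename_symm_rename, Function.comp_apply] using this
      · rw [Tup.rel_rename φ t ⟨Y, hY⟩, rel ⟨Y, hY⟩, Multiset.map_coe, List.map_map]
      · rw [Tup.rel_rename φ t ⟨Y, hY⟩, Multiset.map_map]
        have := wt ⟨Y, hY⟩
        simp only [Phys.rename, Scheme.rename_symm_rename]
        refine this.trans (congrArg _ (Multiset.map_congr rfl fun s _ => ?_))
        exact (Tup.weight_rename φ s).symm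

end

section

open Cost

/-! ## Representation of relations and dictionaries -/

variable {A V : Type}

/-- The columns for the elements of `X` have an entry for every row. -/
structure Phys.HasColumns (P : Phys A V) (X : Scheme A) : Prop where
  col : ∀ a ∈ X.flat, (P.col a).size = P.len
  hd : ∀ Y ∈ X.nested, (P.hd Y).size = P.len
  wt : ∀ Y ∈ X.nested, (P.wt Y).size = P.len

/-- The columns of the physical relations in a store have an entry for every row. -/
structure Store.HasColumns (S : Store A V) (N : Finset (Scheme A)) : Prop where
  cols : ∀ Z ∈ N, (S Z).HasColumns Z
  nxt : ∀ Z ∈ N, (S Z).nxt.size = (S Z).len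

theorem Store.HasColumns.congr {S S' : Store A V} {N N' : Finset (Scheme A)}
    (h : S.HasColumns N) (hN : N' ⊆ N) (hS : ∀ Z ∈ N', S' Z = S Z) : S'.HasColumns N' where
  cols Z hZ := by rw [hS Z hZ]; exact h.cols Z (hN hZ)
  nxt Z hZ := by rw [hS Z hZ]; exact h.nxt Z (hN hZ)

theorem Phys.HasColumns.included {P : Phys A V} {X Y : Scheme A} (h : P.HasColumns X)
    (hY : Y.Included X) : P.HasColumns Y :=
  ⟨fun a ha => h.col a (hY.1 ha), fun Z hZ => h.hd Z (hY.2 hZ), fun Z hZ => h.wt Z (hY.2 hZ)⟩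

/-- The number of rows of a shredded relation over `X`, including the store. -/
def Shred.size (X : Scheme A) (R : Shred A V) : ℕ :=
  R.phys.len + ∑ Z ∈ X.sub, (R.store Z).len

/-- The number of rows in the store of a shredded dictionary with values over `Z`. -/
def ShredDict.size {y : Finset A} (Z : Scheme A) (D : ShredDict A V y) : ℕ :=
  ∑ W ∈ insert Z Z.sub, (D.store W).len

/-- The number of rows of a shredded value. -/
def PVal.size : {τ : Ty A} → PVal V τ → ℕ
  | .rel X, R => Shred.size X R
  | .dict _ Z, D => ShredDict.size Z D

section Rep

variable [Inhabited V]

/-- `R` represents `r`; if `X` is flat, there may be rows that are not selected. -/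
structure Shred.PreRep (X : Scheme A) (R : Shred A V) (r : Rel V X) : Prop where
  cols : R.phys.HasColumns X
  store : R.store.HasColumns X.sub
  sorted : R.sel.toList.Pairwise (· < ·)
  rows : ∃ f : ℕ → Tup V X, (∀ i ∈ R.sel.toList, Den R.store X R.phys i (f i)) ∧
    r = (R.sel.toList.map f : List (Tup V X))

/-- `R` is a shredded representation of `r`. -/
structure Shred.Rep (X : Scheme A) (R : Shred A V) (r : Rel V X) : Prop
    extends Shred.PreRep X R r where
  flat : X.IsFlat → R.sel = Array.range R.phys.len

/-- `D` is a shredded representation of `d`. -/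
structure ShredDict.Rep {y : Finset A} (Z : Scheme A) (D : ShredDict A V y) (d : Dict V y Z) :
    Prop where
  store : D.store.HasColumns (insert Z Z.sub)
  none : ∀ k, D.map k = none → d k = 0
  some : ∀ k j w, D.map k = some (j, w) → InnerRep D.store Z (some j) w (d k)

/-- The shredded representations of a value. -/
def PVal.Rep : {τ : Ty A} → PVal V τ → Val V τ → Prop
  | .rel X, R, r => Shred.Rep X R r
  | .dict _ Z, D, d => ShredDict.Rep Z D d

end Rep

theorem length_le_of_sorted {l : List ℕ} {n : ℕ} (h : l.Pairwise (· < ·)) (hn : ∀ i ∈ l, i < n) :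
    l.length ≤ n := by
  have hnd : l.Nodup := h.imp fun hab => ne_of_lt hab
  have := hnd.subperm (fun i hi => List.mem_range.2 (hn i hi) : l ⊆ List.range n)
  simpa using this.length_le

theorem eq_range_of_sorted {l : List ℕ} {n : ℕ} (h : l.Pairwise (· < ·)) (hn : ∀ i ∈ l, i < n)
    (hl : n ≤ l.length) : l = List.range n := by
  have hnd : l.Nodup := h.imp fun hab => ne_of_lt hab
  have hsub : l.toFinset ⊆ Finset.range n := fun i hi =>
    Finset.mem_range.2 (hn i (List.mem_toFinset.1 hi))
  have heq := Finset.eq_of_subset_of_card_le hsub (by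
    rw [Finset.card_range, List.toFinset_card_of_nodup hnd]
    exact hl)
  refine (h.sortedLT).eq_of_mem_iff List.pairwise_lt_range.sortedLT fun i => ?_
  rw [← List.mem_toFinset, heq]
  simp

theorem map_range_getD {α β : Type} [Inhabited α] (p : Array α) (f : α → β) :
    (List.range p.size).map (fun m => f (p.getD m default)) = p.toList.map f := by
  apply List.ext_getElem
  · simp
  · intro n h1 h2
    simp at h1
    simp [Array.getD_eq_getD_getElem?, h1]

theorem foldl_filter {ι : Type} (p : ι → Bool) (l : List ι) (c : Array ι) :
    l.foldl (fun s i => if p i then s.push i else s) c = c ++ (l.filter p).toArray := by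
  induction l generalizing c with
  | nil => simp
  | cons i l ih => cases h : p i <;> simp [ih, h]

theorem foldl_update {ι : Type} {β : ι → Type} (l : List ι) (g s : (i : ι) → β i) :
    l.foldl (fun s i => Function.update s i (g i)) s = fun i => if i ∈ l then g i else s i := by
  induction l generalizing s with
  | nil => simp
  | cons b l ih =>
    rw [List.foldl_cons, ih]
    funext a
    by_cases h : a ∈ l
    · simp [h]
    · by_cases hb : a = b
      · subst hb; simp
      · simp [h, hb]

theorem Phys.HasColumns.rename (φ : Equiv.Perm A) {P : Phys A V} {X : Scheme A}
    (h : P.HasColumns X) : (P.rename φ).HasColumns (X.rename φ) := by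
  refine ⟨fun a ha => h.col _ (Scheme.mem_flat_rename.1 ha), fun W hW => ?_, fun W hW => ?_⟩
  all_goals
    obtain ⟨Y, hY, rfl⟩ := Scheme.mem_nested_rename.1 hW
    simp only [Phys.rename, Scheme.rename_symm_rename]
  · exact h.hd Y hY
  · exact h.wt Y hY

theorem size_physRename (φ : Equiv.Perm A) (X : Scheme A) (R : Shred A V) :
    (physRename X φ R).val.size (X.rename φ) = R.size X := by
  rw [Shred.size, Scheme.sub_rename, Finset.sum_image fun _ _ _ _ h =>
    Scheme.rename_injective φ h]
  simp only [physRename, val_steps, Scheme.rename_symm_rename]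
  rfl

variable [Inhabited V]

theorem Shred.PreRep.lt_len {X : Scheme A} {R : Shred A V} {r : Rel V X} (h : R.PreRep X r) :
    ∀ i ∈ R.sel.toList, i < R.phys.len := by
  obtain ⟨f, hf, _⟩ := h.rows
  exact fun i hi => (hf i hi).lt_len

theorem Shred.PreRep.size_sel {X : Scheme A} {R : Shred A V} {r : Rel V X} (h : R.PreRep X r) :
    R.sel.size ≤ R.phys.len := by
  simpa using length_le_of_sorted h.sorted h.lt_len

/-! ### Removal of invalid rows -/

/-- Rows gathered from `P` at the positions `p`. -/
theorem rowSim_takeInto (O P : Phys A V) (X : Scheme A) (p : Array ℕ) (hO : O.len = p.size)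
    (m : ℕ) (hm : m < p.size) :
    RowSim (fun _ => id) X P (p.getD m default) (O.takeInto P X.flat X.nested p).val m := by
  rw [Phys.val_takeInto]
  refine .of_id (hO ▸ hm) (fun a ha => ?_) (fun Y hY => ?_) (fun Y hY => ?_)
  · simp only [ha, if_true]
    exact getD_gather _ _ _ hm
  · simp only [hY, if_true]
    exact getD_gather _ _ _ hm
  · simp only [hY, if_true]
    exact getD_gather _ _ _ hm

theorem hasColumns_takeInto (O P : Phys A V) (X : Scheme A) (p : Array ℕ) (hO : O.len = p.size) :
    (O.takeInto P X.flat X.nested p).val.HasColumns X := by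
  rw [Phys.val_takeInto]
  exact ⟨fun a ha => by simp [ha, hO], fun a ha => by simp [ha, hO], fun a ha => by simp [ha, hO]⟩

/-- Selecting all rows of a physical relation that has been gathered at the positions `p`. -/
theorem preRep_takeInto {X : Scheme A} {P : Phys A V} {S : Store A V} {f : ℕ → Tup V X}
    {p : Array ℕ} (O : Phys A V) (hS : S.HasColumns X.sub)
    (hf : ∀ i ∈ p.toList, Den S X P i (f i)) (hO : O.len = p.size) :
    Shred.PreRep X ⟨(O.takeInto P X.flat X.nested p).val, S, Array.range p.size⟩
      (p.toList.map f : List (Tup V X)) := by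
  refine ⟨hasColumns_takeInto _ _ _ _ hO, hS, ?_, fun m => f (p.getD m default), ?_, ?_⟩
  · simpa using List.pairwise_lt_range
  · intro m hm
    simp only [Array.toList_range, List.mem_range] at hm
    refine (hf _ ?_).sim (.of_eq fun _ _ => rfl) (rowSim_takeInto O P X p hO m hm)
    simp [Array.getD_eq_getD_getElem?, hm]
  · simp only [Array.toList_range]
    rw [map_range_getD]

/-- The shredded relation without the invalid rows. -/
def Shred.compacted (X : Scheme A) (R : Shred A V) : Shred A V :=
  ⟨(compact X R.phys R.sel).val.1, R.store, (compact X R.phys R.sel).val.2⟩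

theorem Shred.PreRep.sel_compacted {X : Scheme A} {R : Shred A V} {r : Rel V X}
    (h : R.PreRep X r) : (R.compacted X).sel = Array.range (R.compacted X).phys.len := by
  simp only [compacted, val_compact]
  split_ifs with hlt
  · simp [Phys.val_takeInto, Phys.new]
  · apply Array.toList_inj.1
    rw [eq_range_of_sorted h.sorted h.lt_len (by simpa using hlt)]
    simp

theorem Shred.PreRep.compacted {X : Scheme A} {R : Shred A V} {r : Rel V X}
    (h : R.PreRep X r) : (R.compacted X).Rep X r := by
  refine ⟨?_, fun _ => h.sel_compacted⟩
  simp only [Shred.compacted, val_compact]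
  split_ifs with hlt
  · obtain ⟨f, hf, rfl⟩ := h.rows
    exact preRep_takeInto _ h.store hf rfl
  · exact h

theorem len_compacted_le (X : Scheme A) (R : Shred A V) :
    (R.compacted X).phys.len ≤ R.phys.len := by
  simp only [Shred.compacted, val_compact]
  split_ifs with hlt
  · simp only [Phys.val_takeInto, Phys.new]
    omega
  · exact le_rfl

theorem size_compacted_le (X : Scheme A) (R : Shred A V) :
    (R.compacted X).size X ≤ R.size X :=
  Nat.add_le_add_right (len_compacted_le X R) _

/-! ### Selection -/

/-- The selection vector of a selection. -/
theorem val_physSelect (X : Scheme A) (y : Finset A) (θ : (y → V) → Bool) (R : Shred A V) :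
    (physSelect X y θ R).val =
      let s := (R.sel.toList.filter fun i =>
        θ fun a : y => (R.phys.col a.1).getD i default).toArray
      if X.IsFlat then (⟨R.phys, R.store, s⟩ : Shred A V).compacted X
      else ⟨R.phys, R.store, s⟩ := by
  have h1 : (loop R.sel.toList #[] fun s i => do
      let k ← R.phys.readKey y i
      let b ← steps 1 (θ k)
      if b then push s i else pure s).val = (R.sel.toList.filter fun i =>
        θ fun a : y => (R.phys.col a.1).getD i default).toArray := by
    rw [val_loop]
    have := foldl_filter (fun i => θ fun a : y => (R.phys.col a.1).getD i default) R.sel.toList #[]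
    rw [Array.empty_append] at this
    rw [← this]
    congr 1
    funext s i
    change (if θ (fun a : y => (R.phys.col a.1).getD i default) = true then push s i
      else pure s : Cost (Array ℕ)).val = _
    split_ifs <;> rfl
  rw [physSelect, val_bind, h1]
  split_ifs <;> rfl

theorem time_physSelect (X : Scheme A) (y : Finset A) (θ : (y → V) → Bool) (R : Shred A V)
    (h : R.sel.size ≤ R.phys.len) :
    (physSelect X y θ R).time ≤
      (y.card + 11 + 6 * (X.flat.card + X.nested.card)) * (R.phys.len + 1) := by
  have h1 : (loop R.sel.toList #[] fun s i => do
      let k ← R.phys.readKey y i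
      let b ← steps 1 (θ k)
      if b then push s i else pure s).time ≤ R.sel.toList.length * (y.card + 3 + 1) + 1 := by
    refine time_loop_le _ fun i _ s => ?_
    change y.card + 1 + (1 + (if θ (fun a : y => (R.phys.col a.1).getD i default) = true
      then push s i else pure s : Cost (Array ℕ)).time) ≤ _
    split_ifs <;> simp
  have h2 : R.sel.toList.length * (y.card + 3 + 1) ≤ R.phys.len * (y.card + 3 + 1) :=
    Nat.mul_le_mul_right _ (by simpa using h)
  rw [physSelect, time_bind]
  split_ifs
  · rw [time_bind]
    refine (add_le_add (h1.trans (Nat.add_le_add_right h2 1)) (Nat.add_le_add_right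
      (time_compact X _ _) _)).trans ?_
    simp only [time_pure]
    nlinarith [Nat.zero_le (y.card)]
  · rw [time_pure]
    nlinarith [Nat.zero_le (y.card), Nat.zero_le (X.flat.card * R.phys.len),
      Nat.zero_le (X.nested.card * R.phys.len), Nat.zero_le R.phys.len]

theorem rep_physSelect {X : Scheme A} {y : Finset A} (hy : y ⊆ X.flat) (θ : (y → V) → Bool)
    {R : Shred A V} {r : Rel V X} (h : R.Rep X r) :
    (physSelect X y θ R).val.Rep X (r.filter fun t => θ (t.key y hy) = true) := by
  have key : Shred.PreRep X ⟨R.phys, R.store, (R.sel.toList.filter fun i =>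
        θ fun a : y => (R.phys.col a.1).getD i default).toArray⟩
      (r.filter fun t => θ (t.key y hy) = true) := by
    obtain ⟨f, hf, rfl⟩ := h.rows
    refine ⟨h.cols, h.store, ?_, f, ?_, ?_⟩
    · simpa using h.sorted.sublist List.filter_sublist
    · intro i hi
      simp only [List.mem_filter] at hi
      exact hf i hi.1
    · rw [Multiset.filter_coe, List.filter_map]
      congr 2
      refine List.filter_congr fun i hi => ?_
      rw [(hf i hi).key_eq y hy]
      simp
  rw [val_physSelect]
  simp only
  split_ifs with hX
  · exact key.compacted
  · exact ⟨key, fun hX' => absurd hX' hX⟩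

theorem size_physSelect (X : Scheme A) (y : Finset A) (θ : (y → V) → Bool) (R : Shred A V) :
    (physSelect X y θ R).val.size X ≤ R.size X := by
  rw [val_physSelect]
  simp only
  split_ifs
  · exact size_compacted_le X _
  · exact le_rfl

/-! ### Projection -/

theorem rep_columns {X Y : Scheme A} (hY : Y.Included X) {R : Shred A V} {r : Rel V X}
    (h : R.PreRep X r) :
    Shred.PreRep Y ⟨(R.phys.columns Y).val,
      fun Z => if Z ∈ Y.sub then R.store Z else Phys.new A V 0, R.sel⟩
      (r.map (Tup.restrict hY)) := by
  obtain ⟨f, hf, rfl⟩ := h.rows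
  refine ⟨?_, h.store.congr (Scheme.sub_mono hY.2) fun Z hZ => if_pos hZ, h.sorted,
    Tup.restrict hY ∘ f, fun i hi => ?_, ?_⟩
  · have := h.cols.included hY
    exact ⟨fun a ha => by simp [Phys.columns, ha, this.col a ha],
      fun a ha => by simp [Phys.columns, ha, this.hd a ha],
      fun a ha => by simp [Phys.columns, ha, this.wt a ha]⟩
  · refine ((hf i hi).restrict hY).sim (.of_eq fun Z hZ => if_pos hZ)
      (.of_id (hf i hi).lt_len ?_ ?_ ?_)
    · intro a ha
      simp [Phys.columns, ha]
    · intro a ha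
      simp [Phys.columns, ha]
    · intro a ha
      simp [Phys.columns, ha]
  · rw [Multiset.map_coe, List.map_map]

theorem val_physProject (X Y : Scheme A) (R : Shred A V) :
    (physProject X Y R).val =
      let R' : Shred A V := ⟨(R.phys.columns Y).val,
        fun Z => if Z ∈ Y.sub then R.store Z else Phys.new A V 0, R.sel⟩
      if Y.IsFlat then R'.compacted Y else R' := by
  rw [physProject, val_bind, val_bind]
  split_ifs <;> rfl

theorem rep_physProject {X Y : Scheme A} (hY : Y.Included X) {R : Shred A V} {r : Rel V X}
    (h : R.Rep X r) : (physProject X Y R).val.Rep Y (r.map (Tup.restrict hY)) := by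
  rw [val_physProject]
  simp only
  have := rep_columns hY h.toPreRep
  split_ifs with hf
  · exact this.compacted
  · exact ⟨this, fun h => absurd h hf⟩

theorem size_physProject {X Y : Scheme A} (hY : Y.Included X) (R : Shred A V) :
    (physProject X Y R).val.size Y ≤ R.size X := by
  have key : Shred.size Y ⟨(R.phys.columns Y).val,
      fun Z => if Z ∈ Y.sub then R.store Z else Phys.new A V 0, R.sel⟩ ≤ R.size X := by
    refine add_le_add le_rfl ?_
    refine (Finset.sum_congr rfl fun Z hZ => ?_).trans_le
      (Finset.sum_le_sum_of_subset (Scheme.sub_mono hY.2))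
    simp [hZ]
  rw [val_physProject]
  simp only
  split_ifs
  · exact (size_compacted_le Y _).trans key
  · exact key

theorem time_physProject (X Y : Scheme A) (R : Shred A V) :
    (physProject X Y R).time ≤
      (7 * Y.flat.card + 8 * Y.nested.card + X.sub.card + 8) * (R.phys.len + 1) := by
  rw [physProject, time_bind, time_bind]
  have h1 : (R.phys.columns Y).time = Y.flat.card + 2 * Y.nested.card + 1 := rfl
  have h2 : (R.phys.columns Y).val.len = R.phys.len := rfl
  have h3 := time_compact Y (R.phys.columns Y).val R.sel
  rw [h2] at h3
  rw [h1, time_steps]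
  split_ifs
  · rw [time_bind, time_pure]
    nlinarith [Nat.zero_le (X.sub.card * R.phys.len), Nat.zero_le (Y.flat.card * R.phys.len),
      Nat.zero_le (Y.nested.card * R.phys.len)]
  · rw [time_pure]
    nlinarith [Nat.zero_le (X.sub.card * R.phys.len), Nat.zero_le (Y.flat.card * R.phys.len),
      Nat.zero_le (Y.nested.card * R.phys.len)]

/-! ### Renaming -/

theorem rep_physRename (φ : Equiv.Perm A) {X : Scheme A} {R : Shred A V} {r : Rel V X}
    (h : R.Rep X r) : (physRename X φ R).val.Rep (X.rename φ) (r.map (Tup.rename φ X)) := by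
  refine ⟨⟨Phys.HasColumns.rename φ h.cols, ⟨?_, ?_⟩, h.sorted, ?_⟩, ?_⟩
  · intro W hW
    rw [Scheme.sub_rename, Finset.mem_image] at hW
    obtain ⟨Y, hY, rfl⟩ := hW
    simp only [physRename, val_steps, Scheme.rename_symm_rename]
    exact Phys.HasColumns.rename φ (h.store.cols Y hY)
  · intro W hW
    rw [Scheme.sub_rename, Finset.mem_image] at hW
    obtain ⟨Y, hY, rfl⟩ := hW
    simp only [physRename, val_steps, Scheme.rename_symm_rename]
    exact h.store.nxt Y hY
  · obtain ⟨f, hf, rfl⟩ := h.rows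
    refine ⟨Tup.rename φ X ∘ f, fun i hi => (hf i hi).rename φ, ?_⟩
    rw [Multiset.map_coe, List.map_map]
    rfl
  · intro hX
    refine h.flat ?_
    rw [Scheme.IsFlat, Scheme.nested_rename, Finset.image_eq_empty] at hX
    exact hX

end

section

open Cost

namespace Cost

variable {α β ι σ : Type}

/-- The result satisfies `Q` and is computed in at most `n` steps. -/
def Sat (x : Cost α) (Q : α → Prop) (n : ℕ) : Prop := Q x.val ∧ x.time ≤ n

theorem Sat.self {x : Cost α} {n : ℕ} (h : x.time ≤ n) : Sat x (· = x.val) n := ⟨rfl, h⟩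

theorem Sat.bind {x : Cost α} {f : α → Cost β} {Q : α → Prop} {Q' : β → Prop} {n m : ℕ}
    (hx : Sat x Q n) (hf : ∀ a, Q a → Sat (f a) Q' m) : Sat (x >>= f) Q' (n + m) :=
  ⟨(hf _ hx.1).1, add_le_add hx.2 (hf _ hx.1).2⟩

theorem Sat.pure {a : α} {Q : α → Prop} (h : Q a) : Sat (pure a : Cost α) Q 0 := ⟨h, le_rfl⟩

theorem Sat.mono {x : Cost α} {Q Q' : α → Prop} {n m : ℕ} (h : Sat x Q n)
    (hQ : ∀ a, Q a → Q' a) (hn : n ≤ m) : Sat x Q' m := ⟨hQ _ h.1, h.2.trans hn⟩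

theorem Sat.loop {l : List ι} {s : σ} {body : σ → ι → Cost σ} (I : List ι → σ → Prop)
    (b : ι → ℕ) (h0 : I [] s)
    (h : ∀ pre i post s, l = pre ++ i :: post → I pre s → Sat (body s i) (I (pre ++ [i])) (b i)) :
    Sat (loop l s body) (I l) ((l.map fun i => b i + 1).sum + 1) :=
  loop_rule I b h0 h

theorem Sat.loop_const {l : List ι} {s : σ} {body : σ → ι → Cost σ} (I : List ι → σ → Prop)
    (b : ℕ) (h0 : I [] s)
    (h : ∀ pre i post s, l = pre ++ i :: post → I pre s → Sat (body s i) (I (pre ++ [i])) b) :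
    Sat (Cost.loop l s body) (I l) ((b + 1) * l.length + 1) := by
  refine (Sat.loop I (fun _ => b) h0 h).mono (fun _ h => h) ?_
  simp
  nlinarith

end Cost

variable {A V : Type}

theorem groupByRel_apply (X : Scheme A) (y : Finset A) (hy : y ⊆ X.flat) (R : Rel V X)
    (k : y → V) : groupByRel X y hy R k =
      (R.filter fun t => t.key y hy = k).map (Tup.restrict (X.remove_included y)) := rfl

variable [Inhabited V]

theorem Den.wt_eq {S : Store A V} {X : Scheme A} {P : Phys A V} {i : ℕ} {t : Tup V X}
    (h : Den S X P i t) {Y : Scheme A} (hY : Y ∈ X.nested) :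
    (P.wt Y).getD i default = t.relWeight Y := by
  obtain ⟨_, _, _, _, _, h⟩ := (den_iff.1 h).2.2 ⟨Y, hY⟩
  exact h.trans (t.relWeight_eq ⟨Y, hY⟩).symm

theorem Den.prod_wt {S : Store A V} {X : Scheme A} {P : Phys A V} {i : ℕ} {t : Tup V X}
    (h : Den S X P i t) : ∏ Y ∈ X.nested, (P.wt Y).getD i default = t.weight := by
  rw [Tup.weight_eq]
  exact Finset.prod_congr rfl fun Y hY => h.wt_eq hY

theorem InnerRep.ne_zero {S : Store A V} {Y : Scheme A} {j w : ℕ}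
    {r : Multiset (Tup V Y)} (h : InnerRep S Y (some j) w r) : r ≠ 0 := by
  obtain ⟨js, f, h1, -, rfl, -⟩ := h
  cases js with
  | nil => exact absurd h1 (by simp [IsList])
  | cons j l => simp

/-! ### Group-by -/

/-- The members of `l` with key `k`. -/
def group {K : Type} (κ : ℕ → K) (l : List ℕ) (k : K) : List ℕ := l.filter fun i => κ i = k

theorem mem_group {K : Type} {κ : ℕ → K} {l : List ℕ} {k : K} {i : ℕ} :
    i ∈ group κ l k ↔ i ∈ l ∧ κ i = k := by simp [group]

theorem group_append_self {K : Type} {κ : ℕ → K} {l : List ℕ} {i : ℕ} :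
    group κ (l ++ [i]) (κ i) = group κ l (κ i) ++ [i] := by simp [group]

theorem group_append_of_ne {K : Type} {κ : ℕ → K} {l : List ℕ} {i : ℕ} {k : K} (h : κ i ≠ k) :
    group κ (l ++ [i]) k = group κ l k := by simp [group, h]

/-- The hash table `h` and the pointers `nxt` after the rows `l` with keys `κ` and weights `w` have
been processed. -/
structure Grouped {K : Type} (κ : ℕ → K) (w : Array ℕ) (n : ℕ) (l : List ℕ)
    (h : K → Option (ℕ × ℕ)) (nxt : Array (Option ℕ)) : Prop where
  size : nxt.size = n
  none : ∀ j, j ∉ l → nxt.getD j none = none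
  list : ∀ k, IsList nxt ((h k).map Prod.fst) (group κ l k).reverse
  weight : ∀ k p, h k = some p → p.2 = ((group κ l k).map fun i => w.getD i default).sum

theorem Grouped.group_eq_nil {K : Type} {κ : ℕ → K} {w : Array ℕ} {n : ℕ} {l : List ℕ}
    {h : K → Option (ℕ × ℕ)} {nxt : Array (Option ℕ)} (hg : Grouped κ w n l h nxt) {k : K}
    (hk : h k = Option.none) : group κ l k = [] := by
  have := hg.list k
  rw [hk] at this
  cases hf : (group κ l k).reverse with
  | nil => rwa [List.reverse_eq_nil_iff] at hf
  | cons a b =>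
    rw [hf] at this
    exact absurd this.1 (by simp)

theorem Grouped.insert {K : Type} {κ : ℕ → K} {w : Array ℕ} {n : ℕ} {l : List ℕ}
    {h : K → Option (ℕ × ℕ)} {nxt nxt' : Array (Option ℕ)} {i : ℕ} (hg : Grouped κ w n l h nxt)
    (hl : ∀ j ∈ l, j < i) (hsize : nxt'.size = n)
    (hi : nxt'.getD i Option.none = (h (κ i)).map Prod.fst)
    (hj : ∀ j, j ≠ i → nxt'.getD j Option.none = nxt.getD j Option.none) :
    Grouped κ w n (l ++ [i])
      (Function.update h (κ i) (some (i, ((h (κ i)).map Prod.snd).getD 0 + w.getD i default)))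
      nxt' := by
  have hold : ∀ k, IsList nxt' ((h k).map Prod.fst) (group κ l k).reverse :=
    fun k => (hg.list k).congr fun j hj' => hj j (by
      rw [List.mem_reverse, mem_group] at hj'
      exact (hl j hj'.1).ne)
  refine ⟨hsize, fun j hj' => ?_, fun k => ?_, fun k p hp => ?_⟩
  · simp only [List.mem_append, List.mem_singleton, not_or] at hj'
    rw [hj j hj'.2, hg.none j hj'.1]
  · by_cases hk : κ i = k
    · subst hk
      rw [Function.update_self, group_append_self, List.reverse_append]
      refine ⟨rfl, fun j hj' => ?_, ?_⟩
      · exact hl j (mem_group.1 (List.mem_reverse.1 hj')).1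
      · rw [hi]
        exact hold (κ i)
    · rw [Function.update_of_ne (Ne.symm hk), group_append_of_ne hk]
      exact hold k
  · by_cases hk : κ i = k
    · subst hk
      rw [Function.update_self, Option.some_inj] at hp
      subst hp
      rw [group_append_self, List.map_append, List.sum_append]
      simp only [List.map_cons, List.map_nil, List.sum_cons, List.sum_nil,
        add_zero, Nat.add_right_cancel_iff]
      cases hh : h (κ i) with
      | none => simp [hg.group_eq_nil hh]
      | some p => simpa using hg.weight (κ i) p hh
    · rw [Function.update_of_ne (Ne.symm hk)] at hp
      rw [group_append_of_ne hk]
      exact hg.weight k p hp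

theorem sat_physGroupBy {X : Scheme A} (y : Finset A) {R : Shred A V} {r : Rel V X}
    (h : R.PreRep X r) :
    Sat (physGroupBy X y R) (fun D => ∃ nxt,
        Grouped (fun i (a : y) => (R.phys.col a.1).getD i default) (multiplyWeights R.phys X).val
          R.phys.len R.sel.toList D.map nxt ∧
        D.store = Function.update R.store (X.remove y)
          { (R.phys.columns (X.remove y)).val with nxt := nxt })
      ((9 * X.nested.card + y.card + X.flat.card + 20) * (R.phys.len + 1)) := by
  unfold physGroupBy
  refine Sat.mono (n := (7 * X.nested.card + 2) * (R.phys.len + 1) + (R.phys.len + 1 + (1 +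
    ((y.card + 6 + 1) * R.sel.toList.length + 1 +
      ((X.remove y).flat.card + 2 * (X.remove y).nested.card + 1 + (1 + 0))))))
    (Sat.bind (Sat.self (time_multiplyWeights _ _)) ?_) (fun _ h => h) ?_
  · rintro w rfl
    refine Sat.bind (Sat.self (time_fill _ _).le) ?_
    rintro nxt rfl
    refine Sat.bind (Sat.self (HashMap.time_new _ _).le) ?_
    rintro h0 rfl
    refine Sat.bind (Sat.loop_const (fun l s => Grouped (fun i (a : y) =>
      (R.phys.col a.1).getD i default) (multiplyWeights R.phys X).val R.phys.len l s.1 s.2)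
      (y.card + 6) ?_ ?_) ?_
    · refine ⟨by simp, fun j _ => ?_, fun k => rfl, fun k p hp => absurd hp (by simp)⟩
      by_cases hj : j < R.phys.len <;> simp [Array.getD_eq_getD_getElem?, hj]
    · rintro pre i post ⟨hm, nxt⟩ hl hg
      have hs := h.sorted
      have hlt : i < R.phys.len := h.lt_len i (by rw [hl]; simp)
      rw [hl, List.pairwise_append] at hs
      have hpre : ∀ j ∈ pre, j < i := fun j hj => hs.2.2 j hj i (by simp)
      have hi : i ∉ pre := fun hi => (hpre i hi).false
      refine Sat.mono (n := y.card + 1 + (1 + (1 + 3)))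
        (Sat.bind (Sat.self (Phys.time_readKey _ _ _).le) ?_) (fun _ h => h) (by omega)
      rintro k rfl
      refine Sat.bind (Sat.self (time_rd _ _).le) ?_
      rintro wi rfl
      refine Sat.bind (Sat.self (HashMap.time_lookup _ _).le) ?_
      rintro e rfl
      simp only [Phys.val_readKey, HashMap.val_lookup, val_rd]
      split
      · rename_i j v hk
        refine ⟨?_, le_of_eq rfl⟩
        replace hg : Grouped _ _ _ _ hm nxt := hg
        have := hg.insert (i := i) (nxt' := nxt.setIfInBounds i (some j)) hpre (by simp [hg.size])
          (by
            rw [getD_setIfInBounds, if_pos ⟨rfl, by rw [hg.size]; exact hlt⟩, hk]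
            rfl)
          fun j' hj' => by rw [getD_setIfInBounds, if_neg fun h => hj' h.1.symm]
        simp only [hk] at this
        exact this
      · rename_i hk
        refine ⟨?_, by simp⟩
        replace hg : Grouped _ _ _ _ hm nxt := hg
        have := hg.insert (i := i) hpre hg.size (by rw [hk, hg.none i hi]; rfl) fun _ _ => rfl
        simp only [hk] at this
        simpa using this
    · rintro ⟨hm, nxt⟩ hg
      refine Sat.bind (Sat.self (n := (X.remove y).flat.card + 2 * (X.remove y).nested.card + 1)
        le_rfl) ?_
      rintro P rfl
      refine Sat.bind (Sat.self (time_steps _ _).le) ?_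
      rintro S rfl
      exact Sat.pure ⟨nxt, hg, rfl⟩
  · have h1 : (X.remove y).flat.card ≤ X.flat.card := Finset.card_le_card Finset.sdiff_subset
    have h2 : R.sel.toList.length ≤ R.phys.len := by simpa using h.size_sel
    rw [Scheme.nested_remove]
    nlinarith [Nat.mul_le_mul_left (y.card + 6 + 1) h2, Nat.zero_le (X.flat.card * R.phys.len),
      Nat.zero_le (X.nested.card * R.phys.len)]

theorem rep_physGroupBy {X : Scheme A} {y : Finset A} (hy : y ⊆ X.flat) {R : Shred A V}
    {r : Rel V X} (h : R.Rep X r) :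
    (physGroupBy X y R).val.Rep (X.remove y) (groupByRel X y hy r) := by
  obtain ⟨nxt, hg, hS⟩ := (sat_physGroupBy y h.toPreRep).1
  obtain ⟨f, hf, rfl⟩ := h.rows
  have hself : (physGroupBy X y R).val.store (X.remove y) =
      { (R.phys.columns (X.remove y)).val with nxt := nxt } := by
    rw [hS, Function.update_self]
  have hsub : ∀ Z ∈ (X.remove y).sub, (physGroupBy X y R).val.store Z = R.store Z := by
    intro Z hZ
    rw [hS, Function.update_of_ne]
    rintro rfl
    exact Scheme.notMem_sub_self _ hZ
  have hfilter : ∀ k, (R.sel.toList.map f : Multiset (Tup V X)).filter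
      (fun t => t.key y hy = k) = ((group (fun i (a : y) => (R.phys.col a.1).getD i default)
        R.sel.toList k).map f : List (Tup V X)) := by
    intro k
    rw [Multiset.filter_coe, List.filter_map, group]
    congr 2
    refine List.filter_congr fun i hi => ?_
    rw [(hf i hi).key_eq y hy]
    simp
  refine ⟨⟨?_, ?_⟩, fun k hk => ?_, fun k j w hk => ?_⟩
  · intro Z hZ
    rcases Finset.mem_insert.1 hZ with rfl | hZ
    · rw [hself]
      have := h.cols.included (X.remove_included y)
      exact ⟨fun a ha => by simp [Phys.columns, ha, this.col a ha],
        fun a ha => by simp [Phys.columns, ha, this.hd a ha],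
        fun a ha => by simp [Phys.columns, ha, this.wt a ha]⟩
    · rw [hsub Z hZ]
      rw [Scheme.sub_remove] at hZ
      exact h.store.cols Z hZ
  · intro Z hZ
    rcases Finset.mem_insert.1 hZ with rfl | hZ
    · rw [hself]
      exact hg.size
    · rw [hsub Z hZ]
      rw [Scheme.sub_remove] at hZ
      exact h.store.nxt Z hZ
  · rw [groupByRel_apply, hfilter, hg.group_eq_nil hk]
    rfl
  · have hd : groupByRel X y hy (R.sel.toList.map f : List (Tup V X)) k =
        ((group (fun i (a : y) => (R.phys.col a.1).getD i default) R.sel.toList k).reverse.map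
          (Tup.restrict (X.remove_included y) ∘ f) : List _) := by
      rw [groupByRel_apply, hfilter, Multiset.map_coe, List.map_map, List.map_reverse,
        Multiset.coe_reverse]
    refine ⟨_, _, ?_, ?_, hd, ?_⟩
    · have := hg.list k
      rw [hk] at this
      rw [hself]
      exact this
    · intro i hi
      rw [List.mem_reverse, mem_group] at hi
      have hden := hf i hi.1
      rw [hself]
      refine (hden.restrict (X.remove_included y)).sim (.of_eq hsub) (.of_id hden.lt_len ?_ ?_ ?_)
      all_goals
        intro a ha
        simp [Phys.columns, ha]
    · have hw : w = _ := hg.weight k _ hk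
      rw [hd, hw, Multiset.map_coe, Multiset.sum_coe, List.map_map, List.map_reverse,
        List.sum_reverse]
      refine congrArg _ (List.map_congr_left fun i hi => ?_)
      have hi := hf i (mem_group.1 hi).1
      rw [(val_multiplyWeights R.phys X).2 i hi.lt_len, hi.prod_wt]
      exact (Tup.weight_restrict _ (X.nested_remove y) _).symm

theorem size_physGroupBy {X : Scheme A} {y : Finset A} {R : Shred A V}
    {r : Rel V X} (h : R.Rep X r) :
    (physGroupBy X y R).val.size (X.remove y) = R.size X := by
  obtain ⟨nxt, hg, hS⟩ := (sat_physGroupBy y h.toPreRep).1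
  rw [ShredDict.size, Finset.sum_insert (Scheme.notMem_sub_self _), Shred.size, hS,
    Function.update_self, Scheme.sub_remove]
  congr 1
  refine Finset.sum_congr rfl fun Z hZ => ?_
  rw [Function.update_of_ne]
  rintro rfl
  exact X.remove_notMem_sub y hZ

/-! ### Nested semijoin -/

theorem sat_physSemijoin {X : Scheme A} (y : Finset A) (Z : Scheme A) {R : Shred A V}
    (D : ShredDict A V y) {r : Rel V X} (h : R.PreRep X r) :
    Sat (physSemijoin X y Z R D) (fun T => ∃ hd wt,
        T = ⟨{ R.phys with hd := Function.update R.phys.hd Z hd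
                           wt := Function.update R.phys.wt Z wt },
          fun Y => if Y ∈ X.sub then R.store Y else D.store Y,
          (R.sel.toList.filter fun i =>
            (D.map fun a : y => (R.phys.col a.1).getD i default).isSome).toArray⟩ ∧
        hd.size = R.phys.len ∧ wt.size = R.phys.len ∧
        ∀ i ∈ R.sel.toList, ∀ j w, (D.map fun a : y => (R.phys.col a.1).getD i default) =
          some (j, w) → hd.getD i none = some j ∧ wt.getD i 0 = w)
      ((y.card + X.sub.card + Z.sub.card + 14) * (R.phys.len + 1)) := by
  unfold physSemijoin
  refine Sat.mono (n := R.phys.len + 1 + (R.phys.len + 1 + ((y.card + 5 + 1) *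
    R.sel.toList.length + 1 + (X.sub.card + Z.sub.card + 1 + 0))))
    (Sat.bind (Sat.self (time_fill _ _).le) ?_) (fun _ h => h) ?_
  · rintro hd rfl
    refine Sat.bind (Sat.self (time_fill _ _).le) ?_
    rintro wt rfl
    refine Sat.bind (Sat.loop_const (fun l s => s.1 = (l.filter fun i =>
        (D.map fun a : y => (R.phys.col a.1).getD i default).isSome).toArray ∧
        s.2.1.size = R.phys.len ∧ s.2.2.size = R.phys.len ∧
        ∀ i ∈ l, ∀ j w, (D.map fun a : y => (R.phys.col a.1).getD i default) =
          some (j, w) → s.2.1.getD i none = some j ∧ s.2.2.getD i 0 = w)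
      (y.card + 5) ?_ ?_) ?_
    · simp
    · rintro pre i post ⟨s, hd, wt⟩ hl ⟨h1, h2, h3, h4⟩
      have hlt : i < R.phys.len := h.lt_len i (by rw [hl]; simp)
      dsimp only at h1 h2 h3 h4
      refine Sat.mono (n := y.card + 1 + (1 + 3))
        (Sat.bind (Sat.self (Phys.time_readKey _ _ _).le) ?_) (fun _ h => h) (by omega)
      rintro k rfl
      refine Sat.bind (Sat.self (HashMap.time_lookup _ _).le) ?_
      rintro e rfl
      simp only [Phys.val_readKey, HashMap.val_lookup]
      split
      · rename_i j w hk
        refine ⟨?_, le_of_eq rfl⟩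
        simp only [val_bind, val_push, val_wr, val_pure]
        refine ⟨?_, by simp [h2], by simp [h3], ?_⟩
        · rw [h1, List.filter_append, List.filter_cons_of_pos (by rw [hk]; rfl)]
          simp
        · intro i' hi' j' w' hk'
          rw [getD_setIfInBounds, getD_setIfInBounds, h2, h3]
          by_cases he : i = i'
          · subst he
            rw [hk] at hk'
            simp only [Option.some.injEq, Prod.mk.injEq] at hk'
            simp [hlt, hk'.1, hk'.2]
          · rw [if_neg fun h => he h.1, if_neg fun h => he h.1]
            refine h4 i' ?_ j' w' hk'
            simpa [Ne.symm he] using hi'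
      · rename_i hk
        refine ⟨⟨?_, h2, h3, ?_⟩, by simp⟩
        · simp only [val_pure]
          rw [h1, List.filter_append, List.filter_cons_of_neg (by rw [hk]; simp)]
          simp
        · intro i' hi' j' w' hk'
          refine h4 i' ?_ j' w' hk'
          rw [List.mem_append, List.mem_singleton] at hi'
          refine hi'.resolve_right ?_
          rintro rfl
          rw [hk] at hk'
          simp at hk'
    · rintro ⟨s, hd, wt⟩ ⟨rfl, h2, h3, h4⟩
      refine Sat.bind (Sat.self (time_steps _ _).le) ?_
      rintro S rfl
      exact Sat.pure ⟨hd, wt, rfl, h2, h3, h4⟩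
  · have h2 : R.sel.toList.length ≤ R.phys.len := by simpa using h.size_sel
    nlinarith [Nat.mul_le_mul_left (y.card + 5 + 1) h2, Nat.zero_le (X.sub.card * R.phys.len),
      Nat.zero_le (Z.sub.card * R.phys.len)]

theorem rep_physSemijoin {X : Scheme A} {y : Finset A} {Z : Scheme A} (hy : y ⊆ X.flat)
    (hsub : Disjoint (insert Z Z.sub) X.sub) {R : Shred A V} {D : ShredDict A V y} {r : Rel V X}
    {d : Dict V y Z} (hR : R.Rep X r) (hD : D.Rep Z d) :
    (physSemijoin X y Z R D).val.Rep (X.extend Z) (semijoinRel X y Z hy r d) := by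
  obtain ⟨hd, wt, hT, hhd, hwt, hrow⟩ := (sat_physSemijoin y Z D hR.toPreRep).1
  obtain ⟨f, hf, rfl⟩ := hR.rows
  have hZ : ∀ {W}, W ∈ insert Z Z.sub → W ∉ X.sub := fun h => Finset.disjoint_left.1 hsub h
  have hne : ∀ {W}, W ∈ X.nested → W ≠ Z := by
    rintro W hW rfl
    exact hZ (Finset.mem_insert_self _ _) (X.nested_subset_sub hW)
  rw [hT]
  refine ⟨⟨⟨?_, ?_, ?_⟩, ⟨?_, ?_⟩, ?_, ?_⟩, ?_⟩
  · exact hR.cols.col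
  · intro W hW
    rcases Scheme.mem_nested_extend.1 hW with rfl | hW
    · simpa using hhd
    · simpa [hne hW] using hR.cols.hd W hW
  · intro W hW
    rcases Scheme.mem_nested_extend.1 hW with rfl | hW
    · simpa using hwt
    · simpa [hne hW] using hR.cols.wt W hW
  · intro W hW
    rcases Scheme.mem_sub_extend.1 hW with hW | hW
    · simpa only [if_pos hW] using hR.store.cols W hW
    · simpa only [if_neg (hZ hW)] using hD.store.cols W hW
  · intro W hW
    rcases Scheme.mem_sub_extend.1 hW with hW | hW
    · simpa only [if_pos hW] using hR.store.nxt W hW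
    · simpa only [if_neg (hZ hW)] using hD.store.nxt W hW
  · simpa using hR.sorted.sublist List.filter_sublist
  · have hkey : ∀ i ∈ R.sel.toList, (fun a : y => (R.phys.col a.1).getD i default) =
        (f i).key y hy := fun i hi => (hf i hi).key_eq y hy
    refine ⟨fun i => if h : d ((f i).key y hy) ≠ 0 then (f i).extend Z ⟨_, h⟩ else default, ?_, ?_⟩
    · intro i hi
      simp only [List.mem_filter] at hi
      obtain ⟨hi, hk⟩ := hi
      obtain ⟨⟨j, w⟩, hk⟩ := Option.isSome_iff_exists.1 hk
      obtain ⟨h1, h2⟩ := hrow i hi j w hk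
      rw [hkey i hi] at hk
      have hin := hD.some _ _ _ hk
      have hden := den_iff.1 (hf i hi)
      dsimp only
      rw [dif_pos hin.ne_zero, den_iff]
      refine ⟨hden.1, fun a => ?_, ?_⟩
      · rw [Tup.val_extend]
        exact hden.2.1 a
      · rintro ⟨W, hW⟩
        rcases Scheme.mem_nested_extend.1 hW with rfl | hW'
        · rw [Tup.rel_extend_self]
          simp only [Function.update_self]
          rw [h1, h2]
          exact hin.congr_store fun U hU => if_neg (hZ hU)
        · rw [Tup.rel_extend_of_ne Z _ _ hW hW' (hne hW')]
          simp only [Function.update_of_ne (hne hW')]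
          exact (hden.2.2 ⟨W, hW'⟩).congr_store fun U hU =>
            if_pos (Scheme.Linear.insert_sub_subset hW' hU)
    · have : ∀ l : List ℕ, (∀ i ∈ l, i ∈ R.sel.toList) →
          (l.map f).filterMap (fun t => if h : d (t.key y hy) ≠ 0 then
            some (t.extend Z ⟨d (t.key y hy), h⟩) else none) =
          (l.filter fun i => (D.map fun a : y => (R.phys.col a.1).getD i default).isSome).map
            fun i => if h : d ((f i).key y hy) ≠ 0 then (f i).extend Z ⟨_, h⟩ else default := by
        intro l hl
        induction l with
        | nil => rfl
        | cons i l ih =>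
          have ih := ih fun j hj => hl j (by simp [hj])
          have hk := hkey i (hl i (by simp))
          rw [List.map_cons, List.filterMap_cons]
          cases hm : D.map ((f i).key y hy) with
          | none =>
            rw [List.filter_cons_of_neg (by rw [hk, hm]; simp)]
            rw [← ih]
            simp [hD.none _ hm]
          | some p =>
            have hin := (hD.some _ p.1 p.2 hm).ne_zero
            rw [List.filter_cons_of_pos (by rw [hk, hm]; rfl), List.map_cons, ← ih]
            simp only [dif_pos hin]
      have := this R.sel.toList fun i hi => hi
      simp only
      rw [← this]
      rfl
  · intro hX
    have : Z ∈ (X.extend Z).nested := Scheme.mem_nested_extend.2 (.inl rfl)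
    rw [show (X.extend Z).nested = ∅ from hX] at this
    exact absurd this (Finset.notMem_empty _)

theorem size_physSemijoin {X : Scheme A} {y : Finset A} {Z : Scheme A}
    (hsub : Disjoint (insert Z Z.sub) X.sub) {R : Shred A V} (D : ShredDict A V y) {r : Rel V X}
    (hR : R.PreRep X r) :
    (physSemijoin X y Z R D).val.size (X.extend Z) = R.size X + D.size Z := by
  obtain ⟨hd, wt, hT, -⟩ := (sat_physSemijoin y Z D hR).1
  have hs : (X.extend Z).sub = X.sub ∪ insert Z Z.sub := by
    ext W
    rw [Scheme.mem_sub_extend, Finset.mem_union]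
  rw [hT, Shred.size, hs, Finset.sum_union hsub.symm, Shred.size, ShredDict.size, add_assoc]
  congr 2
  · exact Finset.sum_congr rfl fun W hW => by simp [hW]
  · exact Finset.sum_congr rfl fun W hW => by simp [Finset.disjoint_left.1 hsub hW]

end

section

open Cost

variable {A V : Type} [Inhabited V]

/-! ### Unnest -/

theorem Den.itr {S : Store A V} {X : Scheme A} {P : Phys A V} {i : ℕ} {t : Tup V X}
    (h : Den S X P i t) (Y : X.nested) :
    (itr P S Y.1 i).time = 2 * (NSA.itr P S Y.1 i).val.length + 2 ∧
      ∃ g : ℕ → Tup V Y.1, (∀ j ∈ (NSA.itr P S Y.1 i).val, Den S Y.1 (S Y.1) j (g j)) ∧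
        (t.rel Y).1 = ((NSA.itr P S Y.1 i).val.map g : List (Tup V Y.1)) := by
  obtain ⟨js, g, h1, h2, h3, -⟩ := (den_iff.1 h).2.2 Y
  obtain ⟨h4, h5⟩ := h1.chase fun j hj => (h2 j hj).lt_len
  have hv : (NSA.itr P S Y.1 i).val = js := h4
  have ht : (NSA.itr P S Y.1 i).time = 1 + (2 * js.length + 1) := congrArg (1 + ·) h5
  rw [hv, ht]
  exact ⟨by omega, g, h2, h3⟩

/-- The pairs of a position in `sel` and a position in its inner relation. -/
def unnestPairs (J : ℕ → List ℕ) (sel : List ℕ) : List (ℕ × ℕ) :=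
  sel.flatMap fun i => (J i).map fun j => (i, j)

theorem mem_unnestPairs {J : ℕ → List ℕ} {sel : List ℕ} {p : ℕ × ℕ} :
    p ∈ unnestPairs J sel ↔ p.1 ∈ sel ∧ p.2 ∈ J p.1 := by
  simp only [unnestPairs, List.mem_flatMap, List.mem_map]
  constructor
  · rintro ⟨i, hi, j, hj, rfl⟩
    exact ⟨hi, hj⟩
  · rintro ⟨h1, h2⟩
    exact ⟨p.1, h1, p.2, h2, rfl⟩

theorem length_unnestPairs (J : ℕ → List ℕ) (sel : List ℕ) :
    (unnestPairs J sel).length = (sel.map fun i => (J i).length).sum := by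
  simp [unnestPairs, List.length_flatMap]

/-- The result of unnesting, with the vectors `p` and `q` of positions in the outer and inner
relations. -/
def unnested (X Y : Scheme A) (R : Shred A V) (p q : Array ℕ) : Shred A V :=
  ⟨(((Phys.new A V p.size).takeInto R.phys X.flat (X.nested.erase Y) p).val.takeInto (R.store Y)
      Y.flat Y.nested q).val,
    Function.update R.store Y (Phys.new A V 0), Array.range p.size⟩

theorem sat_physUnnest {X Y : Scheme A} (hY : Y ∈ X.nested) {R : Shred A V} {r : Rel V X}
    (h : R.PreRep X r) (l : List (ℕ × ℕ))
    (hl : l = unnestPairs (fun i => (itr R.phys R.store Y i).val) R.sel.toList) :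
    Sat (physUnnest X Y R) (fun T =>
        T = unnested X Y R (l.map Prod.fst).toArray (l.map Prod.snd).toArray)
      ((6 * (X.flat.card + X.nested.card + Y.flat.card + Y.nested.card) + 20) *
        (R.phys.len + l.length + 1)) := by
  obtain ⟨f, hf, -⟩ := h.rows
  unfold physUnnest
  refine Sat.mono (n := ((R.sel.toList.map fun i =>
      (2 * (itr R.phys R.store Y i).val.length + 2 +
        ((2 + 1) * (itr R.phys R.store Y i).val.length + 1)) + 1).sum + 1) +
      ((6 * (X.flat.card + (X.nested.erase Y).card) + 2) * (l.length + 1) +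
      ((6 * (Y.flat.card + Y.nested.card) + 2) * (l.length + 1) +
      (1 + (2 * l.length + 1 + 0)))))
    (Sat.bind (Sat.loop (fun k s =>
        s.1 = ((unnestPairs (fun i => (itr R.phys R.store Y i).val) k).map Prod.fst).toArray ∧
        s.2 = ((unnestPairs (fun i => (itr R.phys R.store Y i).val) k).map Prod.snd).toArray)
      (fun i => 2 * (itr R.phys R.store Y i).val.length + 2 +
        ((2 + 1) * (itr R.phys R.store Y i).val.length + 1)) ?_ ?_) ?_) (fun _ h => h) ?_
  · exact ⟨rfl, rfl⟩
  · rintro pre i post ⟨p, q⟩ hs ⟨h1, h2⟩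
    dsimp only at h1 h2
    refine Sat.bind (Sat.self (((hf i (by rw [hs]; simp)).itr ⟨Y, hY⟩).1.le)) ?_
    rintro js rfl
    refine Sat.mono (Sat.loop_const (fun k s => s.1 = p ++ (k.map fun _ => i).toArray ∧
      s.2 = q ++ k.toArray) 2 (by simp) ?_) ?_ le_rfl
    · rintro pre' j post' ⟨p', q'⟩ - ⟨h3, h4⟩
      dsimp only at h3 h4
      subst h3 h4
      refine ⟨⟨?_, by simp⟩, by simp⟩
      change (p ++ (pre'.map fun _ => i).toArray).push i = _
      exact Array.toList_inj.1 (by simp)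
    · rintro ⟨p', q'⟩ ⟨h3, h4⟩
      dsimp only at h3 h4
      subst h1 h2 h3 h4
      simp [unnestPairs, Function.comp_def]
  · rintro ⟨p, q⟩ ⟨h1, h2⟩
    dsimp only at h1 h2
    rw [← hl] at h1 h2
    have hp : p.size = l.length := by rw [h1]; simp
    have hq : q.size = l.length := by rw [h2]; simp
    refine Sat.bind (Sat.self (hp ▸ Phys.time_takeInto _ _ _ _ _)) ?_
    rintro O rfl
    refine Sat.bind (Sat.self (hq ▸ Phys.time_takeInto _ _ _ _ _)) ?_
    rintro O rfl
    refine Sat.bind (Sat.self (time_steps _ _).le) ?_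
    rintro S rfl
    refine Sat.bind (Sat.self (hp ▸ time_allSel _)) ?_
    rintro s rfl
    refine Sat.pure ?_
    rw [← h1, ← h2, val_allSel]
    rfl
  · have h1 : (R.sel.toList.map fun i =>
      (2 * (itr R.phys R.store Y i).val.length + 2 +
        ((2 + 1) * (itr R.phys R.store Y i).val.length + 1)) + 1).sum =
        5 * l.length + 4 * R.sel.toList.length := by
      rw [hl, length_unnestPairs, ← sum_map_const_add]
      refine congrArg _ (List.map_congr_left fun i _ => ?_)
      ring
    have h2 : R.sel.toList.length ≤ R.phys.len := by simpa using h.size_sel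
    have h3 : (X.nested.erase Y).card ≤ X.nested.card := Finset.card_le_card (Finset.erase_subset _ _)
    rw [h1]
    have h4 : 6 * (X.flat.card + (X.nested.erase Y).card) + 2 ≤
      6 * (X.flat.card + X.nested.card) + 2 := by omega
    have h5 := Nat.mul_le_mul_right (l.length + 1) h4
    have h6 := Nat.zero_le ((6 * (X.flat.card + X.nested.card + Y.flat.card + Y.nested.card)) *
      R.phys.len)
    nlinarith

theorem rep_unnested {X Y : Scheme A} (hX : X.Linear) (hY : Y ∈ X.nested) {R : Shred A V}
    {f : ℕ → Tup V X} {g : ℕ → ℕ → Tup V Y} {l : List (ℕ × ℕ)}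
    (hS : R.store.HasColumns X.sub) (hf : ∀ p ∈ l, Den R.store X R.phys p.1 (f p.1))
    (hg : ∀ p ∈ l, Den R.store Y (R.store Y) p.2 (g p.1 p.2)) :
    (unnested X Y R (l.map Prod.fst).toArray (l.map Prod.snd).toArray).Rep (X.unnest Y)
      (l.map fun p => Tup.concat Y (f p.1) (g p.1 p.2) : List (Tup V (X.unnest Y))) := by
  have hstore : ∀ Z ∈ (X.unnest Y).sub,
      Function.update R.store Y (Phys.new A V 0) Z = R.store Z := by
    intro Z hZ
    rw [Function.update_of_ne]
    rintro rfl
    exact hX.notMem_sub_unnest hY hZ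
  have hflat : ∀ {a}, a ∈ X.flat → a ∉ Y.flat := fun ha ha' =>
    Finset.disjoint_left.1 (hX.disjoint_flat hY) ha (Y.flat_subset_flatsub ha')
  have hnested : ∀ {W}, W ∈ X.nested.erase Y → W ∉ Y.nested := fun {W} hW hW' =>
    Finset.disjoint_left.1 (hX.disjoint_sub (Finset.mem_of_mem_erase hW) hY
      (Finset.ne_of_mem_erase hW)) (Finset.mem_insert_self _ _)
      (Finset.mem_insert_of_mem (Y.nested_subset_sub hW'))
  have hlen : (unnested X Y R (l.map Prod.fst).toArray (l.map Prod.snd).toArray).phys.len =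
      l.length := by
    simp [unnested, Phys.val_takeInto, Phys.new]
  have hsel : (unnested X Y R (l.map Prod.fst).toArray (l.map Prod.snd).toArray).sel =
      Array.range l.length := by
    simp [unnested]
  have hcol : ∀ a, (unnested X Y R (l.map Prod.fst).toArray (l.map Prod.snd).toArray).phys.col a =
      if a ∈ Y.flat then gather ((R.store Y).col a) (l.map Prod.snd).toArray
      else if a ∈ X.flat then gather (R.phys.col a) (l.map Prod.fst).toArray else #[] := by
    intro a
    simp only [unnested, Phys.val_takeInto, Phys.new]
  have hhd : ∀ a, (unnested X Y R (l.map Prod.fst).toArray (l.map Prod.snd).toArray).phys.hd a =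
      if a ∈ Y.nested then gather ((R.store Y).hd a) (l.map Prod.snd).toArray
      else if a ∈ X.nested.erase Y then gather (R.phys.hd a) (l.map Prod.fst).toArray
      else #[] := by
    intro a
    simp only [unnested, Phys.val_takeInto, Phys.new]
  have hwt : ∀ a, (unnested X Y R (l.map Prod.fst).toArray (l.map Prod.snd).toArray).phys.wt a =
      if a ∈ Y.nested then gather ((R.store Y).wt a) (l.map Prod.snd).toArray
      else if a ∈ X.nested.erase Y then gather (R.phys.wt a) (l.map Prod.fst).toArray
      else #[] := by
    intro a
    simp only [unnested, Phys.val_takeInto, Phys.new]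
  refine ⟨⟨⟨fun a ha => ?_, fun W hW => ?_, fun W hW => ?_⟩,
    hS.congr (Scheme.sub_unnest_subset hY) hstore, ?_, ?_⟩, fun _ => by rw [hsel, hlen]⟩
  · rw [hcol, hlen]
    rcases Finset.mem_union.1 ha with ha | ha <;> by_cases ha' : a ∈ Y.flat <;> simp [ha, ha']
  · rw [hhd, hlen]
    rcases Scheme.mem_nested_unnest.1 hW with hW | hW
    · rw [if_neg (hnested hW), if_pos hW]
      simp
    · rw [if_pos hW]
      simp
  · rw [hwt, hlen]
    rcases Scheme.mem_nested_unnest.1 hW with hW | hW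
    · rw [if_neg (hnested hW), if_pos hW]
      simp
    · rw [if_pos hW]
      simp
  · rw [hsel]
    simpa using List.pairwise_lt_range
  · have hget : ∀ m < l.length, l.toArray.getD m default ∈ l := by
      intro m hm
      simp [Array.getD_eq_getD_getElem?, hm]
    have hfst : ∀ m < l.length, (l.map Prod.fst).toArray.getD m default =
        (l.toArray.getD m default).1 := by
      intro m hm
      simp [Array.getD_eq_getD_getElem?, hm]
    have hsnd : ∀ m < l.length, (l.map Prod.snd).toArray.getD m default =
        (l.toArray.getD m default).2 := by
      intro m hm
      simp [Array.getD_eq_getD_getElem?, hm]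
    refine ⟨fun m => (fun p : ℕ × ℕ => Tup.concat Y (f p.1) (g p.1 p.2))
      (l.toArray.getD m default), ?_, ?_⟩
    · intro m hm
      rw [hsel] at hm
      simp only [Array.toList_range, List.mem_range] at hm
      have h1 := den_iff.1 (hf _ (hget m hm))
      have h2 := den_iff.1 (hg _ (hget m hm))
      refine den_iff.2 ⟨hlen ▸ hm, ?_, ?_⟩
      · rintro ⟨a, ha⟩
        rw [hcol]
        rcases Finset.mem_union.1 ha with ha' | ha'
        · rw [Tup.val_concat_left Y _ _ ha ha', if_neg (hflat ha'), if_pos ha',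
            getD_gather _ _ _ (by simpa using hm), hfst m hm]
          exact h1.2.1 ⟨a, ha'⟩
        · rw [Tup.val_concat_right Y _ _ ha (fun h => hflat h ha') ha', if_pos ha',
            getD_gather _ _ _ (by simpa using hm), hsnd m hm]
          exact h2.2.1 ⟨a, ha'⟩
      · rintro ⟨W, hW⟩
        rw [hhd, hwt]
        have hsubW : insert W W.sub ⊆ (X.unnest Y).sub := Scheme.Linear.insert_sub_subset hW
        rcases Scheme.mem_nested_unnest.1 hW with hW' | hW'
        · rw [Tup.rel_concat_left Y _ _ hW hW', if_neg (hnested hW'), if_pos hW',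
            if_neg (hnested hW'), if_pos hW']
          have h3 := h1.2.2 ⟨W, Finset.mem_of_mem_erase hW'⟩
          have e1 := getD_gather (R.phys.hd W) (l.map Prod.fst).toArray m (by simpa using hm)
          have e2 := getD_gather (R.phys.wt W) (l.map Prod.fst).toArray m (by simpa using hm)
          rw [hfst m hm] at e1 e2
          erw [e1, e2]
          exact h3.congr_store fun Z hZ => hstore Z (hsubW hZ)
        · rw [Tup.rel_concat_right Y _ _ hW (fun h => hnested h hW') hW', if_pos hW', if_pos hW']
          have h3 := h2.2.2 ⟨W, hW'⟩
          have e1 := getD_gather ((R.store Y).hd W) (l.map Prod.snd).toArray m (by simpa using hm)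
          have e2 := getD_gather ((R.store Y).wt W) (l.map Prod.snd).toArray m (by simpa using hm)
          rw [hsnd m hm] at e1 e2
          erw [e1, e2]
          exact h3.congr_store fun Z hZ => hstore Z (hsubW hZ)
    · rw [hsel, Array.toList_range]
      have := map_range_getD l.toArray fun p : ℕ × ℕ => Tup.concat Y (f p.1) (g p.1 p.2)
      rw [List.size_toArray] at this
      rw [this]

/-- Correctness and running time of unnest. -/
theorem physUnnest_spec {X Y : Scheme A} (hX : X.Linear) (hY : Y ∈ X.nested) {R : Shred A V}
    {r : Rel V X} (h : R.Rep X r) :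
    (physUnnest X Y R).val.Rep (X.unnest Y)
        (r.bind fun s => (s.rel ⟨Y, hY⟩).1.map (Tup.concat Y s)) ∧
      (physUnnest X Y R).val.size (X.unnest Y) ≤ R.size X +
        Multiset.card (r.bind fun s => (s.rel ⟨Y, hY⟩).1.map (Tup.concat Y s)) ∧
      (physUnnest X Y R).time ≤
        (6 * (X.flat.card + X.nested.card + Y.flat.card + Y.nested.card) + 20) *
        (R.phys.len +
          Multiset.card (r.bind fun s => (s.rel ⟨Y, hY⟩).1.map (Tup.concat Y s)) + 1) := by
  obtain ⟨hval, htime⟩ := sat_physUnnest hY h.toPreRep _ rfl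
  obtain ⟨f, hf, rfl⟩ := h.rows
  have hex : ∀ i ∈ R.sel.toList, ∃ g : ℕ → Tup V Y,
      (∀ j ∈ (itr R.phys R.store Y i).val, Den R.store Y (R.store Y) j (g j)) ∧
        ((f i).rel ⟨Y, hY⟩).1 = ((itr R.phys R.store Y i).val.map g : List (Tup V Y)) :=
    fun i hi => ((hf i hi).itr ⟨Y, hY⟩).2
  choose! g hg hrel using hex
  have hbind : ((R.sel.toList.map f : List (Tup V X)) : Multiset (Tup V X)).bind
      (fun s => (s.rel ⟨Y, hY⟩).1.map (Tup.concat Y s)) =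
      ((unnestPairs (fun i => (itr R.phys R.store Y i).val) R.sel.toList).map fun p =>
        Tup.concat Y (f p.1) (g p.1 p.2) : List (Tup V (X.unnest Y))) := by
    rw [unnestPairs, List.map_flatMap, ← Multiset.map_coe, Multiset.bind_map,
      ← Multiset.coe_bind]
    refine Multiset.bind_congr fun i hi => ?_
    rw [hrel i hi, Multiset.map_coe, List.map_map, List.map_map]
    rfl
  have hrep := rep_unnested hX hY (R := R) (f := f) (g := g)
    (l := unnestPairs (fun i => (itr R.phys R.store Y i).val) R.sel.toList) h.store
    (fun p hp => hf p.1 (mem_unnestPairs.1 hp).1)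
    (fun p hp => hg p.1 (mem_unnestPairs.1 hp).1 p.2 (mem_unnestPairs.1 hp).2)
  rw [← hval, ← hbind] at hrep
  have hcard := congrArg Multiset.card hbind
  rw [Multiset.coe_card, List.length_map] at hcard
  refine ⟨hrep, ?_, ?_⟩
  · have hlen : (physUnnest X Y R).val.phys.len = (unnestPairs
        (fun i => (itr R.phys R.store Y i).val) R.sel.toList).length := by
      rw [hval]
      simp [unnested, Phys.val_takeInto, Phys.new]
    have hsum : ∑ Z ∈ (X.unnest Y).sub, ((physUnnest X Y R).val.store Z).len ≤
        ∑ Z ∈ X.sub, (R.store Z).len := by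
      refine (Finset.sum_congr rfl fun Z hZ => ?_).trans_le
        (Finset.sum_le_sum_of_subset (Scheme.sub_unnest_subset hY))
      rw [hval]
      simp only [unnested]
      rw [Function.update_of_ne]
      rintro rfl
      exact hX.notMem_sub_unnest hY hZ
    rw [Shred.size, Shred.size, hlen, hcard]
    omega
  · rw [hcard]
    exact htime

end

section

open Cost

variable {A V : Type}

/-! ### Union -/

/-- The rows of `P` followed by those of `Q`, with the list heads of `Q` shifted. -/
def Phys.union (S : Store A V) (X : Scheme A) (P Q : Phys A V) : Phys A V :=
  (Phys.concat X P (fixHeads S X Q).val).val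

/-- The union of two stores. -/
def Store.union (N : Finset (Scheme A)) (S S' : Store A V) : Store A V := fun Y =>
  if Y ∈ N then { (S Y).union S Y (S' Y) with nxt := (S Y).nxt ++ shift (S Y).len (S' Y).nxt }
  else Phys.new A V 0

section Union

variable {S S' : Store A V} {X : Scheme A} {P Q : Phys A V}

theorem Phys.len_union : (P.union S X Q).len = P.len + Q.len := by
  rw [union, val_concat, val_fixHeads]

theorem Phys.HasColumns.union (hP : P.HasColumns X) (hQ : Q.HasColumns X) :
    (P.union S X Q).HasColumns X := by
  rw [Phys.union, val_concat, val_fixHeads]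
  exact ⟨fun a ha => by simp [ha, hP.col a ha, hQ.col a ha],
    fun a ha => by simp [ha, hP.hd a ha, hQ.hd a ha],
    fun a ha => by simp [ha, hP.wt a ha, hQ.wt a ha]⟩

theorem Store.HasColumns.union {N : Finset (Scheme A)} (hS : S.HasColumns N)
    (hS' : S'.HasColumns N) : (S.union N S').HasColumns N := by
  refine ⟨fun Z hZ => ?_, fun Z hZ => ?_⟩
  · rw [Store.union, if_pos hZ]
    have := (hS.cols Z hZ).union (S := S) (hS'.cols Z hZ)
    exact ⟨this.col, this.hd, this.wt⟩
  · rw [Store.union, if_pos hZ]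
    simp [hS.nxt Z hZ, hS'.nxt Z hZ, Phys.len_union]

theorem time_union (hP : P.HasColumns X) (hQ : Q.HasColumns X) :
    (fixHeads S X Q).time + (Phys.concat X P (fixHeads S X Q).val).time ≤
      (3 * X.flat.card + 6 * X.nested.card + 4) * (P.len + Q.len + 1) := by
  have h1 := time_fixHeads S X Q Q.len hQ.hd
  have h2 := Phys.time_concat X P (fixHeads S X Q).val (P.len + Q.len)
    (fun a ha => by rw [val_fixHeads]; simp [hP.col a ha, hQ.col a ha])
    (fun a ha => by rw [val_fixHeads]; simp [ha, hP.hd a ha, hQ.hd a ha])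
    (fun a ha => by rw [val_fixHeads]; simp [hP.wt a ha, hQ.wt a ha])
  have h3 : (3 * X.nested.card + 1) * (Q.len + 1) ≤ (3 * X.nested.card + 1) * (P.len + Q.len + 1) :=
    Nat.mul_le_mul_left _ (by omega)
  nlinarith

end Union

variable [Inhabited V]

/-! ### Difference -/

theorem map_sub_of_injective {K L : Type} {φ : K → L}
    (hφ : Function.Injective φ) (s t : Multiset K) : (s - t).map φ = s.map φ - t.map φ := by
  induction t using Multiset.induction generalizing s with
  | empty => simp
  | cons a t ih => rw [Multiset.sub_cons, ih, Multiset.map_cons, Multiset.sub_cons,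
      Multiset.map_erase φ hφ]

/-- `h` stores the multiplicities of `C`. -/
def Counts {K : Type} (h : K → Option ℕ) (C : Multiset K) : Prop :=
  ∀ k, (h k).getD 0 = C.count k

theorem Counts.insert {K : Type} {h : K → Option ℕ} {κ : ℕ → K} {l : List ℕ} {i : ℕ}
    (hh : Counts h (l.map κ : List K)) :
    Counts (Function.update h (κ i) (some ((h (κ i)).getD 0 + 1))) ((l ++ [i]).map κ : List K) := by
  intro k
  rw [List.map_append, ← Multiset.coe_add, Multiset.count_add, ← hh k]
  by_cases hk : k = κ i
  · subst hk
    simp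
  · rw [Function.update_of_ne hk]
    simp [hk]

/-- The vector of positions computed by the difference. -/
structure DiffPos {K : Type} (κ : ℕ → K) (C : Multiset K) (l : List ℕ) (p : Array ℕ)
    (h : K → Option ℕ) : Prop where
  mem : ∀ i ∈ p.toList, i ∈ l
  size : p.size ≤ l.length
  keys : (p.toList.map κ : Multiset K) = (l.map κ : List K) - C
  count : ∀ k, (h k).getD 0 = (C - (l.map κ : List K)).count k

theorem DiffPos.nil {K : Type} {κ : ℕ → K} {C : Multiset K} {h : K → Option ℕ}
    (hh : Counts h C) : DiffPos κ C [] #[] h :=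
  ⟨by simp, by simp, by simp, fun k => by simpa using hh k⟩

theorem DiffPos.skip {K : Type} {κ : ℕ → K} {C : Multiset K} {l : List ℕ} {p : Array ℕ}
    {h : K → Option ℕ} {i n : ℕ} (hp : DiffPos κ C l p h) (hn : h (κ i) = some (n + 1)) :
    DiffPos κ C (l ++ [i]) p (Function.update h (κ i) (some n)) := by
  have hc := hp.count (κ i)
  rw [hn, Multiset.count_sub] at hc
  simp only [Option.getD_some] at hc
  refine ⟨fun j hj => by simp [hp.mem j hj], by have := hp.size; simp; omega, ?_, fun k => ?_⟩
  · rw [hp.keys]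
    ext k
    rw [List.map_append, ← Multiset.coe_add, Multiset.count_sub, Multiset.count_sub,
      Multiset.count_add]
    by_cases hk : k = κ i
    · subst hk
      simp only [List.map_cons, List.map_nil, Multiset.coe_singleton, Multiset.count_singleton_self]
      omega
    · simp [hk]
  · have := hp.count k
    rw [Multiset.count_sub] at this
    rw [List.map_append, ← Multiset.coe_add, Multiset.count_sub, Multiset.count_add]
    by_cases hk : k = κ i
    · subst hk
      rw [Function.update_self, Option.getD_some]
      simp only [List.map_cons, List.map_nil, Multiset.coe_singleton, Multiset.count_singleton_self]
      omega
    · rw [Function.update_of_ne hk, this]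
      simp [hk]

theorem DiffPos.push {K : Type} {κ : ℕ → K} {C : Multiset K} {l : List ℕ} {p : Array ℕ}
    {h : K → Option ℕ} {i : ℕ} (hp : DiffPos κ C l p h) (hn : (h (κ i)).getD 0 = 0) :
    DiffPos κ C (l ++ [i]) (p.push i) h := by
  have hc := hp.count (κ i)
  rw [hn, Multiset.count_sub] at hc
  refine ⟨fun j hj => ?_, by have := hp.size; simp; omega, ?_, fun k => ?_⟩
  · simp only [Array.toList_push, List.mem_append, List.mem_singleton] at hj ⊢
    exact hj.imp_left (hp.mem j)
  · rw [Array.toList_push, List.map_append, ← Multiset.coe_add, hp.keys]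
    ext k
    rw [List.map_append, ← Multiset.coe_add, Multiset.count_sub, Multiset.count_add,
      Multiset.count_sub, Multiset.count_add]
    by_cases hk : k = κ i
    · subst hk
      simp only [List.map_cons, List.map_nil, Multiset.coe_singleton, Multiset.count_singleton_self]
      omega
    · simp [hk]
  · have := hp.count k
    rw [Multiset.count_sub] at this
    rw [List.map_append, ← Multiset.coe_add, Multiset.count_sub, Multiset.count_add, this]
    by_cases hk : k = κ i
    · subst hk
      simp only [List.map_cons, List.map_nil, Multiset.coe_singleton, Multiset.count_singleton_self]
      omega
    · simp [hk]

theorem sat_physDiff {X : Scheme A} {R T : Shred A V} {r t : Rel V X} (hR : R.PreRep X r)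
    (hT : T.PreRep X t) :
    Sat (physDiff X R T) (fun U => ∃ p h,
        DiffPos (fun i (a : X.flat) => (R.phys.col a.1).getD i default)
          ((T.sel.toList.map fun i (a : X.flat) => (T.phys.col a.1).getD i default :
            List (X.flat → V)) : Multiset (X.flat → V)) R.sel.toList p h ∧
        U = ⟨((Phys.new A V p.size).takeInto R.phys X.flat ∅ p).val, R.store, Array.range p.size⟩)
      ((8 * X.flat.card + 20) * (R.phys.len + T.phys.len + 1)) := by
  unfold physDiff
  refine Sat.mono (n := 1 + ((X.flat.card + 4 + 1) * T.sel.toList.length + 1 +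
      ((X.flat.card + 3 + 1) * R.sel.toList.length + 1 +
        ((6 * (X.flat.card + (∅ : Finset (Scheme A)).card) + 2) * (R.phys.len + 1) +
          (2 * R.phys.len + 1 + 0)))))
    (Sat.bind (Sat.self (HashMap.time_new _ _).le) ?_) (fun _ h => h) ?_
  · rintro h rfl
    refine Sat.bind (Sat.loop_const (fun l (s : (X.flat → V) → Option ℕ) => Counts s
      (l.map fun i (a : X.flat) => (T.phys.col a.1).getD i default : List (X.flat → V)))
      (X.flat.card + 4) ?_ ?_) ?_
    · intro k
      rfl
    · intro pre i post h hl hh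
      refine Sat.mono (n := X.flat.card + 1 + 3)
        (Sat.bind (Sat.self (Phys.time_readKey _ _ _).le) ?_) (fun _ h => h) (by omega)
      rintro k rfl
      exact ⟨hh.insert, le_of_eq rfl⟩
    · intro h hh
      refine Sat.bind (Sat.loop_const (fun l s => DiffPos
        (fun i (a : X.flat) => (R.phys.col a.1).getD i default)
        ((T.sel.toList.map fun i (a : X.flat) => (T.phys.col a.1).getD i default :
            List (X.flat → V)) : Multiset (X.flat → V)) l s.1 s.2) (X.flat.card + 3) ?_ ?_) ?_
      · exact .nil hh
      · rintro pre i post ⟨p, h⟩ hl hp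
        replace hp : DiffPos _ _ _ p h := hp
        refine Sat.mono (n := X.flat.card + 1 + (1 + 1))
          (Sat.bind (Sat.self (Phys.time_readKey _ _ _).le) ?_) (fun _ h => h) (by omega)
        rintro k rfl
        refine Sat.bind (Sat.self (HashMap.time_lookup _ _).le) ?_
        rintro e rfl
        simp only [Phys.val_readKey, HashMap.val_lookup]
        split
        · rename_i n hk
          exact ⟨hp.skip hk, le_of_eq rfl⟩
        · rename_i hk
          refine ⟨hp.push ?_, le_of_eq rfl⟩
          generalize (h fun a => (R.phys.col a.1).getD i default) = e at hk
          rcases e with _ | _ | n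
          · rfl
          · rfl
          · exact absurd rfl (hk n)
      · rintro ⟨p, h⟩ hp
        replace hp : DiffPos _ _ _ p h := hp
        have hsize : p.size ≤ R.phys.len := hp.size.trans (by simpa using hR.size_sel)
        refine Sat.bind (Sat.self ((Phys.time_takeInto _ _ _ _ _).trans
          (Nat.mul_le_mul_left _ (Nat.add_le_add_right hsize 1)))) ?_
        rintro O rfl
        refine Sat.bind (Sat.self ((time_allSel _).trans
          (Nat.add_le_add_right (Nat.mul_le_mul_left 2 hsize) 1))) ?_
        rintro s rfl
        exact Sat.pure ⟨p, h, hp, by rw [val_allSel]⟩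
  · have h1 : R.sel.toList.length ≤ R.phys.len := by simpa using hR.size_sel
    have h2 : T.sel.toList.length ≤ T.phys.len := by simpa using hT.size_sel
    rw [Finset.card_empty]
    nlinarith [Nat.mul_le_mul_left (X.flat.card + 3 + 1) h1,
      Nat.mul_le_mul_left (X.flat.card + 4 + 1) h2, Nat.zero_le (X.flat.card * R.phys.len),
      Nat.zero_le (X.flat.card * T.phys.len)]

/-- Correctness and running time of the difference. -/
theorem physDiff_spec {X : Scheme A} (hX : X.IsFlat) {R T : Shred A V} {r t : Rel V X}
    (hR : R.Rep X r) (hT : T.Rep X t) :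
    (physDiff X R T).val.Rep X (r - t) ∧
      (physDiff X R T).val.size X ≤ R.size X ∧
      (physDiff X R T).time ≤ (8 * X.flat.card + 20) * (R.phys.len + T.phys.len + 1) := by
  obtain ⟨⟨p, h, hp, hU⟩, htime⟩ := sat_physDiff hR.toPreRep hT.toPreRep
  obtain ⟨f, hf, rfl⟩ := hR.rows
  obtain ⟨g, hg, rfl⟩ := hT.rows
  have hflat : ∀ (P : Phys A V) (S : Store A V) (i : ℕ) (s : Tup V X), Den S X P i s →
      s = Tup.mkFlat hX fun a => (P.col a.1).getD i default := by
    intro P S i s hs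
    rw [Tup.eq_mkFlat hX s]
    congr 1
    funext a
    exact ((den_iff.1 hs).2.1 a).symm
  have hinj : Function.Injective (Tup.mkFlat (V := V) hX) := fun a b hab => by
    rw [← Tup.val_mkFlat hX a, hab, Tup.val_mkFlat]
  have hmap : ∀ (P : Phys A V) (S : Store A V) (l : List ℕ) (f : ℕ → Tup V X),
      (∀ i ∈ l, Den S X P i (f i)) → l.map f =
        (l.map fun i (a : X.flat) => (P.col a.1).getD i default).map (Tup.mkFlat hX) := by
    intro P S l f hf
    rw [List.map_map]
    exact List.map_congr_left fun i hi => hflat P S i _ (hf i hi)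
  have heq : (R.sel.toList.map f : Multiset (Tup V X)) - (T.sel.toList.map g : List (Tup V X)) =
      (p.toList.map f : List (Tup V X)) := by
    rw [hmap _ _ _ f hf, hmap _ _ _ g hg, hmap _ _ _ f fun i hi => hf i (hp.mem i hi),
      ← Multiset.map_coe (Tup.mkFlat hX), ← Multiset.map_coe (Tup.mkFlat hX),
      ← Multiset.map_coe (Tup.mkFlat hX), hp.keys]
    exact (map_sub_of_injective hinj _ _).symm
  have hlen : (physDiff X R T).val.phys.len = p.size := by
    rw [hU]
    simp [Phys.val_takeInto, Phys.new]
  refine ⟨?_, ?_, htime⟩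
  · have := preRep_takeInto (Phys.new A V p.size) hR.store
      (fun i hi => hf i (hp.mem i hi)) (p := p) rfl
    rw [show X.nested = ∅ from hX] at this
    rw [heq]
    refine ⟨?_, fun _ => ?_⟩
    · rw [hU]
      exact this
    · rw [hlen, hU]
  · rw [Shred.size, Shred.size, hX.sub_eq, hlen]
    simpa using hp.size.trans (by simpa using hR.size_sel)

section Union

variable {S S' : Store A V} {X : Scheme A} {P Q : Phys A V}

theorem rowSim_union_left (hP : P.HasColumns X) {i : ℕ} (hi : i < P.len) :
    RowSim (fun _ => id) X P i (P.union S X Q) i := by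
  refine .of_id (by rw [Phys.len_union]; omega) ?_ ?_ ?_
  all_goals
    intro a ha
    rw [Phys.union, Phys.val_concat, val_fixHeads]
    simp only [ha, if_true]
    rw [getD_append_left]
  · rwa [hP.col a ha]
  · rwa [hP.hd a ha]
  · rwa [hP.wt a ha]

theorem rowSim_union_right (hP : P.HasColumns X) {j : ℕ} (hj : j < Q.len) :
    RowSim (fun Y j => j + (S Y).len) X Q j (P.union S X Q) (j + P.len) := by
  refine ⟨by rw [Phys.len_union]; omega, ?_, ?_, ?_⟩
  all_goals
    intro a ha
    rw [Phys.union, Phys.val_concat, val_fixHeads]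
    simp only [ha, if_true]
  · rw [← hP.col a ha, getD_append_right]
  · rw [← hP.hd a ha, getD_append_right, getD_shift]
  · rw [← hP.wt a ha, getD_append_right]

theorem storeSim_union_left {N : Finset (Scheme A)} (hS : S.HasColumns N) :
    StoreSim (fun _ => id) N S (S.union N S') := by
  refine ⟨fun _ _ => strictMono_id, fun Z hZ j hj => ?_, fun Z hZ j hj => ?_⟩
  · rw [Store.union, if_pos hZ]
    have := rowSim_union_left (S := S) (Q := S' Z) (hS.cols Z hZ) hj
    exact ⟨this.len, this.col, this.hd, this.wt⟩
  · rw [Store.union, if_pos hZ]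
    simp only [id]
    rw [getD_append_left _ _ _ _ (by rwa [hS.nxt Z hZ])]
    exact Option.map_id'.symm

theorem storeSim_union_right {N : Finset (Scheme A)} (hS : S.HasColumns N) :
    StoreSim (fun Y j => j + (S Y).len) N S' (S.union N S') := by
  refine ⟨fun _ _ _ _ h => Nat.add_lt_add_right h _, fun Z hZ j hj => ?_, fun Z hZ j hj => ?_⟩
  · rw [Store.union, if_pos hZ]
    have := rowSim_union_right (S := S) (Q := S' Z) (hS.cols Z hZ) hj
    exact ⟨this.len, this.col, this.hd, this.wt⟩
  · rw [Store.union, if_pos hZ]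
    simp only
    rw [← hS.nxt Z hZ, getD_append_right, getD_shift]

end Union

theorem val_physUnion (X : Scheme A) (R T : Shred A V) :
    (physUnion X R T).val =
      ⟨(R.compacted X).phys.union R.store X (T.compacted X).phys, R.store.union X.sub T.store,
        Array.range ((R.compacted X).phys.union R.store X (T.compacted X).phys).len⟩ := by
  simp only [physUnion, val_bind, val_pure, val_loop, val_offset, val_append, val_allSel]
  rw [foldl_update]
  simp only [Finset.mem_toList]
  rw [Shred.mk.injEq]
  refine ⟨rfl, ?_, rfl⟩
  funext Y
  rw [Store.union]
  split_ifs
  · simp only [Phys.union, Phys.mk.injEq, true_and]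
    rw [val_fixHeads]
  · rfl

theorem rep_physUnion {X : Scheme A} {R T : Shred A V} {r t : Rel V X} (hR : R.Rep X r)
    (hT : T.Rep X t) : (physUnion X R T).val.Rep X (r + t) := by
  have hR' := hR.toPreRep.compacted
  have hT' := hT.toPreRep.compacted
  obtain ⟨f, hf, rfl⟩ := hR'.rows
  obtain ⟨g, hg, rfl⟩ := hT'.rows
  rw [hR.toPreRep.sel_compacted, Array.toList_range] at hf ⊢
  rw [hT.toPreRep.sel_compacted, Array.toList_range] at hg ⊢
  rw [val_physUnion]
  refine ⟨⟨hR'.cols.union hT'.cols, hR.store.union hT.store, ?_, ?_⟩, fun _ => rfl⟩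
  · simpa using List.pairwise_lt_range
  · refine ⟨fun i => if i < (R.compacted X).phys.len then f i
      else g (i - (R.compacted X).phys.len), ?_, ?_⟩
    · intro i hi
      simp only [Array.toList_range, List.mem_range, Phys.len_union] at hi
      dsimp only
      split_ifs with hlt
      · exact (hf i (List.mem_range.2 hlt)).sim (storeSim_union_left hR.store)
          (rowSim_union_left hR'.cols hlt)
      · obtain ⟨j, rfl⟩ : ∃ j, i = j + (R.compacted X).phys.len :=
          ⟨i - (R.compacted X).phys.len, by omega⟩
        rw [Nat.add_sub_cancel]
        exact (hg j (List.mem_range.2 (by omega))).sim (storeSim_union_right hR.store)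
          (rowSim_union_right hR'.cols (by omega))
    · rw [Array.toList_range, Phys.len_union, List.range_add, List.map_append, List.map_map,
        ← Multiset.coe_add]
      congr 2
      · refine List.map_congr_left fun i hi => ?_
        rw [if_pos (List.mem_range.1 hi)]
      · refine List.map_congr_left fun i hi => ?_
        simp

theorem size_physUnion (X : Scheme A) (R T : Shred A V) :
    (physUnion X R T).val.size X ≤ R.size X + T.size X := by
  have h1 := len_compacted_le X R
  have h2 := len_compacted_le X T
  have h3 : ∑ Z ∈ X.sub, (R.store.union X.sub T.store Z).len =
      ∑ Z ∈ X.sub, ((R.store Z).len + (T.store Z).len) := by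
    refine Finset.sum_congr rfl fun Z hZ => ?_
    rw [Store.union, if_pos hZ]
    exact Phys.len_union
  rw [Finset.sum_add_distrib] at h3
  rw [val_physUnion, Shred.size, Shred.size, Shred.size, Phys.len_union, h3]
  omega

theorem time_physUnion (X : Scheme A) :
    ∃ c, ∀ (R T : Shred A V) (r t : Rel V X), R.Rep X r → T.Rep X t →
      (physUnion X R T).time ≤ c * (R.size X + T.size X + 1) := by
  let M := ∑ Y ∈ insert X X.sub, (Y.flat.card + Y.nested.card)
  have hM : ∀ Y ∈ insert X X.sub, Y.flat.card + Y.nested.card ≤ M := fun Y hY =>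
    Finset.single_le_sum (f := fun Y : Scheme A => Y.flat.card + Y.nested.card)
      (fun _ _ => Nat.zero_le _) hY
  refine ⟨(6 * M + 6) + (6 * M + 6) + (((6 * M + 9) + 1) * X.sub.card + 1) + (6 * M + 4) + 2,
    fun R T r t hR hT => ?_⟩
  have hN1 : R.phys.len ≤ R.size X := Nat.le_add_right _ _
  have hN2 : T.phys.len ≤ T.size X := Nat.le_add_right _ _
  have hN3 : ∀ Y ∈ X.sub, (R.store Y).len ≤ R.size X := fun Y hY =>
    (Finset.single_le_sum (f := fun Y => (R.store Y).len) (fun _ _ => Nat.zero_le _) hY).trans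
      (Nat.le_add_left _ _)
  have hN4 : ∀ Y ∈ X.sub, (T.store Y).len ≤ T.size X := fun Y hY =>
    (Finset.single_le_sum (f := fun Y => (T.store Y).len) (fun _ _ => Nat.zero_le _) hY).trans
      (Nat.le_add_left _ _)
  have hR' := hR.toPreRep.compacted
  have hT' := hT.toPreRep.compacted
  set N := R.size X + T.size X with hN
  have hmX := hM X (Finset.mem_insert_self _ _)
  have hc : ∀ U : Shred A V, U.phys.len ≤ N →
      (compact X U.phys U.sel).time ≤ (6 * M + 6) * (N + 1) := fun U hU =>
    (time_compact X U.phys U.sel).trans (Nat.mul_le_mul (by omega) (by omega))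
  have hu : ∀ Y ∈ insert X X.sub, ∀ (S : Store A V) (P Q : Phys A V), P.HasColumns Y →
      Q.HasColumns Y → P.len + Q.len ≤ N →
      (fixHeads S Y Q).time + (Phys.concat Y P (fixHeads S Y Q).val).time ≤
        (6 * M + 4) * (N + 1) := fun Y hY S P Q hP hQ h =>
    (time_union hP hQ).trans (Nat.mul_le_mul (by have := hM Y hY; omega) (by omega))
  have hloop : (loop X.sub.toList (Store.empty A V) fun S Y => do
      let U ← fixHeads R.store Y (T.store Y)
      let O ← Phys.concat Y (R.store Y) U
      let m ← offset (R.store Y).len U.nxt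
      let m ← append (R.store Y).nxt m
      pure (Function.update S Y { O with nxt := m })).time ≤
        X.sub.toList.length * ((6 * M + 9) * (N + 1) + 1) + 1 := by
    refine time_loop_le _ fun Y hY S => ?_
    rw [Finset.mem_toList] at hY
    have h1 := hN3 Y hY
    have h2 := hN4 Y hY
    have h3 := hu Y (Finset.mem_insert_of_mem hY) R.store _ _ (hR.store.cols Y hY)
      (hT.store.cols Y hY) (by omega)
    have h4 := time_offset (R.store Y).len (T.store Y).nxt
    have h5 := hR.store.nxt Y hY
    have h6 := hT.store.nxt Y hY
    have h7 : (fixHeads R.store Y (T.store Y)).val.nxt = (T.store Y).nxt := by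
      rw [val_fixHeads]
    simp only [time_bind, time_pure, time_append, val_offset, size_shift, h7]
    rw [h6] at h4 ⊢
    rw [h5]
    have h8 : (6 * M + 9) * (N + 1) = (6 * M + 4) * (N + 1) + 5 * (N + 1) := by ring
    omega
  have h1 := hc R (by omega)
  have h2 := hc T (by omega)
  have h3 := hu X (Finset.mem_insert_self _ _) R.store _ _ hR'.cols hT'.cols (by
    have := len_compacted_le X R
    have := len_compacted_le X T
    omega)
  have h4 : (allSel ((R.compacted X).phys.union R.store X (T.compacted X).phys).len).time ≤
      2 * N + 1 := by
    refine (time_allSel _).trans ?_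
    rw [Phys.len_union]
    have := len_compacted_le X R
    have := len_compacted_le X T
    omega
  have ht : (physUnion X R T).time = (compact X R.phys R.sel).time +
      ((compact X T.phys T.sel).time + ((loop X.sub.toList (Store.empty A V) fun S Y => do
      let U ← fixHeads R.store Y (T.store Y)
      let O ← Phys.concat Y (R.store Y) U
      let m ← offset (R.store Y).len U.nxt
      let m ← append (R.store Y).nxt m
      pure (Function.update S Y { O with nxt := m })).time +
      ((fixHeads R.store X (T.compacted X).phys).time +
      ((Phys.concat X (R.compacted X).phys (fixHeads R.store X (T.compacted X).phys).val).time +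
      ((allSel ((R.compacted X).phys.union R.store X (T.compacted X).phys).len).time + 0))))) := rfl
  rw [ht]
  rw [Finset.length_toList] at hloop
  have h5 : X.sub.card * ((6 * M + 9) * (N + 1) + 1) + 1 ≤
      (((6 * M + 9) + 1) * X.sub.card + 1) * (N + 1) := by
    nlinarith [Nat.zero_le (X.sub.card * N)]
  have h6 : 2 * N + 1 ≤ 2 * (N + 1) := by omega
  calc _ ≤ (6 * M + 6) * (N + 1) + (6 * M + 6) * (N + 1) +
        (((6 * M + 9) + 1) * X.sub.card + 1) * (N + 1) + (6 * M + 4) * (N + 1) + 2 * (N + 1) := by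
        omega
    _ = _ := by ring

end

section

open Cost

/-! ### Flatten -/

section Sections

variable {ι : Type} [DecidableEq ι] {β : ι → Type} [∀ i, Inhabited (β i)]

/-- The choices of an element of `M i` for every `i` in `l`, in lexicographic order. -/
def choices : List ι → ((i : ι) → List (β i)) → List ((i : ι) → β i)
  | [], _ => [fun _ => default]
  | i :: l, M => (M i).flatMap fun m => (choices l M).map fun g => Function.update g i m

theorem length_choices (l : List ι) (M : (i : ι) → List (β i)) :
    (choices l M).length = (l.map fun i => (M i).length).prod := by
  induction l with
  | nil => rfl
  | cons i l ih => simp [choices, List.length_flatMap, ih]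

theorem coe_choices {l : List ι} (hl : l.Nodup) (m : Multiset ι) (hm : (l : Multiset ι) = m)
    (M : (i : ι) → List (β i)) :
    (choices l M : Multiset ((i : ι) → β i)) =
      (Multiset.pi m fun i => (M i : Multiset (β i))).map fun g i =>
        if h : i ∈ m then g i h else default := by
  subst hm
  induction l with
  | nil =>
    simp [choices, Multiset.pi_zero]
  | cons i l ih =>
    rw [List.nodup_cons] at hl
    rw [choices, ← Multiset.coe_bind, ← Multiset.cons_coe, Multiset.pi_cons, Multiset.map_bind]
    refine Multiset.bind_congr fun b _ => ?_
    rw [← Multiset.map_coe, ih hl.2, Multiset.map_map, Multiset.map_map]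
    refine Multiset.map_congr rfl fun g _ => ?_
    funext j
    simp only [Function.comp_apply]
    by_cases hj : j = i
    · subst hj
      rw [Function.update_self, dif_pos (Multiset.mem_cons_self _ _), Multiset.Pi.cons_same]
    · rw [Function.update_of_ne hj]
      by_cases hjl : j ∈ (l : Multiset ι)
      · rw [dif_pos hjl, dif_pos (Multiset.mem_cons_of_mem hjl), Multiset.Pi.cons_ne _ hj]
      · rw [dif_neg hjl, dif_neg (by simpa [hj] using hjl)]

theorem flatMap_const {γ δ : Type} (l : List γ) (x : List δ) :
    (l.flatMap fun _ => x) = (List.replicate l.length x).flatten := by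
  induction l with
  | nil => rfl
  | cons a l ih => simp [ih, List.replicate_succ]

theorem replicate_flatten_replicate {δ : Type} (a b : ℕ) (x : List δ) :
    (List.replicate a (List.replicate b x).flatten).flatten =
      (List.replicate (a * b) x).flatten := by
  induction a with
  | zero => simp
  | succ a ih =>
    rw [List.replicate_succ, List.flatten_cons, ih, Nat.succ_mul, Nat.add_comm,
      List.replicate_add, List.flatten_append]

theorem flatMap_flatten_replicate {γ δ : Type} (a : ℕ) (x : List γ) (f : γ → List δ) :
    (List.replicate a x).flatten.flatMap f = (List.replicate a (x.flatMap f)).flatten := by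
  induction a with
  | zero => simp
  | succ a ih => simp [List.replicate_succ, ih]

theorem flatMap_replicate_replicate {δ : Type} (b r : ℕ) (x : δ) :
    (List.replicate b x).flatMap (List.replicate r) = List.replicate (r * b) x := by
  induction b with
  | zero => simp
  | succ b ih =>
    rw [List.replicate_succ, List.flatMap_cons, ih, Nat.mul_succ, Nat.add_comm, List.replicate_add]

/-- The column of `i` in the list of choices. -/
theorem map_choices {pre post : List ι} {i : ι} (h : (pre ++ i :: post).Nodup)
    (M : (i : ι) → List (β i)) :
    (choices (pre ++ i :: post) M).map (fun g => g i) =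
      (List.replicate (pre.map fun j => (M j).length).prod
        ((M i).flatMap (List.replicate (post.map fun j => (M j).length).prod))).flatten := by
  induction pre with
  | nil =>
    simp only [List.nil_append, choices, List.map_flatMap, List.map_map, Function.comp_def,
      Function.update_self, List.map_nil, List.prod_nil, List.replicate_one, List.flatten_singleton,
      List.map_const', length_choices]
  | cons j pre ih =>
    rw [List.cons_append, List.nodup_cons] at h
    have hne : i ≠ j := by
      rintro rfl
      exact h.1 (by simp)
    simp only [List.cons_append, choices, List.map_flatMap, List.map_map, Function.comp_def,
      Function.update_of_ne hne]
    rw [ih h.2, flatMap_const, replicate_flatten_replicate, List.map_cons, List.prod_cons]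

end Sections

/-- Every row listed in `pr`, repeated as often as the second component says. -/
def expand {β : Type} (L : ℕ → List β) (pr : List (ℕ × ℕ)) : List β :=
  pr.flatMap fun p => (L p.1).flatMap fun g => List.replicate p.2 g

/-- The rows of the inner relations, repeated according to `a` and `b`. -/
def nestedRows (a b : ℕ → ℕ) (J : ℕ → List ℕ) (pr : List (ℕ × ℕ)) : List (ℕ × ℕ) :=
  pr.flatMap fun p => (List.replicate (a p.1) ((J p.1).map fun j => (j, p.2 * b p.1))).flatten

theorem length_expand {β : Type} (L : ℕ → List β) (pr : List (ℕ × ℕ)) :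
    (expand L pr).length = (pr.map fun p => p.2 * (L p.1).length).sum := by
  simp [expand, List.length_flatMap, Nat.mul_comm]

theorem mem_nestedRows {a b : ℕ → ℕ} {J : ℕ → List ℕ} {pr : List (ℕ × ℕ)} {q : ℕ × ℕ}
    (h : q ∈ nestedRows a b J pr) : ∃ p ∈ pr, q.1 ∈ J p.1 ∧ q.2 = p.2 * b p.1 := by
  simp only [nestedRows, List.mem_flatMap, List.mem_flatten, List.mem_replicate] at h
  obtain ⟨p, hp, l, ⟨_, rfl⟩, h⟩ := h
  obtain ⟨j, hj, rfl⟩ := List.mem_map.1 h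
  exact ⟨p, hp, hj, rfl⟩

theorem length_nestedRows (a b : ℕ → ℕ) (J : ℕ → List ℕ) (pr : List (ℕ × ℕ)) :
    (nestedRows a b J pr).length = (pr.map fun p => a p.1 * (J p.1).length).sum := by
  simp [nestedRows, List.length_flatMap]

theorem expand_nestedRows {β : Type} (L : ℕ → List β) (a b : ℕ → ℕ) (J : ℕ → List ℕ)
    (pr : List (ℕ × ℕ)) :
    expand L (nestedRows a b J pr) =
      pr.flatMap fun p => (List.replicate (a p.1) (((J p.1).flatMap L).flatMap
        (List.replicate (p.2 * b p.1)))).flatten := by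
  rw [expand, nestedRows, List.flatMap_assoc]
  congr 1
  funext p
  rw [flatMap_flatten_replicate, List.flatMap_map, List.flatMap_assoc]

variable {A V : Type} [Inhabited V]

/-- The result of flattening row `i` of `P`. -/
def flatRows (S : Store A V) (X : Scheme A) (P : Phys A V) (i : ℕ) : List (X.flatsub → V) :=
  (choices X.nested.attach.toList fun Y =>
      (itr P S Y.1 i).val.flatMap (flatRows S Y.1 (S Y.1))).map
    fun g a =>
      if h : a.1 ∈ X.flat then (P.col a.1).getD i default
      else g (Classical.choose (Tup.exists_of_mem_flatsub a h))
        ⟨a.1, Classical.choose_spec (Tup.exists_of_mem_flatsub a h)⟩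
termination_by X.size
decreasing_by exact Scheme.size_lt Y.2

/-- The result of flattening the inner relation `Y` of row `i` of `P`. -/
def innerRows (S : Store A V) (P : Phys A V) (i : ℕ) (Y : Scheme A) : List (Y.flatsub → V) :=
  (itr P S Y i).val.flatMap (flatRows S Y (S Y))

theorem flatRows_eq (S : Store A V) (X : Scheme A) (P : Phys A V) (i : ℕ) :
    flatRows S X P i = (choices X.nested.attach.toList fun Y => innerRows S P i Y.1).map
      fun g a =>
      if h : a.1 ∈ X.flat then (P.col a.1).getD i default
      else g (Classical.choose (Tup.exists_of_mem_flatsub a h))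
        ⟨a.1, Classical.choose_spec (Tup.exists_of_mem_flatsub a h)⟩ := by
  rw [flatRows]
  rfl

theorem Den.coe_flatRows {S : Store A V} {X : Scheme A} {P : Phys A V} {i : ℕ} {t : Tup V X}
    (h : Den S X P i t) :
    (flatRows S X P i : Multiset (X.flatsub → V)) = Tup.flatten X t := by
  induction X using Scheme.ind generalizing P i with
  | h X ih =>
    have hin : ∀ Y : X.nested, (innerRows S P i Y.1 : Multiset (Y.1.flatsub → V)) =
        (t.rel Y).1.bind (Tup.flatten Y.1) := by
      intro Y
      obtain ⟨-, g, hg, hrel⟩ := h.itr Y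
      rw [hrel, innerRows, ← Multiset.coe_bind, ← Multiset.map_coe, Multiset.bind_map]
      exact Multiset.bind_congr fun j hj => ih Y.1 Y.2 (hg j hj)
    rw [flatRows_eq, Tup.flatten, ← Multiset.map_coe, coe_choices (Finset.nodup_toList _) _
      (Finset.coe_toList _), Multiset.map_map]
    simp only [hin]
    refine Multiset.map_congr rfl fun g _ => ?_
    funext a
    simp only [Function.comp_apply]
    split_ifs with ha hmem
    · exact (den_iff.1 h).2.1 ⟨a.1, ha⟩
    · rfl
    · exact absurd (Finset.mem_attach X.nested _) hmem

theorem Den.wt_eq_length {S : Store A V} {X : Scheme A} {P : Phys A V} {i : ℕ} {t : Tup V X}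
    (h : Den S X P i t) (Y : X.nested) :
    (P.wt Y.1).getD i default = (innerRows S P i Y.1).length := by
  obtain ⟨-, g, hg, hrel⟩ := h.itr Y
  rw [h.wt_eq Y.2, Tup.relWeight_eq, hrel, innerRows, List.length_flatMap, Multiset.map_coe,
    Multiset.sum_coe, List.map_map]
  refine congrArg _ (List.map_congr_left fun j hj => ?_)
  exact congrArg Multiset.card (hg j hj).coe_flatRows.symm

theorem Den.length_flatRows {S : Store A V} {X : Scheme A} {P : Phys A V} {i : ℕ} {t : Tup V X}
    (h : Den S X P i t) : (flatRows S X P i).length = t.weight :=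
  congrArg Multiset.card h.coe_flatRows

theorem Den.innerRows_pos {S : Store A V} {X : Scheme A} {P : Phys A V} {i : ℕ} {t : Tup V X}
    (h : Den S X P i t) (Y : X.nested) : 0 < (innerRows S P i Y.1).length := by
  have h1 := t.weight_pos
  rw [Tup.weight_eq] at h1
  rw [← h.wt_eq_length Y, h.wt_eq Y.2]
  exact Nat.pos_of_ne_zero (Finset.prod_ne_zero_iff.1 h1.ne' Y.1 Y.2)

theorem Den.itr_pos {S : Store A V} {X : Scheme A} {P : Phys A V} {i : ℕ} {t : Tup V X}
    (h : Den S X P i t) (Y : X.nested) : 0 < (NSA.itr P S Y.1 i).val.length := by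
  have := h.innerRows_pos Y
  rw [innerRows] at this
  refine Nat.pos_of_ne_zero fun h0 => ?_
  rw [List.length_eq_zero_iff] at h0
  simp [h0] at this

/-- Restriction to the attributes of a nested scheme. -/
def restrictTo {X : Scheme A} (Y : X.nested) (g : X.flatsub → V) : Y.1.flatsub → V :=
  fun a => g ⟨a.1, Scheme.flatsub_subset_of_mem_nested Y.2 a.2⟩

theorem map_flatRows_nested {X : Scheme A} (hX : X.Linear) (S : Store A V) (P : Phys A V) (i : ℕ)
    {pre post : List X.nested} {Y : X.nested} (hl : X.nested.attach.toList = pre ++ Y :: post) :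
    (flatRows S X P i).map (restrictTo Y) =
      (List.replicate (pre.map fun Z => (innerRows S P i Z.1).length).prod
        ((innerRows S P i Y.1).flatMap
          (List.replicate (post.map fun Z => (innerRows S P i Z.1).length).prod))).flatten := by
  have hnd : (pre ++ Y :: post).Nodup := hl ▸ Finset.nodup_toList _
  rw [flatRows_eq, hl, ← map_choices hnd (fun Z => innerRows S P i Z.1), List.map_map]
  refine List.map_congr_left fun g _ => ?_
  funext a
  have ha : a.1 ∉ X.flat := fun h =>
    Finset.disjoint_left.1 (hX.disjoint_flat Y.2) h a.2
  simp only [Function.comp_apply, restrictTo, dif_neg ha]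
  generalize_proofs h1 h2
  have key : ∀ (Z : X.nested) (hZ : a.1 ∈ Z.1.flatsub), g Z ⟨a.1, hZ⟩ = g Y a := by
    intro Z hZ
    obtain rfl : Z = Y := by
      by_contra hne
      exact Finset.disjoint_left.1 (hX.disjoint_flatsub Z.2 Y.2 fun e => hne (Subtype.ext e)) hZ a.2
    rfl
  exact key _ _

/-- Flattening the inner relation `Y` of the rows in `pr`. -/
theorem expand_flatRows_nested {X : Scheme A} (hX : X.Linear) (S : Store A V) (P : Phys A V)
    (pr : List (ℕ × ℕ)) {pre post : List X.nested} {Y : X.nested}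
    (hl : X.nested.attach.toList = pre ++ Y :: post) :
    (expand (flatRows S X P) pr).map (restrictTo Y) =
      expand (flatRows S Y.1 (S Y.1)) (nestedRows
        (fun i => (pre.map fun Z => (innerRows S P i Z.1).length).prod)
        (fun i => (post.map fun Z => (innerRows S P i Z.1).length).prod)
        (fun i => (itr P S Y.1 i).val) pr) := by
  rw [expand_nestedRows, expand, List.map_flatMap]
  congr 1
  funext p
  have h1 : ((flatRows S X P p.1).flatMap fun g => List.replicate p.2 g).map (restrictTo Y) =
      ((flatRows S X P p.1).map (restrictTo Y)).flatMap (List.replicate p.2) := by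
    rw [List.map_flatMap, List.flatMap_map]
    congr 1
    funext g
    rw [List.map_replicate]
  rw [h1, map_flatRows_nested hX S P p.1 hl, flatMap_flatten_replicate, List.flatMap_assoc]
  simp only [flatMap_replicate_replicate]
  rfl

theorem expand_flatRows_flat (X : Scheme A) (S : Store A V) (P : Phys A V)
    (pr : List (ℕ × ℕ)) {a : A} (ha : a ∈ X.flat) :
    (expand (flatRows S X P) pr).map (fun g => g ⟨a, X.flat_subset_flatsub ha⟩) =
      (pr.flatMap fun p => List.replicate (p.2 * (flatRows S X P p.1).length) p.1).map
        fun i => (P.col a).getD i default := by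
  rw [expand, List.map_flatMap, List.map_flatMap]
  congr 1
  funext p
  rw [List.map_replicate, ← flatMap_replicate_replicate]
  have h1 : (flatRows S X P p.1).map (fun g => g ⟨a, X.flat_subset_flatsub ha⟩) =
      List.replicate (flatRows S X P p.1).length ((P.col a).getD p.1 default) := by
    rw [List.eq_replicate_iff]
    refine ⟨by simp, ?_⟩
    rw [flatRows_eq]
    simp [ha]
  rw [← h1, List.flatMap_map, List.map_flatMap]
  simp

end

section

open Cost

theorem range_eq_append_cons {n i : ℕ} {pre post : List ℕ} (h : List.range n = pre ++ i :: post) :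
    i = pre.length ∧ i < n := by
  have h1 : (List.range n)[pre.length]? = some i := by rw [h]; simp
  have h2 : pre.length < n := by
    have := congrArg List.length h
    simp at this
    omega
  rw [List.getElem?_range h2, Option.some_inj] at h1
  exact ⟨h1.symm, h1 ▸ h2⟩

/-- A loop over the rows of a table given by the list `l`. -/
theorem Cost.Sat.loop_range {β σ : Type} [Inhabited β] {n : ℕ} {s : σ} {body : σ → ℕ → Cost σ}
    (l : List β) (hn : n = l.length) (I : List β → σ → Prop) (b : β → ℕ) (h0 : I [] s)
    (h : ∀ pre q post s, l = pre ++ q :: post → I pre s →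
      Sat (body s pre.length) (I (pre ++ [q])) (b q)) :
    Sat (Cost.loop (List.range n) s body) (I l) ((l.map fun q => b q + 1).sum + 1) := by
  subst hn
  have := Sat.loop (l := List.range l.length) (s := s) (body := body)
    (fun pre s => I (l.take pre.length) s) (fun i => b (l.toArray.getD i default)) (by simpa using h0)
    (by
      intro pre i post s hl hI
      obtain ⟨rfl, hlt⟩ := range_eq_append_cons hl
      have h1 : l.toArray.getD pre.length default = l[pre.length] := by
        simp [Array.getD_eq_getD_getElem?, hlt]
      rw [h1]
      have h2 := h (l.take pre.length) l[pre.length] (l.drop (pre.length + 1)) s (by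
        rw [← List.drop_eq_getElem_cons, List.take_append_drop]) hI
      rw [List.length_take, min_eq_left hlt.le] at h2
      rw [List.length_append, List.length_singleton, List.take_add_one, List.getElem?_eq_getElem hlt]
      exact h2)
  refine this.mono (fun _ h => by simpa using h) ?_
  have h3 := map_range_getD l.toArray fun q => b q + 1
  rw [List.size_toArray] at h3
  rw [h3]

theorem getD_map_append_cons {β γ : Type} [Inhabited γ] (f : β → γ) (pre post : List β) (q : β) :
    ((pre ++ q :: post).map f).toArray.getD pre.length default = f q := by
  simp [Array.getD_eq_getD_getElem?]

theorem length_le_length_expand {β : Type} {L : ℕ → List β} {pr : List (ℕ × ℕ)}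
    (h : ∀ p ∈ pr, 0 < p.2 ∧ 0 < (L p.1).length) : pr.length ≤ (expand L pr).length := by
  rw [length_expand]
  induction pr with
  | nil => simp
  | cons p pr ih =>
    have h1 := h p (by simp)
    have h2 := ih fun q hq => h q (by simp [hq])
    have h3 := Nat.mul_pos h1.1 h1.2
    simp only [List.length_cons, List.map_cons, List.sum_cons]
    omega

variable {A V : Type}

theorem sat_divWeights (P : Phys A V) (Y : Scheme A) (w : Array ℕ) (hw : w.size = P.len) :
    Sat (loop (List.range P.len) w fun w i => do
        let m ← rd w i
        let n ← rd (P.wt Y) i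
        let k ← div m n
        wr w i k)
      (fun w' => w'.size = P.len ∧
        ∀ i < P.len, w'.getD i default = w.getD i default / (P.wt Y).getD i default)
      (P.len * 5 + 1) := by
  refine ⟨?_, (time_loop_le 4 (by simp)).trans (by simp)⟩
  rw [val_loop]
  obtain ⟨h1, h2⟩ := foldl_setIfInBounds_range
    (fun i m => m / (P.wt Y).getD i default) w P.len hw.ge
  refine ⟨h1.trans hw, fun i hi => ?_⟩
  have := h2 i
  rw [if_pos hi] at this
  exact this

variable [Inhabited V]

theorem sat_generate {S : Store A V} {X : Scheme A} {P : Phys A V} (O : Phys A V)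
    (pr : List (ℕ × ℕ)) (w : Array ℕ)
    (hw : ∀ p ∈ pr, w.getD p.1 default = (flatRows S X P p.1).length) :
    Sat (generate X P (pr.map Prod.fst).toArray (pr.map Prod.snd).toArray w O)
      (fun O' => O'.len = (expand (flatRows S X P) pr).length ∧
        (∀ a (ha : a ∈ X.flat), O'.col a = ((expand (flatRows S X P) pr).map fun g =>
          g ⟨a, X.flat_subset_flatsub ha⟩).toArray) ∧
        ∀ a, a ∉ X.flat → O'.col a = O.col a)
      ((6 * X.flat.card + 8) * ((expand (flatRows S X P) pr).length + pr.length + 1)) := by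
  have hlen : (pr.flatMap fun p => List.replicate (p.2 * (flatRows S X P p.1).length) p.1).length =
      (expand (flatRows S X P) pr).length := by
    rw [length_expand, List.length_flatMap]
    simp
  unfold generate
  refine Sat.mono (n := ((pr.map fun p => (4 + (2 * (p.2 * (flatRows S X P p.1).length) + 1)) +
      1).sum + 1) + (6 * (X.flat.card + (∅ : Finset (Scheme A)).card) + 2) *
        ((expand (flatRows S X P) pr).length + 1))
    (Sat.bind (Sat.loop_range pr (by simp)
      (fun l p => p = (l.flatMap fun p =>
        List.replicate (p.2 * (flatRows S X P p.1).length) p.1).toArray)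
      (fun p => 4 + (2 * (p.2 * (flatRows S X P p.1).length) + 1)) rfl ?_) ?_) (fun _ h => h) ?_
  · rintro pre q post p hl rfl
    have hq : q ∈ pr := by rw [hl]; simp
    have h1 := getD_map_append_cons Prod.fst pre post q
    have h2 := getD_map_append_cons Prod.snd pre post q
    rw [← hl] at h1 h2
    refine Sat.mono (n := 1 + (1 + (1 + (1 + (2 * (q.2 * (flatRows S X P q.1).length) + 1)))))
      (Sat.bind (Sat.self (time_rd _ _).le) ?_) (fun _ h => h) (by omega)
    rintro i rfl
    refine Sat.bind (Sat.self (time_rd _ _).le) ?_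
    rintro r rfl
    refine Sat.bind (Sat.self (time_rd _ _).le) ?_
    rintro wi rfl
    refine Sat.bind (Sat.self (time_mul _ _).le) ?_
    rintro n rfl
    rw [val_mul, val_rd, val_rd, val_rd, h1, h2, hw q hq]
    refine Sat.mono (Sat.loop_const (fun l s => s = (pre.flatMap fun p =>
        List.replicate (p.2 * (flatRows S X P p.1).length) p.1).toArray ++
      (List.replicate l.length q.1).toArray) 1 (by simp) ?_) ?_ (by simp)
    · rintro pre' _ _ s - rfl
      refine ⟨?_, le_rfl⟩
      rw [val_push]
      apply Array.toList_inj.1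
      simp [List.replicate_add]
    · rintro s rfl
      apply Array.toList_inj.1
      simp
  · rintro p rfl
    have hsize : (pr.flatMap fun p =>
        List.replicate (p.2 * (flatRows S X P p.1).length) p.1).toArray.size =
          (expand (flatRows S X P) pr).length := by rw [List.size_toArray, hlen]
    rw [← hsize]
    refine Sat.mono (Sat.self (Phys.time_takeInto _ _ _ _ _)) ?_ le_rfl
    rintro O' rfl
    rw [Phys.val_takeInto]
    refine ⟨rfl, fun a ha => ?_, fun a ha => ?_⟩
    · simp only [ha, if_true]
      rw [gather_toArray, expand_flatRows_flat _ _ _ _ ha]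
    · simp only [ha, if_false]
  · have h1 : (pr.map fun p => (4 + (2 * (p.2 * (flatRows S X P p.1).length) + 1)) + 1).sum =
        2 * (expand (flatRows S X P) pr).length + 6 * pr.length := by
      rw [length_expand, ← sum_map_const_add]
      refine congrArg _ (List.map_congr_left fun p _ => ?_)
      ring
    rw [h1, Finset.card_empty]
    nlinarith [Nat.zero_le (X.flat.card * pr.length),
      Nat.zero_le (X.flat.card * (expand (flatRows S X P) pr).length)]

/-- `O'` contains the columns of the relation `rows` over the flat attributes in `X`. -/
structure Flattened (X : Scheme A) (rows : List (X.flatsub → V)) (O O' : Phys A V) : Prop where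
  len : O'.len = rows.length
  col : ∀ a (ha : a ∈ X.flatsub), O'.col a = (rows.map fun g => g ⟨a, ha⟩).toArray
  other : ∀ a, a ∉ X.flatsub → O'.col a = O.col a

/-- One row of the loop that computes the positions and repetitions for the next attribute. -/
theorem sat_nestedRows {X : Scheme A} {S : Store A V} {P : Phys A V} (Y : X.nested)
    (pr : List (ℕ × ℕ)) (hpr : ∀ p ∈ pr, ∃ t, Den S X P p.1 t) (a b : ℕ → ℕ) (w out : Array ℕ)
    (hw : ∀ p ∈ pr, w.getD p.1 default = b p.1)
    (hout : out = (pr.map fun p => a p.1).toArray) :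
    Sat (loop (List.range (pr.map Prod.fst).toArray.size)
        ((#[], #[], out) : Array ℕ × Array ℕ × Array ℕ) fun (npos, nrep, out) row => do
      let i ← rd (pr.map Prod.fst).toArray row
      let r ← rd (pr.map Prod.snd).toArray row
      let wi ← rd w i
      let m ← mul r wi
      let n ← rd out row
      let (npos, nrep) ← loop (List.range n) (npos, nrep) fun (npos, nrep) _ => do
        let js ← itr P S Y.1 i
        loop js (npos, nrep) fun (npos, nrep) j => do
          let npos ← push npos j
          let nrep ← push nrep m
          pure (npos, nrep)
      let v ← rd (P.wt Y.1) i
      let n ← mul n v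
      let out ← wr out row n
      pure (npos, nrep, out))
      (fun s => s = (((nestedRows a b (fun i => (itr P S Y.1 i).val) pr).map Prod.fst).toArray,
        ((nestedRows a b (fun i => (itr P S Y.1 i).val) pr).map Prod.snd).toArray,
        (pr.map fun p => a p.1 * (innerRows S P p.1 Y.1).length).toArray))
      (9 * (nestedRows a b (fun i => (itr P S Y.1 i).val) pr).length + 10 * pr.length + 1) := by
  refine Sat.mono (Sat.loop_range pr (by simp)
    (fun l s => s.1 = ((nestedRows a b (fun i => (itr P S Y.1 i).val) l).map Prod.fst).toArray ∧
      s.2.1 = ((nestedRows a b (fun i => (itr P S Y.1 i).val) l).map Prod.snd).toArray ∧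
      ∀ post, pr = l ++ post → s.2.2 = ((l.map fun p => a p.1 * (innerRows S P p.1 Y.1).length) ++
        post.map fun p => a p.1).toArray)
    (fun q => 8 + ((5 * (itr P S Y.1 q.1).val.length + 3 + 1) * a q.1 + 1)) ?_ ?_) ?_ ?_
  · refine ⟨rfl, rfl, ?_⟩
    rintro post rfl
    exact hout
  · rintro pre q post ⟨npos, nrep, out⟩ hl ⟨e1, e2, e3⟩
    dsimp only at e1 e2 e3
    have hq : q ∈ pr := by rw [hl]; simp
    obtain ⟨t, ht⟩ := hpr q hq
    have h1 := getD_map_append_cons Prod.fst pre post q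
    have h2 := getD_map_append_cons Prod.snd pre post q
    rw [← hl] at h1 h2
    replace e3 := e3 _ hl
    have h3 : out.getD pre.length default = a q.1 := by
      rw [e3]
      simp [Array.getD_eq_getD_getElem?]
    refine Sat.mono (n := 1 + (1 + (1 + (1 + (1 + (((5 * (itr P S Y.1 q.1).val.length + 3 + 1) *
      a q.1 + 1) + (1 + (1 + (1 + 0))))))))) (Sat.bind (Sat.self (time_rd _ _).le) ?_)
      (fun _ h => h) (by omega)
    rintro i rfl
    refine Sat.bind (Sat.self (time_rd _ _).le) ?_
    rintro r rfl
    refine Sat.bind (Sat.self (time_rd _ _).le) ?_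
    rintro wi rfl
    refine Sat.bind (Sat.self (time_mul _ _).le) ?_
    rintro m rfl
    refine Sat.bind (Sat.self (time_rd _ _).le) ?_
    rintro n rfl
    rw [val_mul, val_rd, val_rd, val_rd, val_rd, h1, h2, h3, hw q hq]
    refine Sat.bind (Sat.mono (Sat.loop_const (fun l s =>
      s.1 = npos ++ ((List.replicate l.length (itr P S Y.1 q.1).val).flatten).toArray ∧
      s.2 = nrep ++ ((List.replicate l.length ((itr P S Y.1 q.1).val.map fun _ =>
        q.2 * b q.1)).flatten).toArray) (5 * (itr P S Y.1 q.1).val.length + 3) (by simp) ?_)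
        (fun _ h => h) (by simp)) ?_
    · rintro pre' _ _ ⟨p', r'⟩ - ⟨e4, e5⟩
      dsimp only at e4 e5
      refine Sat.mono (n := 2 * (itr P S Y.1 q.1).val.length + 2 +
        ((2 + 1) * (itr P S Y.1 q.1).val.length + 1))
        (Sat.bind (Sat.self (ht.itr Y).1.le) ?_) (fun _ h => h) (by omega)
      rintro js rfl
      refine Sat.mono (Sat.loop_const (fun k s => s.1 = p' ++ k.toArray ∧
        s.2 = r' ++ (k.map fun _ => q.2 * b q.1).toArray) 2 (by simp) ?_) ?_ le_rfl
      · rintro pre'' j _ ⟨p'', r''⟩ - ⟨e6, e7⟩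
        dsimp only at e6 e7
        subst e6 e7
        refine ⟨⟨?_, ?_⟩, by simp⟩
        · change (p' ++ pre''.toArray).push j = _
          exact Array.toList_inj.1 (by simp)
        · change (r' ++ (pre''.map fun _ => q.2 * b q.1).toArray).push (q.2 * b q.1) = _
          exact Array.toList_inj.1 (by simp)
      · rintro ⟨p'', r''⟩ ⟨e6, e7⟩
        dsimp only at e6 e7
        subst e4 e5 e6 e7
        rw [List.length_append, List.length_singleton, List.replicate_add, List.replicate_add,
          List.flatten_append, List.flatten_append]
        constructor <;> simp
    · rintro ⟨p', r'⟩ ⟨e4, e5⟩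
      dsimp only at e4 e5
      rw [List.length_range] at e4 e5
      refine Sat.bind (Sat.self (time_rd _ _).le) ?_
      rintro v rfl
      refine Sat.bind (Sat.self (time_mul _ _).le) ?_
      rintro n rfl
      refine Sat.bind (Sat.self (time_wr _ _ _).le) ?_
      rintro out' rfl
      refine Sat.pure ⟨?_, ?_, ?_⟩
      · rw [e4, e1]
        simp [nestedRows, Function.comp_def]
      · rw [e5, e2]
        simp [nestedRows, Function.comp_def]
      · intro post' hl'
        have : post' = post := by simpa [hl] using hl'.symm
        subst this
        dsimp only
        rw [val_wr, val_mul, val_rd, ht.wt_eq_length Y, e3]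
        apply Array.toList_inj.1
        simp
  · rintro ⟨npos, nrep, out'⟩ ⟨e1, e2, e3⟩
    dsimp only at e1 e2 e3
    rw [e1, e2, e3 [] (by simp)]
    simp
  · rw [length_nestedRows]
    have : (pr.map fun q => 8 + ((5 * (itr P S Y.1 q.1).val.length + 3 + 1) * a q.1 + 1) + 1).sum ≤
        (pr.map fun q => 9 * (a q.1 * (itr P S Y.1 q.1).val.length) + 10).sum := by
      refine List.sum_le_sum fun q hq => ?_
      obtain ⟨t, ht⟩ := hpr q hq
      have := Nat.mul_le_mul_left (a q.1) (ht.itr_pos Y)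
      nlinarith
    rw [sum_map_const_add] at this
    omega

end

section

open Cost

variable {A V : Type} [Inhabited V]

/-- The state of `rflatten` after the attributes in `pre` have been treated. -/
structure FlattenInv (S : Store A V) (X : Scheme A) (P : Phys A V) (pr : List (ℕ × ℕ))
    (O : Phys A V) (pre : List X.nested) (s : Phys A V × Array ℕ × Array ℕ) : Prop where
  len : s.1.len = (expand (flatRows S X P) pr).length
  col : ∀ a (ha : a ∈ X.flatsub), (a ∈ X.flat ∨ ∃ Y ∈ pre, a ∈ Y.1.flatsub) →
    s.1.col a = ((expand (flatRows S X P) pr).map fun g => g ⟨a, ha⟩).toArray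
  other : ∀ a, a ∉ X.flatsub → s.1.col a = O.col a
  size : s.2.1.size = P.len
  weight : ∀ p ∈ pr, ∀ post, X.nested.attach.toList = pre ++ post →
    s.2.1.getD p.1 default = (post.map fun Z => (innerRows S P p.1 Z.1).length).prod
  out : s.2.2 =
    (pr.map fun p => (pre.map fun Z => (innerRows S P p.1 Z.1).length).prod).toArray

theorem Den.multiplyWeights {S : Store A V} {X : Scheme A} {P : Phys A V} {i : ℕ} {t : Tup V X}
    (h : Den S X P i t) : (multiplyWeights P X).val.getD i default =
      (X.nested.attach.toList.map fun Z => (innerRows S P i Z.1).length).prod := by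
  rw [(val_multiplyWeights P X).2 i h.lt_len, Finset.prod_map_toList, ← Finset.prod_attach]
  exact Finset.prod_congr rfl fun Y _ => h.wt_eq_length Y

/-- Flattening the inner relations of one nested attribute. -/
theorem sat_rflatten_step {X : Scheme A} (hX : X.Linear) {S : Store A V} {P : Phys A V}
    {O : Phys A V} {pr : List (ℕ × ℕ)} (hpr : ∀ p ∈ pr, 0 < p.2 ∧ ∃ t, Den S X P p.1 t)
    {pre post : List X.nested} {Y : X.nested} (hl : X.nested.attach.toList = pre ++ Y :: post)
    {c : ℕ} (hc : ∀ (O : Phys A V) (pr : List (ℕ × ℕ)),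
      (∀ p ∈ pr, 0 < p.2 ∧ ∃ t, Den S Y.1 (S Y.1) p.1 t) →
      Sat (rflatten S Y.1 (S Y.1) (pr.map Prod.fst).toArray (pr.map Prod.snd).toArray O)
        (Flattened Y.1 (expand (flatRows S Y.1 (S Y.1)) pr) O)
        (c * ((S Y.1).len + ∑ Z ∈ Y.1.sub, (S Z).len +
          (expand (flatRows S Y.1 (S Y.1)) pr).length + 1)))
    {O' : Phys A V} {w out : Array ℕ} (hI : FlattenInv S X P pr O pre (O', w, out)) :
    Sat (do
      let w ← loop (List.range P.len) w fun w i => do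
        let m ← rd w i
        let n ← rd (P.wt Y.1) i
        let k ← div m n
        wr w i k
      let (npos, nrep, out) ← loop (List.range (pr.map Prod.fst).toArray.size)
          ((#[], #[], out) : Array ℕ × Array ℕ × Array ℕ) fun (npos, nrep, out) row => do
        let i ← rd (pr.map Prod.fst).toArray row
        let r ← rd (pr.map Prod.snd).toArray row
        let wi ← rd w i
        let m ← mul r wi
        let n ← rd out row
        let (npos, nrep) ← loop (List.range n) (npos, nrep) fun (npos, nrep) _ => do
          let js ← itr P S Y.1 i
          loop js (npos, nrep) fun (npos, nrep) j => do
            let npos ← push npos j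
            let nrep ← push nrep m
            pure (npos, nrep)
        let v ← rd (P.wt Y.1) i
        let n ← mul n v
        let out ← wr out row n
        pure (npos, nrep, out)
      let O ← rflatten S Y.1 (S Y.1) npos nrep O'
      pure (O, w, out))
      (FlattenInv S X P pr O (pre ++ [Y]))
      ((c + 21) * (P.len + ∑ Z ∈ X.sub, (S Z).len +
        (expand (flatRows S X P) pr).length + 1)) := by
  set a : ℕ → ℕ := fun i => (pre.map fun Z => (innerRows S P i Z.1).length).prod with ha
  set b : ℕ → ℕ := fun i => (post.map fun Z => (innerRows S P i Z.1).length).prod with hb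
  set np := nestedRows a b (fun i => (itr P S Y.1 i).val) pr with hnp
  have hrows := expand_flatRows_nested hX S P pr hl
  rw [← hnp] at hrows
  have hlen : (expand (flatRows S Y.1 (S Y.1)) np).length =
      (expand (flatRows S X P) pr).length := by rw [← hrows, List.length_map]
  have hb_pos : ∀ p ∈ pr, 0 < b p.1 := by
    intro p hp
    obtain ⟨t, ht⟩ := (hpr p hp).2
    refine List.prod_pos fun n hn => ?_
    obtain ⟨Z, -, rfl⟩ := List.mem_map.1 hn
    exact ht.innerRows_pos Z
  have hden : ∀ q ∈ np, 0 < q.2 ∧ ∃ t, Den S Y.1 (S Y.1) q.1 t := by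
    intro q hq
    obtain ⟨p, hp, hj, e⟩ := mem_nestedRows hq
    obtain ⟨h0, t, ht⟩ := hpr p hp
    obtain ⟨-, g, hg, -⟩ := ht.itr Y
    exact ⟨e ▸ Nat.mul_pos h0 (hb_pos p hp), _, hg _ hj⟩
  have hpr_len : pr.length ≤ (expand (flatRows S X P) pr).length := by
    refine length_le_length_expand fun p hp => ?_
    obtain ⟨h0, t, ht⟩ := hpr p hp
    exact ⟨h0, ht.length_flatRows ▸ t.weight_pos⟩
  have hnp_len : np.length ≤ (expand (flatRows S X P) pr).length := by
    rw [← hlen]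
    refine length_le_length_expand fun p hp => ?_
    obtain ⟨h0, t, ht⟩ := hden p hp
    exact ⟨h0, ht.length_flatRows ▸ t.weight_pos⟩
  have hsum : (S Y.1).len + ∑ Z ∈ Y.1.sub, (S Z).len ≤ ∑ Z ∈ X.sub, (S Z).len := by
    rw [← Finset.sum_insert (f := fun Z => (S Z).len) (Scheme.notMem_sub_self Y.1)]
    exact Finset.sum_le_sum_of_subset (Scheme.Linear.insert_sub_subset Y.2)
  refine Sat.mono (n := (P.len * 5 + 1) + ((9 * np.length + 10 * pr.length + 1) +
    (c * ((S Y.1).len + ∑ Z ∈ Y.1.sub, (S Z).len +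
      (expand (flatRows S Y.1 (S Y.1)) np).length + 1) + 0)))
    (Sat.bind (sat_divWeights P Y.1 w hI.size) ?_) (fun _ h => h) ?_
  · rintro w' ⟨hs, hw'⟩
    have hw : ∀ p ∈ pr, w'.getD p.1 default = b p.1 := by
      intro p hp
      obtain ⟨t, ht⟩ := (hpr p hp).2
      rw [hw' _ ht.lt_len, hI.weight p hp _ hl, ht.wt_eq_length Y, List.map_cons, List.prod_cons,
        Nat.mul_div_cancel_left _ (ht.innerRows_pos Y)]
    refine Sat.bind (sat_nestedRows Y pr (fun p hp => (hpr p hp).2) a b w' out hw hI.out) ?_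
    rintro _ rfl
    refine Sat.bind (hc O' np hden) ?_
    rintro O'' hO
    refine Sat.pure ⟨hO.len.trans hlen, ?_, ?_, hs, ?_, ?_⟩
    · intro x hx hx'
      by_cases hxY : x ∈ Y.1.flatsub
      · refine (hO.col x hxY).trans ?_
        rw [← hrows, List.map_map]
        rfl
      · refine (hO.other x hxY).trans (hI.col x hx ?_)
        rcases hx' with h | ⟨Z, hZ, h⟩
        · exact Or.inl h
        · rcases List.mem_append.1 hZ with hZ | hZ
          · exact Or.inr ⟨Z, hZ, h⟩
          · rw [List.mem_singleton.1 hZ] at h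
            exact absurd h hxY
    · intro x hx
      exact (hO.other x fun h => hx (Scheme.flatsub_subset_of_mem_nested Y.2 h)).trans
        (hI.other x hx)
    · intro p hp post' hl'
      rw [hl, List.append_assoc, List.append_cancel_left_eq, List.singleton_append] at hl'
      obtain rfl : post = post' := by simpa using hl'
      exact hw p hp
    · simp [ha]
  · rw [hlen]
    have h1 := Nat.mul_le_mul_left c hsum
    generalize ∑ Z ∈ X.sub, (S Z).len = n at *
    have h2 := Nat.zero_le (c * P.len)
    nlinarith

/-- Flattening is correct, and takes time linear in the size of its input and output. -/
theorem sat_rflatten {X : Scheme A} (hX : X.Linear) : ∃ c, ∀ (S : Store A V) (P O : Phys A V)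
    (pr : List (ℕ × ℕ)), (∀ p ∈ pr, 0 < p.2 ∧ ∃ t, Den S X P p.1 t) →
      Sat (rflatten S X P (pr.map Prod.fst).toArray (pr.map Prod.snd).toArray O)
        (Flattened X (expand (flatRows S X P) pr) O)
        (c * (P.len + ∑ Z ∈ X.sub, (S Z).len + (expand (flatRows S X P) pr).length + 1)) := by
  induction X using Scheme.ind with
  | h X ih =>
    choose c hc using fun Y : X.nested => ih Y.1 Y.2 (hX.of_mem_nested Y.2)
    refine ⟨(7 * X.nested.card + 2) + (12 * X.flat.card + 16) + 1 +
      (X.nested.attach.toList.map fun Y => c Y + 22).sum + 1, fun S P O pr hpr => ?_⟩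
    set N := P.len + ∑ Z ∈ X.sub, (S Z).len + (expand (flatRows S X P) pr).length with hN
    have hpr_len : pr.length ≤ (expand (flatRows S X P) pr).length := by
      refine length_le_length_expand fun p hp => ?_
      obtain ⟨h0, t, ht⟩ := hpr p hp
      exact ⟨h0, ht.length_flatRows ▸ t.weight_pos⟩
    have hw : ∀ p ∈ pr, (multiplyWeights P X).val.getD p.1 default =
        (X.nested.attach.toList.map fun Z => (innerRows S P p.1 Z.1).length).prod := by
      intro p hp
      obtain ⟨t, ht⟩ := (hpr p hp).2
      exact ht.multiplyWeights
    rw [rflatten]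
    refine Sat.mono (n := (7 * X.nested.card + 2) * (P.len + 1) +
      ((6 * X.flat.card + 8) * ((expand (flatRows S X P) pr).length + pr.length + 1) +
        ((pr.length + 1) +
          (((X.nested.attach.toList.map fun Y => (c Y + 21) * (N + 1) + 1).sum + 1) + 0))))
      (Sat.bind (Sat.self (time_multiplyWeights P X)) ?_) (fun _ h => h) ?_
    · rintro w rfl
      refine Sat.bind (sat_generate O pr _ ?_) ?_
      · intro p hp
        rw [hw p hp, flatRows_eq, List.length_map, length_choices]
      rintro O' ⟨h1, h2, h3⟩
      refine Sat.bind (Sat.self (n := pr.length + 1) (by simp)) ?_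
      rintro out rfl
      refine Sat.bind (Sat.loop (FlattenInv S X P pr O) (fun Y => (c Y + 21) * (N + 1)) ?_ ?_) ?_
      · refine ⟨h1, ?_, ?_, (val_multiplyWeights P X).1, ?_, ?_⟩
        · rintro a ha (h | ⟨Y, hY, -⟩)
          · exact h2 a h
          · simp at hY
        · exact fun a ha => h3 a fun h => ha (X.flat_subset_flatsub h)
        · rintro p hp post hpost
          rw [List.nil_append] at hpost
          rw [← hpost]
          exact hw p hp
        · simp
      · rintro pre Y post ⟨O', w, out⟩ hl hI
        exact sat_rflatten_step hX hpr hl (fun O pr h => hc Y S (S Y.1) O pr h) hI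
      · rintro ⟨O', w, out⟩ hI
        refine Sat.pure ⟨hI.len, fun a ha => hI.col a ha ?_, hI.other⟩
        rcases Scheme.mem_flatsub.1 ha with h | ⟨Y, hY, h⟩
        · exact Or.inl h
        · exact Or.inr ⟨⟨Y, hY⟩, by simp, h⟩
    · have h1 : (X.nested.attach.toList.map fun Y => (c Y + 21) * (N + 1) + 1).sum ≤
          (X.nested.attach.toList.map fun Y => c Y + 22).sum * (N + 1) := by
        rw [← List.sum_map_mul_right]
        refine List.sum_le_sum fun Y _ => ?_
        nlinarith
      have h2 : (7 * X.nested.card + 2) * (P.len + 1) ≤ (7 * X.nested.card + 2) * (N + 1) :=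
        Nat.mul_le_mul_left _ (by omega)
      have h3 : (6 * X.flat.card + 8) * ((expand (flatRows S X P) pr).length + pr.length + 1) ≤
          (6 * X.flat.card + 8) * (2 * (N + 1)) := Nat.mul_le_mul_left _ (by omega)
      have h4 : pr.length + 1 ≤ N + 1 := by omega
      nlinarith

end

section

open Cost

variable {A V : Type}

theorem size_of_isFlat {X : Scheme A} (hX : X.IsFlat) (R : Shred A V) :
    R.size X = R.phys.len := by
  rw [Shred.size, hX.sub_eq, Finset.sum_empty, add_zero]

theorem Expr.inCard_left {Sym : Type} {sch : Sym → Finset A} {τ₁ τ₂ τ' : Ty A}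
    (f : Op2 A V τ₁ τ₂ τ') (e₁ : Expr V sch τ₁) (e₂ : Expr V sch τ₂) (db : Database V sch) :
    e₁.inCard db ≤ (Expr.app2 f e₁ e₂).inCard db :=
  Finset.sum_le_sum_of_subset Finset.subset_union_left

theorem Expr.inCard_right {Sym : Type} {sch : Sym → Finset A} {τ₁ τ₂ τ' : Ty A}
    (f : Op2 A V τ₁ τ₂ τ') (e₁ : Expr V sch τ₁) (e₂ : Expr V sch τ₂) (db : Database V sch) :
    e₂.inCard db ≤ (Expr.app2 f e₁ e₂).inCard db :=
  Finset.sum_le_sum_of_subset Finset.subset_union_right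

/-- A tuple over `flatsub(X)`. -/
def Tup.ofRow {X : Scheme A} (g : X.flatsub → V) : Tup V (.ofFlat X.flatsub) :=
  Tup.mkFlat (show Scheme.IsFlat _ from Scheme.nested_ofFlat _) g

variable [Inhabited V]

theorem Den.eq_mkFlat {S : Store A V} {X : Scheme A} {P : Phys A V} {i : ℕ} {t : Tup V X}
    (h : Den S X P i t) (hX : X.IsFlat) :
    t = Tup.mkFlat hX fun a => (P.col a.1).getD i default := by
  rw [Tup.eq_mkFlat hX t]
  congr 1
  funext a
  exact ((den_iff.1 h).2.1 a).symm

/-- A represented flat relation is represented by its rows. -/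
theorem Phys.Represents.rep {X : Scheme A} {P : Phys A V} {hX : X.IsFlat} {r : Rel V X}
    (h : P.Represents hX r) (S : Store A V) : Shred.Rep X ⟨P, S, Array.range P.len⟩ r := by
  have hX' : X.nested = ∅ := hX
  refine ⟨⟨⟨h.1, by simp [hX'], by simp [hX']⟩, ⟨by simp [hX.sub_eq], by simp [hX.sub_eq]⟩,
    by simpa using List.pairwise_lt_range,
    fun i => Tup.mkFlat hX fun a => (P.col a.1).getD i default, fun i hi => ?_, ?_⟩, fun _ => rfl⟩
  · rw [Array.toList_range, List.mem_range] at hi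
    exact den_iff.2 ⟨hi, by simp, fun Y => absurd Y.2 (by simp [hX'])⟩
  · rw [h.2, Array.toList_range]
    rfl

theorem Shred.Rep.represents {X : Scheme A} {R : Shred A V} {r : Rel V X} (h : R.Rep X r)
    (hX : X.IsFlat) : R.Represents hX r := by
  have hsel := h.flat hX
  refine ⟨⟨h.cols.col, ?_⟩, hsel⟩
  obtain ⟨f, hf, rfl⟩ := h.rows
  rw [hsel, Array.toList_range] at hf ⊢
  rw [List.map_congr_left fun i hi => (hf i hi).eq_mkFlat hX]
  rfl

/-- Correctness and running time of flatten. -/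
theorem physFlatten_spec {X : Scheme A} (hX : X.Linear) :
    ∃ c, ∀ (R : Shred A V) (r : Rel V X), R.Rep X r →
      (physFlatten X R).val.Rep (.ofFlat X.flatsub)
        (r.bind fun s => (Tup.flatten X s).map Tup.ofRow) ∧
      (physFlatten X R).val.size (.ofFlat X.flatsub) = Multiset.card
        (r.bind fun s => (Tup.flatten X s).map Tup.ofRow) ∧
      (physFlatten X R).time ≤ c * (R.size X + Multiset.card
        (r.bind fun s => (Tup.flatten X s).map Tup.ofRow) + 1) := by
  obtain ⟨c, hc⟩ := sat_rflatten (V := V) hX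
  refine ⟨c + 3, fun R r h => ?_⟩
  obtain ⟨f, hf, hr⟩ := h.rows
  set pr := R.sel.toList.map fun i => (i, 1) with hpr
  set rows := expand (flatRows R.store X R.phys) pr with hrows
  set out := r.bind fun s => (Tup.flatten X s).map Tup.ofRow with hout
  have hbind : out = (rows.map Tup.ofRow : List (Tup V (.ofFlat X.flatsub))) := by
    have h1 : rows = R.sel.toList.flatMap (flatRows R.store X R.phys) := by
      simp [hrows, hpr, expand, List.flatMap_map]
    rw [hout, hr, h1, List.map_flatMap, ← Multiset.map_coe, Multiset.bind_map,
      ← Multiset.coe_bind]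
    refine Multiset.bind_congr fun i hi => ?_
    rw [← (hf i hi).coe_flatRows, Multiset.map_coe]
  have hcard : Multiset.card out = rows.length := by rw [hbind]; simp
  have hsat : Sat (physFlatten X R)
      (fun T => ∃ O, Flattened X rows (Phys.new A V 0) O ∧
        T = ⟨O, Store.empty A V, Array.range O.len⟩)
      (R.sel.size + 1 + (c * (R.size X + rows.length + 1) + (2 * rows.length + 1 + 0))) := by
    unfold physFlatten
    refine Sat.bind (Sat.self (time_fill _ _).le) ?_
    rintro rep rfl
    have h1 : R.sel = (pr.map Prod.fst).toArray := by
      simp [hpr, Function.comp_def]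
    have h2 : (fill R.sel.size 1).val = (pr.map Prod.snd).toArray := by
      apply Array.toList_inj.1
      simp [hpr, Function.comp_def]
    rw [h2]
    refine Sat.bind (Q := Flattened X rows (Phys.new A V 0)) ?_ ?_
    · nth_rw 1 [h1]
      refine hc R.store R.phys _ pr fun p hp => ?_
      obtain ⟨i, hi, rfl⟩ := List.mem_map.1 hp
      exact ⟨one_pos, _, hf i hi⟩
    · intro O hO
      refine Sat.bind (Sat.self (n := 2 * rows.length + 1) (hO.len ▸ time_allSel _)) ?_
      rintro s rfl
      exact Sat.pure ⟨O, hO, by rw [val_allSel]⟩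
  obtain ⟨⟨O, hO, hval⟩, htime⟩ := hsat
  rw [hval, hcard]
  refine ⟨Phys.Represents.rep (hX := Scheme.nested_ofFlat _) ⟨?_, ?_⟩ _, ?_, htime.trans ?_⟩
  · intro a ha
    rw [hO.col a ha, hO.len]
    simp
  · rw [hbind, hO.len]
    refine congrArg _ (List.ext_getElem (by simp) fun i h1 h2 => ?_)
    rw [List.length_map] at h1
    simp only [List.getElem_map, List.getElem_range]
    rw [Tup.ofRow]
    congr 1
    funext a
    rw [hO.col a.1 a.2]
    simp [Array.getD_eq_getD_getElem?, h1]
  · rw [size_of_isFlat (Scheme.nested_ofFlat _), hO.len]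
  · have h1 := h.size_sel
    have h2 : R.phys.len ≤ R.size X := Nat.le_add_right _ _
    nlinarith

/-! ## Evaluation of expressions -/

/-- Every unary operator is implemented correctly, in time linear in the size of its input, and
in the cardinality of its output if it is an unnest or a flatten. -/
theorem Op1.phys_spec {τ τ' : Ty A} (f : Op1 A V τ τ') (hτ : τ.Linear) :
    ∃ c, ∀ (v : PVal V τ) (r : Val V τ), PVal.Rep v r → PVal.Rep (f.phys v).val (f.sem r) ∧
      ∀ n, (f.IsUnnest → Val.card (f.sem r) ≤ n) →
        PVal.size (f.phys v).val ≤ c * (PVal.size v + n + 1) ∧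
          (f.phys v).time ≤ c * (PVal.size v + n + 1) := by
  cases f with
  | select X y hy θ =>
    refine ⟨(y.card + 11 + 6 * (X.flat.card + X.nested.card)) + 1, fun (v : Shred A V) r h =>
      ⟨rep_physSelect hy θ h, fun n _ => ⟨?_, ?_⟩⟩⟩
    · exact (size_physSelect X y θ v).trans (by change v.size X ≤ _ * (v.size X + n + 1); nlinarith)
    · refine (time_physSelect X y θ v (Shred.Rep.toPreRep h).size_sel).trans
        (Nat.mul_le_mul (by omega) ?_)
      have h2 : v.phys.len ≤ v.size X := Nat.le_add_right _ _
      change _ ≤ v.size X + n + 1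
      omega
  | project X Y hY =>
    refine ⟨(7 * Y.flat.card + 8 * Y.nested.card + X.sub.card + 8) + 1, fun (v : Shred A V) r h =>
      ⟨rep_physProject hY h, fun n _ => ⟨?_, ?_⟩⟩⟩
    · exact (size_physProject hY v).trans (by change v.size X ≤ _ * (v.size X + n + 1); nlinarith)
    · refine (time_physProject X Y v).trans (Nat.mul_le_mul (by omega) ?_)
      have h2 : v.phys.len ≤ v.size X := Nat.le_add_right _ _
      change _ ≤ v.size X + n + 1
      omega
  | rename X φ =>
    refine ⟨X.flatsub.card + 3 * X.sub.card + 1, fun (v : Shred A V) r h =>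
      ⟨rep_physRename φ h, fun n _ => ⟨?_, ?_⟩⟩⟩
    · refine (size_physRename φ X v).trans_le ?_
      change v.size X ≤ _ * (v.size X + n + 1)
      nlinarith
    · exact Nat.le_mul_of_pos_right _ (Nat.succ_pos _)
  | groupBy X y hy =>
    refine ⟨(9 * X.nested.card + y.card + X.flat.card + 20) + 1, fun (v : Shred A V) r h =>
      ⟨rep_physGroupBy hy h, fun n _ => ⟨?_, ?_⟩⟩⟩
    · refine (size_physGroupBy h).trans_le ?_
      change v.size X ≤ _ * (v.size X + n + 1)
      nlinarith
    · refine (sat_physGroupBy y (Shred.Rep.toPreRep h)).2.trans (Nat.mul_le_mul (by omega) ?_)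
      have h2 : v.phys.len ≤ v.size X := Nat.le_add_right _ _
      change _ ≤ v.size X + n + 1
      omega
  | unnest X Y hY =>
    refine ⟨(6 * (X.flat.card + X.nested.card + Y.flat.card + Y.nested.card) + 20) + 1,
      fun (v : Shred A V) r h => ?_⟩
    obtain ⟨h1, h2, h3⟩ := physUnnest_spec hτ hY h
    have h4 : v.phys.len ≤ v.size X := Nat.le_add_right _ _
    refine ⟨h1, fun n hn => ⟨h2.trans ?_, h3.trans (Nat.mul_le_mul (by omega) ?_)⟩⟩
    · have := Nat.add_le_add_left (hn trivial) (v.size X)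
      refine this.trans ?_
      change _ ≤ _ * (v.size X + n + 1)
      nlinarith
    · exact Nat.add_le_add_right (Nat.add_le_add h4 (hn trivial)) 1
  | flatten X =>
    obtain ⟨c, hc⟩ := physFlatten_spec (V := V) hτ
    refine ⟨c + 1, fun (v : Shred A V) r h => ?_⟩
    obtain ⟨h1, h2, h3⟩ := hc v r h
    refine ⟨h1, fun n hn => ⟨h2.trans_le ((hn trivial).trans ?_),
      h3.trans (Nat.mul_le_mul (by omega) ?_)⟩⟩
    · change _ ≤ _ * (v.size X + n + 1)
      nlinarith
    · exact Nat.add_le_add_right (Nat.add_le_add_left (hn trivial) _) 1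

/-- Every binary operator is implemented correctly, in time linear in the size of its inputs. -/
theorem Op2.phys_spec {τ₁ τ₂ τ' : Ty A} (f : Op2 A V τ₁ τ₂ τ') :
    ∃ c, ∀ (v : PVal V τ₁) (w : PVal V τ₂) (r : Val V τ₁) (s : Val V τ₂),
      PVal.Rep v r → PVal.Rep w s → PVal.Rep (f.phys v w).val (f.sem r s) ∧
        PVal.size (f.phys v w).val ≤ c * (PVal.size v + PVal.size w + 1) ∧
          (f.phys v w).time ≤ c * (PVal.size v + PVal.size w + 1) := by
  cases f with
  | union X =>
    obtain ⟨c, hc⟩ := time_physUnion (V := V) X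
    refine ⟨c + 1, fun (v w : Shred A V) r s hv hw => ⟨rep_physUnion hv hw, ?_, ?_⟩⟩
    · refine (size_physUnion X v w).trans ?_
      change _ ≤ _ * (v.size X + w.size X + 1)
      nlinarith
    · exact (hc v w r s hv hw).trans (Nat.mul_le_mul_right _ (Nat.le_succ _))
  | diff X hX =>
    refine ⟨8 * X.flat.card + 20, fun (v w : Shred A V) r s hv hw => ?_⟩
    obtain ⟨h1, h2, h3⟩ := physDiff_spec hX hv hw
    refine ⟨h1, h2.trans ?_, h3.trans (Nat.mul_le_mul_left _ (Nat.add_le_add_right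
      (Nat.add_le_add (Nat.le_add_right _ _) (Nat.le_add_right _ _)) 1))⟩
    change _ ≤ _ * (v.size X + w.size X + 1)
    nlinarith
  | semijoin X y Z hy hflat hsub =>
    refine ⟨y.card + X.sub.card + Z.sub.card + 14, fun (v : Shred A V) (w : ShredDict A V y) r s
      hv hw => ⟨rep_physSemijoin hy hsub hv hw, ?_, ?_⟩⟩
    · refine (size_physSemijoin hsub w (Shred.Rep.toPreRep hv)).trans_le ?_
      change _ ≤ _ * (v.size X + w.size Z + 1)
      nlinarith
    · refine (sat_physSemijoin y Z w (Shred.Rep.toPreRep hv)).2.trans (Nat.mul_le_mul_left _ ?_)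
      have h2 : v.phys.len ≤ v.size X := Nat.le_add_right _ _
      change _ ≤ v.size X + w.size Z + 1
      omega

/-- Every 2-phase expression is evaluated correctly, in time linear in its input, and in its
output if it contains an unnest or a flatten. -/
theorem Expr.run_spec {Sym : Type} {sch : Sym → Finset A} {τ : Ty A} (e : Expr V sch τ)
    (he : e.TwoPhase) :
    ∃ c, ∀ (db : Database V sch) (pdb : Sym → Phys A V),
      (∀ R, (pdb R).Represents (Scheme.nested_ofFlat (sch R)) (db R)) →
        PVal.Rep (e.run pdb).val (e.eval db) ∧
          ∀ n, (e.HasUnnest → Val.card (e.eval db) ≤ n) →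
            PVal.size (e.run pdb).val ≤ c * (e.inCard db + n + 1) ∧
              (e.run pdb).time ≤ c * (e.inCard db + n + 1) := by
  induction e with
  | base R =>
    refine ⟨(sch R).card + 4, fun db pdb hdb => ?_⟩
    have h := hdb R
    have hlen : (pdb R).len = Multiset.card (db R) := by
      have := congrArg Multiset.card h.2
      simpa using this.symm
    have hin : (Expr.base (V := V) (sch := sch) R).inCard db = (pdb R).len := by
      rw [hlen]
      exact Finset.sum_singleton _ _
    have hrep : ((pdb R).columns (.ofFlat (sch R))).val.Represents
        (Scheme.nested_ofFlat (sch R)) (db R) := by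
      refine ⟨fun a ha => ?_, ?_⟩
      · refine Eq.trans ?_ (h.1 a ha)
        simp [Phys.columns, ha]
      · refine h.2.trans (Multiset.map_congr rfl fun i _ => ?_)
        congr 1
        funext a
        simp [Phys.columns, a.2]
    have hval : ((Expr.base (V := V) (sch := sch) R).run pdb).val =
        (⟨((pdb R).columns (.ofFlat (sch R))).val, Store.empty A V,
          Array.range (pdb R).len⟩ : Shred A V) := by
      simp only [Expr.run, val_bind, val_allSel, val_pure]
      rfl
    rw [hval]
    refine ⟨hrep.rep _, fun n _ => ⟨?_, ?_⟩⟩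
    · refine (size_of_isFlat (Scheme.nested_ofFlat _) _).trans_le ?_
      rw [hin]
      change (pdb R).len ≤ _
      nlinarith
    · rw [hin]
      have h1 := time_allSel (pdb R).len
      have h2 : ((Expr.base (V := V) (sch := sch) R).run pdb).time =
          ((Scheme.ofFlat (sch R)).flat.card + 2 * (Scheme.ofFlat (sch R)).nested.card + 1) +
            ((allSel (pdb R).len).time + 0) := rfl
      have h3 : (Scheme.ofFlat (sch R)).flat.card = (sch R).card := rfl
      rw [h2, Scheme.nested_ofFlat, Finset.card_empty, h3]
      nlinarith
  | app1 f e ih =>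
    obtain ⟨c, hc⟩ := ih he.1
    obtain ⟨d, hd⟩ := f.phys_spec e.linear
    refine ⟨d * (c + 1) + c, fun db pdb hdb => ?_⟩
    obtain ⟨h1, h2⟩ := hc db pdb hdb
    obtain ⟨h3, h4⟩ := hd _ _ h1
    refine ⟨h3, fun n hn => ?_⟩
    obtain ⟨h5, h6⟩ := h2 n fun hu => (he.2 hu _).trans (hn (Or.inr hu))
    obtain ⟨h7, h8⟩ := h4 n fun hu => hn (Or.inl hu)
    have h9 : PVal.size (e.run pdb).val + n + 1 ≤ (c + 1) * (e.inCard db + n + 1) := by nlinarith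
    have h10 := Nat.mul_le_mul_left d h9
    have h11 : (Expr.app1 f e).inCard db = e.inCard db := rfl
    have h12 : ((Expr.app1 f e).run pdb).time =
        (e.run pdb).time + (f.phys (e.run pdb).val).time := rfl
    rw [h11, h12, add_mul, mul_assoc]
    exact ⟨(h7.trans h10).trans (Nat.le_add_right _ _),
      (add_le_add h6 (h8.trans h10)).trans_eq (add_comm _ _)⟩
  | app2 f e₁ e₂ ih₁ ih₂ =>
    obtain ⟨c₁, hc₁⟩ := ih₁ he.1
    obtain ⟨c₂, hc₂⟩ := ih₂ he.2.1
    obtain ⟨d, hd⟩ := f.phys_spec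
    refine ⟨d * (c₁ + c₂ + 1) + (c₁ + c₂), fun db pdb hdb => ?_⟩
    obtain ⟨h1, h2⟩ := hc₁ db pdb hdb
    obtain ⟨h1', h2'⟩ := hc₂ db pdb hdb
    obtain ⟨h3, h7, h8⟩ := hd _ _ _ _ h1 h1'
    refine ⟨h3, fun n hn => ?_⟩
    obtain ⟨h5, h6⟩ := h2 n fun hu =>
      (le_max_left _ _).trans ((he.2.2 (Or.inl hu) _ _).trans (hn (Or.inl hu)))
    obtain ⟨h5', h6'⟩ := h2' n fun hu =>
      (le_max_right _ _).trans ((he.2.2 (Or.inr hu) _ _).trans (hn (Or.inr hu)))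
    have h9 := Nat.mul_le_mul_left c₁
      (Nat.add_le_add_right (Expr.inCard_left f e₁ e₂ db) (n + 1))
    have h9' := Nat.mul_le_mul_left c₂
      (Nat.add_le_add_right (Expr.inCard_right f e₁ e₂ db) (n + 1))
    simp only [← add_assoc] at h9 h9'
    have h10 : PVal.size (e₁.run pdb).val + PVal.size (e₂.run pdb).val + 1 ≤
        (c₁ + c₂ + 1) * ((Expr.app2 f e₁ e₂).inCard db + n + 1) := by
      rw [add_mul, add_mul]
      omega
    have h11 := Nat.mul_le_mul_left d h10
    have h12 : ((Expr.app2 f e₁ e₂).run pdb).time = (e₁.run pdb).time +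
        ((e₂.run pdb).time + (f.phys (e₁.run pdb).val (e₂.run pdb).val).time) := rfl
    rw [h12, add_mul, mul_assoc]
    refine ⟨(h7.trans h11).trans (Nat.le_add_right _ _), ?_⟩
    rw [add_mul c₁ c₂]
    omega

end

end NSA

end

theorem mainTheorem1 {A V Sym : Type} [Inhabited V] (sch : Sym → Finset A) {X : NSA.Scheme A}
    (hX : X.IsFlat) (e : NSA.Expr V sch (.rel X)) (he : e.TwoPhase) :
    ∃ c : ℕ, ∀ (db : NSA.Database V sch) (pdb : Sym → NSA.Phys A V),
      (∀ R, (pdb R).Represents (NSA.Scheme.nested_ofFlat (sch R)) (db R)) →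
        NSA.Shred.Represents (e.run pdb).val hX (e.eval db) ∧
          (e.run pdb).time ≤ c * (e.inCard db + (e.eval db).card + 1) := by
  obtain ⟨c, hc⟩ := e.run_spec he
  refine ⟨c, fun db pdb hdb => ?_⟩
  obtain ⟨h1, h2⟩ := hc db pdb hdb
  exact ⟨NSA.Shred.Rep.represents h1 hX, (h2 _ fun _ => le_rfl).2⟩
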